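/- Let $n\ge 0$ be an integer and $q>0$ a real number. Let $\Delta_{-1}=0$, $\Delta_0=1$, $\Delta_{k+1}=q\Delta_k-\Delta_{k-1}$, suppose that $\Delta_k(q)\neq 0$ for $0\le k\le n-1$, and put $\mu_k=\Delta_{k-1}/\Delta_k$. **Setting.** For $0\le p\le\lfloor n/2\rfloor$ let $U(n;p)$ be the complex vector space with basis $\xi_{\mathfrak a}$ indexed by the noncrossing half-diagrams $\mathfrak a$ on the points $1,\dots,n$ with $p$ arches and $n-2p$ through-strings. Let $TL_n=TL_n(q)$ be the Temperley–Lieb algebra with basis $e_{\mathfrak p}$ indexed by the noncrossing pairings $\mathfrak p$ of $\{1,\dots,2n\}$, with the product given by concatenation of diagrams (every closed loop contributing a factor $q$), generators $e_1,\dots,e_{n-1}$, and the conjugate-linear involution $e_{\mathfrak p}^*=e_{\mathfrak p^t}$, where $\mathfrak p^t$ is $\mathfrak p$ with the points renumbered $i\mapsto 2n-i+1$. It acts on $U(n;p)$ by concatenation, where a concatenation that joins two through-strings of the half-diagram is $0$. Let $\langle\cdot,\cdot\rangle$ be the sesquilinear form on $U(n;p)$ for which $\langle\xi_{\mathfrak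 a},\xi_{\mathfrak b}\rangle$ is $0$ if gluing $\mathfrak a$ to $\mathfrak b$ joins two through-strings of the same half-diagram, and $q^c$ with $c$ the number of closed loops otherwise. For half-diagrams $\mathfrak a,\mathfrak b$ on $n$ points with the same number of arches, $\mathfrak a\otimes\mathfrak b$ is the pairing of $\{1,\dots,2n\}$ with left half $\mathfrak a$ and right half $\mathfrak b$ (point $i$ of $\mathfrak b$ being point $2n-i+1$); it exists and is unique, and every noncrossing pairing of $\{1,\dots,2n\}$ is $\mathfrak a\otimes\mathfrak b$ for exactly one $(\mathfrak a,\mathfrak b)$. Reading a half-diagram as a lattice path (an up-step at a through-string or at the smaller end of an arch, a down-step at the larger end), let $h_i(\mathfrak a)$ be the height after $i$ steps; if the path of $\mathfrak a$ has a minimum at $i$, let $\Diamond_i(\mathfrak a)$ be obtained by turning that minimum into a maximum. The second basis of $U(n;p)$ is given by $\xi'_{\mathfrak a}=\xi_{\mathfrak a}$ if $\mathfrak a$ is the half-diagram with arches $\{1,2\},\dots,\{2p-1,2p\}$, and $\xi'_{\Diamond_i(\mathfrak a)}=(e_i-\mu_{h_i(\mathfrak a)+1})\,\xi'_{\mathfrak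 a}$ whenever $\mathfrak a$ has a minimum at $i$; this determines a unique family, which is a basis of $U(n;p)$. The same construction on $U(2n;n)$, which is identified with $TL_n$ by $\xi_{\mathfrak p}\leftrightarrow e_{\mathfrak p}$, gives a basis $e'_{\mathfrak p}$ of $TL_n$. Put $N_{\mathfrak a}=\langle\xi'_{\mathfrak a},\xi'_{\mathfrak a}\rangle$, and let $E_{\mathfrak a\mathfrak b}$ be the elementary matrices in the direct sum $\bigoplus_{p=0}^{\lfloor n/2\rfloor}M_{c_{n,n-2p}}(\mathbb C)$, the rows and columns of the $p$-th block being indexed by the $c_{n,n-2p}=\binom np-\binom n{p-1}$ half-diagrams with $p$ arches. **Theorem.** 1. Every $N_{\mathfrak a}$ is a nonzero real number. For $\mathfrak a,\mathfrak b$ with the same number of arches, $e'_{\mathfrak a\otimes\mathfrak b}\,\xi'_{\mathfrak b}=N_{\mathfrak b}\,\xi'_{\mathfrak a}$, and $e'_{\mathfrak a\otimes\mathfrak b}\,\xi'_{\mathfrak c}=0$ for all half-diagrams $\mathfrak c\ne\mathfrak b$ on $n$ points, with any number of arches. Moreover $(e'_{\mathfrak a\otimes\mathfrak b})^*=e'_{\mathfrak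 b\otimes\mathfrak a}$. 2. Sending $x\in TL_n$ to the matrices of its action on the spaces $U(n;p)$ with respect to the bases $\xi'_{\mathfrak a}$ is an isomorphism of unital algebras $TL_n\to\bigoplus_{p}M_{c_{n,n-2p}}(\mathbb C)$, under which $e'_{\mathfrak a\otimes\mathfrak b}\mapsto N_{\mathfrak b}E_{\mathfrak a\mathfrak b}$. 3. Choose complex numbers $s_{\mathfrak a}$ with $s_{\mathfrak a}^2=N_{\mathfrak a}$ and use the bases $\hat\xi_{\mathfrak a}=\xi'_{\mathfrak a}/s_{\mathfrak a}$ instead. Then $\langle\hat\xi_{\mathfrak a},\hat\xi_{\mathfrak b}\rangle=\delta_{\mathfrak a\mathfrak b}\,\varepsilon_{\mathfrak a}$ with $\varepsilon_{\mathfrak a}=\operatorname{sign}N_{\mathfrak a}\in\{1,-1\}$, and the matrices of the action give an isomorphism of unital algebras $\Phi:TL_n\to\bigoplus_pM_{c_{n,n-2p}}(\mathbb C)$ with $$\Phi(e'_{\mathfrak a\otimes\mathfrak b})=s_{\mathfrak a}s_{\mathfrak b}E_{\mathfrak a\mathfrak b},\qquad \Phi\big((e'_{\mathfrak a\otimes\mathfrak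 b})^*\big)=s_{\mathfrak a}s_{\mathfrak b}E_{\mathfrak b\mathfrak a}.$$ It is a $*$-homomorphism when the $p$-th block carries the involution $M\mapsto J_pM^{\mathsf H}J_p$, where $M^{\mathsf H}$ is the conjugate transpose and $J_p=\operatorname{diag}(\varepsilon_{\mathfrak a})$, that is, the adjoint with respect to $\langle\cdot,\cdot\rangle$ in the normalised basis. In particular, if $\Delta_k(q)>0$ for $0\le k\le n-1$, then $\Phi$ is a $*$-homomorphism for the conjugate transpose. -/

import Mathlib

noncomputable section

namespace TemperleyLieb

/-- A noncrossing half-diagram on `n` points with `p` arches and `n - 2 * p` through-strings.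
`partner i` is the point paired with `i`, and `partner i = i` means that there is a through-string
at `i`. A crossing is a configuration `i < k < partner i < partner k`, or a through-string at some
`k` with `i < k < partner i`. Points are numbered from `0`. -/
@[ext]
structure HalfDiagram (n p : ℕ) where
  partner : Fin n → Fin n
  invol : ∀ i, partner (partner i) = i
  noncrossing : ∀ i k, i < k → k < partner i → partner k ≠ k ∧ ¬ partner i < partner k
  card_through : (Finset.univ.filter fun i => partner i = i).card + 2 * p = n

namespace HalfDiagram

variable {n p : ℕ}

instance : DecidableEq (HalfDiagram n p) := fun a b =>
  decidable_of_iff (a.partner = b.partner) HalfDiagram.ext_iff.symm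

instance : Fintype (HalfDiagram n p) :=
  Fintype.ofInjective HalfDiagram.partner fun _ _ h => HalfDiagram.ext h

/-- There is a through-string at the point `i`. -/
def IsThrough (a : HalfDiagram n p) (i : Fin n) : Prop := a.partner i = i

/-- The bracket at the point `i` is an opening bracket: `i` is paired with a larger point, or
carries a through-string. Otherwise it is a closing bracket. -/
def IsOpening (a : HalfDiagram n p) (i : Fin n) : Prop := i ≤ a.partner i

instance (a : HalfDiagram n p) : DecidablePred a.IsOpening := fun i =>
  inferInstanceAs (Decidable (i ≤ a.partner i))

/-- The height of the associated Dyck path after `k` steps: the number of opening brackets minus the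
number of closing brackets among the first `k` brackets. -/
def height (a : HalfDiagram n p) (k : ℕ) : ℤ :=
  ((Finset.univ.filter fun j : Fin n => (j : ℕ) < k ∧ a.IsOpening j).card : ℤ) -
    ((Finset.univ.filter fun j : Fin n => (j : ℕ) < k ∧ ¬ a.IsOpening j).card : ℤ)

/-- The minimal half-diagram, with restricted sequence `(1, …, 1)`: its `p` arches are not nested
and precede all through-strings, so they join the points `2 t` and `2 t + 1` for `t < p`. -/
def IsMinimal (a : HalfDiagram n p) : Prop :=
  ∀ i : Fin n, (a.partner i : ℕ) =
    if (i : ℕ) < 2 * p then (if (i : ℕ) % 2 = 0 then (i : ℕ) + 1 else (i : ℕ) - 1) else (i : ℕ)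

/-- `b` is the result of box addition on `a` at the points `i` and `i + 1`: there `a` has a closing
bracket followed by an opening bracket (the path has a minimum after `i + 1` steps), and `b` has an
opening bracket followed by a closing bracket; all other brackets agree. -/
def IsBoxAddition (i : ℕ) (hi : i + 1 < n) (a b : HalfDiagram n p) : Prop :=
  ¬ a.IsOpening ⟨i, by omega⟩ ∧ a.IsOpening ⟨i + 1, hi⟩ ∧
  b.IsOpening ⟨i, by omega⟩ ∧ ¬ b.IsOpening ⟨i + 1, hi⟩ ∧
  ∀ j : Fin n, (j : ℕ) ≠ i → (j : ℕ) ≠ i + 1 → (b.IsOpening j ↔ a.IsOpening j)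

/-- The diagram obtained by renumbering the points in the reverse order. -/
def transpose (a : HalfDiagram n p) : HalfDiagram n p where
  partner i := (a.partner i.rev).rev
  invol i := by simp [a.invol]
  noncrossing i k hik hk := by
    have h1 : k.rev < i.rev := Fin.rev_lt_rev.mpr hik
    have h2 : a.partner i.rev < k.rev := by
      have := Fin.rev_lt_rev.mpr hk
      simpa using this
    have h3 := a.noncrossing (a.partner i.rev) k.rev h2 (by rw [a.invol]; exact h1)
    refine ⟨fun h => h3.1 ?_, fun h => ?_⟩
    · have := congrArg Fin.rev h
      simpa using this
    · have h4 : a.partner k.rev < a.partner i.rev := Fin.rev_lt_rev.mp h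
      have h5 := a.noncrossing (a.partner k.rev) (a.partner i.rev) h4
        (by rw [a.invol]; exact h2)
      exact h5.2 (by rw [a.invol, a.invol]; exact h1)
  card_through := by
    have h : (Finset.univ.filter fun i : Fin n => (a.partner i.rev).rev = i).card =
        (Finset.univ.filter fun i : Fin n => a.partner i = i).card := by
      refine Finset.card_bij (fun i _ => i.rev) ?_ ?_ ?_
      · intro i hi
        have := congrArg Fin.rev (Finset.mem_filter.mp hi).2
        simpa using this
      · intro i _ j _ h
        exact Fin.rev_injective h
      · intro i hi
        refine ⟨i.rev, ?_, by simp⟩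
        simpa using (Finset.mem_filter.mp hi).2
    rw [h]
    exact a.card_through

end HalfDiagram

/-- A noncrossing pairing of `2 n` points: a half-diagram on `2 n` points without through-strings.
As a strand diagram, its left points are `Fin.castAdd n i` and its right points are
`(Fin.castAdd n i).rev`, for `i : Fin n`, both from top to bottom. -/
abbrev Pairing (n : ℕ) := HalfDiagram (n + n) n

namespace Pairing

/-- The diagram in which each left point is joined to the right point opposite to it. -/
def one (n : ℕ) : Pairing n where
  partner i := i.rev
  invol i := Fin.rev_rev i
  noncrossing i k hik hk := by
    simp only [Fin.lt_def, Fin.val_rev, ne_eq, Fin.ext_iff] at *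
    omega
  card_through := by
    have h : (Finset.univ.filter fun i : Fin (n + n) => i.rev = i) = ∅ := by
      ext i
      simp only [Fin.ext_iff, Fin.val_rev, Finset.mem_filter, Finset.mem_univ, true_and,
        Finset.notMem_empty, iff_false]
      omega
    rw [h, Finset.card_empty]
    omega

/-- The diagram of the generator: the left points `i` and `i + 1` are joined, the right points `i`
and `i + 1` are joined, and every other left point is joined to the right point opposite to it. -/
def gen (n i : ℕ) (hi : i + 1 < n) : Pairing n where
  partner x :=
    ⟨if (x : ℕ) = i then i + 1
      else if (x : ℕ) = i + 1 then i
      else if (x : ℕ) = n + n - 1 - i then n + n - 1 - (i + 1)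
      else if (x : ℕ) = n + n - 1 - (i + 1) then n + n - 1 - i
      else n + n - 1 - x, by split_ifs <;> omega⟩
  invol x := by
    have hx := x.isLt
    rw [Fin.ext_iff]
    dsimp only
    split_ifs <;> omega
  noncrossing x y := by
    have hx := x.isLt
    have hy := y.isLt
    simp only [Fin.lt_def, ne_eq, Fin.ext_iff]
    intro h1 h2
    constructor
    · clear h1 h2
      split_ifs <;> omega
    · split_ifs at h2 ⊢ <;> omega
  card_through := by
    rw [Finset.filter_eq_empty_iff.mpr, Finset.card_empty]
    · omega
    · intro x _
      have hx := x.isLt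
      rw [Fin.ext_iff]
      dsimp only
      split_ifs <;> omega

/-- Places the left points of a strand diagram in column `s` and its right points in column `t`. -/
def place {m n : ℕ} (s t : Fin m) : Fin (n + n) → Fin m × Fin n :=
  Fin.addCases (fun i => (s, i)) (fun i => (t, i.rev))

/-- `P` is the pairing `a ⊗ b`: its left half is `a` and its right half is `b`. -/
def IsTensor {n p : ℕ} (a b : HalfDiagram n p) (P : Pairing n) : Prop :=
  ∀ i j : Fin n, i ≠ j →
    (P.partner (Fin.castAdd n i) = Fin.castAdd n j ↔ a.partner i = j) ∧
    (P.partner (Fin.castAdd n i).rev = (Fin.castAdd n j).rev ↔ b.partner i = j)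

end Pairing

/-- Two vertices lie in the same connected component of the graph with edge relation `r`; the
connected components are the elements of `Quot r`. -/
def Joined {V : Type} (r : V → V → Prop) (u v : V) : Prop := Quot.mk r u = Quot.mk r v

/-- The number of connected components of the graph with edge relation `r` that contain no vertex
of `E`. In the concatenations below, `E` is the set of all ends of paths, so that these components
are the closed loops. -/
def loops {V : Type} (r : V → V → Prop) (E : Set V) : ℕ :=
  Nat.card {C : Quot r // ∀ v ∈ E, Quot.mk r v ≠ C}

section Multiplication

variable {n : ℕ}

/-- The concatenation of the strand diagrams `P` and `Q`: `P` is drawn between the columns `0`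
and `1`, and `Q` between the columns `1` and `2`, so that the right points of `P` are identified with
the left points of `Q`. -/
def mulEdge (P Q : Pairing n) (u v : Fin 3 × Fin n) : Prop :=
  (∃ x, u = Pairing.place 0 1 x ∧ v = Pairing.place 0 1 (P.partner x)) ∨
  (∃ x, u = Pairing.place 1 2 x ∧ v = Pairing.place 1 2 (Q.partner x))

/-- `R` is the diagram left when the closed loops and the identified points are deleted from the
concatenation of `P` and `Q`. -/
def IsMulResult (P Q R : Pairing n) : Prop :=
  ∀ x y : Fin (n + n), x ≠ y →
    (R.partner x = y ↔ Joined (mulEdge P Q) (Pairing.place 0 2 x) (Pairing.place 0 2 y))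

open Classical in
/-- The coefficient of `e_R` in `e_P e_Q`. -/
def mulCoeff (q : ℝ) (P Q R : Pairing n) : ℂ :=
  if IsMulResult P Q R then
    (q : ℂ) ^ loops (mulEdge P Q) (Set.range (Pairing.place 0 2))
  else 0

end Multiplication

/-- The space `U(n; p)` of formal complex linear combinations of the half-diagrams on `n` points
with `p` arches, where `Pi.single a 1` is the basis element `ξ_a`. -/
abbrev U (n p : ℕ) : Type := HalfDiagram n p → ℂ

/-- The Temperley-Lieb algebra `TL_n(q)`: formal complex linear combinations of the noncrossing
pairings of `2 n` points. -/
def TL (n : ℕ) (_q : ℝ) : Type := Pairing n → ℂ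

namespace TL

variable {n : ℕ} {q : ℝ}

instance : AddCommGroup (TL n q) := inferInstanceAs (AddCommGroup (Pairing n → ℂ))

instance : Module ℂ (TL n q) := inferInstanceAs (Module ℂ (Pairing n → ℂ))

/-- The identification of `U(2 n; n)` with `TL_n(q)`, which sends `ξ_P` to `e_P`. -/
def ofU (n : ℕ) (q : ℝ) : U (n + n) n ≃ₗ[ℂ] TL n q := LinearEquiv.refl ℂ (Pairing n → ℂ)

/-- The basis element `e_P`. -/
def e (q : ℝ) (P : Pairing n) : TL n q := ofU n q (Pi.single P 1)

/-- The coefficient of `e_P`. -/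
def coeff (x : TL n q) (P : Pairing n) : ℂ := (ofU n q).symm x P

instance : One (TL n q) := ⟨e q (Pairing.one n)⟩

/-- The bilinear extension of the concatenation product of diagrams. -/
instance : Mul (TL n q) :=
  ⟨fun x y => ofU n q fun R => ∑ P, ∑ Q, x.coeff P * y.coeff Q * mulCoeff q P Q R⟩

/-- The conjugate-linear involution with `e_P ↦ e_{Pᵗ}`. -/
instance : Star (TL n q) :=
  ⟨fun x => ofU n q fun P => (starRingEnd ℂ) (x.coeff P.transpose)⟩

/-- The generator, numbered from `0`: here `i` and `i + 1` are the two points that are joined. -/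
def gen (q : ℝ) (i : ℕ) (hi : i + 1 < n) : TL n q := e q (Pairing.gen n i hi)

end TL

section Action

variable {n p : ℕ}

/-- The concatenation of a strand diagram `P`, drawn between the columns `0` and `1`, and a
half-diagram `a` on the points of column `1`. -/
def actEdge (P : Pairing n) (a : HalfDiagram n p) (u v : Fin 2 × Fin n) : Prop :=
  (∃ x, u = Pairing.place 0 1 x ∧ v = Pairing.place 0 1 (P.partner x)) ∨
  (∃ i, u = (1, i) ∧ v = (1, a.partner i))

/-- Some path of the concatenation joins two through-strings of `a`. -/
def ActVanishes (P : Pairing n) (a : HalfDiagram n p) : Prop :=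
  ∃ i j : Fin n, i ≠ j ∧ a.IsThrough i ∧ a.IsThrough j ∧ Joined (actEdge P a) (1, i) (1, j)

/-- `b` is the half-diagram left when the closed loops and the identified points are deleted from
the concatenation of `P` and `a`. -/
def IsActResult (P : Pairing n) (a b : HalfDiagram n p) : Prop :=
  ∀ i j : Fin n, i ≠ j → (b.partner i = j ↔ Joined (actEdge P a) (0, i) (0, j))

open Classical in
/-- The coefficient of `ξ_b` in `e_P ξ_a`. -/
def actCoeff (q : ℝ) (P : Pairing n) (a b : HalfDiagram n p) : ℂ :=
  if ¬ ActVanishes P a ∧ IsActResult P a b then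
    (q : ℂ) ^ loops (actEdge P a) {v | v.1 = 0 ∨ a.IsThrough v.2}
  else 0

/-- The action of `TL_n(q)` on `U(n; p)`. -/
def act {q : ℝ} (x : TL n q) (ξ : U n p) : U n p :=
  fun b => ∑ P, ∑ a, x.coeff P * ξ a * actCoeff q P a b

end Action

section Form

variable {n p : ℕ}

/-- The graph obtained from two half-diagrams by identifying their `i`th points for all `i`. -/
def formEdge (a b : HalfDiagram n p) (i j : Fin n) : Prop := j = a.partner i ∨ j = b.partner i

/-- Some path joins two through-strings of the same half-diagram. -/
def FormVanishes (a b : HalfDiagram n p) : Prop :=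
  ∃ i j : Fin n, i ≠ j ∧ Joined (formEdge a b) i j ∧
    ((a.IsThrough i ∧ a.IsThrough j) ∨ (b.IsThrough i ∧ b.IsThrough j))

open Classical in
/-- The value `⟨ξ_a, ξ_b⟩`. -/
def formCoeff (q : ℝ) (a b : HalfDiagram n p) : ℂ :=
  if FormVanishes a b then 0
  else (q : ℂ) ^ loops (formEdge a b) {i | a.IsThrough i ∨ b.IsThrough i}

/-- The sesquilinear form `⟨ξ, η⟩` on `U(n; p)`, linear in `ξ` and conjugate-linear in `η`. -/
def form (q : ℝ) (ξ η : U n p) : ℂ :=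
  ∑ a, ∑ b, ξ a * (starRingEnd ℂ) (η b) * formCoeff q a b

end Form

/-- The Chebyshev polynomial with `Δ_{-1} = 0`, `Δ_0 = 1` and `Δ_{k+1} = q Δ_k - Δ_{k-1}`. -/
def Δ (k : ℤ) (q : ℝ) : ℝ := (Polynomial.Chebyshev.S ℝ k).eval q

/-- The quotient `μ_k = Δ_{k-1} / Δ_k`. -/
def μ (k : ℤ) (q : ℝ) : ℝ := Δ (k - 1) q / Δ k q

/-- The second basis: `ξ'_a = ξ_a` for the minimal half-diagram `a`, and
`ξ'_b = (e_i - μ_{h + 1}) ξ'_a` if `b` is obtained from `a` by box addition at a minimum of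
height `h`. -/
def IsSecondBasis {n p : ℕ} (q : ℝ) (F : HalfDiagram n p → U n p) : Prop :=
  (∀ a, a.IsMinimal → F a = Pi.single a 1) ∧
  ∀ (i : ℕ) (hi : i + 1 < n) (a b : HalfDiagram n p), HalfDiagram.IsBoxAddition i hi a b →
    F b = act (TL.gen q i hi) (F a) - ((μ (a.height (i + 1) + 1) q : ℝ) : ℂ) • F a

/-- The generalized Catalan number `c_{n, n - 2 p}`. -/
def genCatalan (n p : ℕ) : ℤ := (n.choose p : ℤ) - if p = 0 then 0 else (n.choose (p - 1) : ℤ)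

/-- The direct sum of the matrix algebras, one for each number `p` of arches with `2 p ≤ n`; the
rows and columns of the block of `p` are indexed by the half-diagrams with `p` arches. -/
abbrev MatSum (n : ℕ) : Type :=
  ∀ p : Fin (n / 2 + 1), Matrix (HalfDiagram n p) (HalfDiagram n p) ℂ

/-- The elementary matrix in the block of `p`, with the entry `c` in row `a` and column `b`. -/
def elem {n : ℕ} (p : Fin (n / 2 + 1)) (a b : HalfDiagram n p) (c : ℂ) : MatSum n :=
  Pi.single p (Matrix.single a b c)

/-- `Φ` is an isomorphism of unital algebras. -/
def IsAlgIso {n : ℕ} {q : ℝ} (Φ : TL n q ≃ₗ[ℂ] MatSum n) : Prop :=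
  Φ 1 = 1 ∧ ∀ x y, Φ (x * y) = Φ x * Φ y

/-- In every block, `Φ x` is the matrix of the action of `x` with respect to the family `F`. -/
def IsMatrixOfAction {n : ℕ} {q : ℝ} (F : ∀ p : Fin (n / 2 + 1), HalfDiagram n p → U n p)
    (Φ : TL n q → MatSum n) : Prop :=
  ∀ x p c, act x (F p c) = ∑ a, Φ x p a c • F p a

/-- The sign of a nonzero real number, as a complex number. -/
def sgn (z : ℂ) : ℂ := if 0 < z.re then 1 else -1

end TemperleyLieb

end

/-! Topology enters only through two-colourings. Two vertices of a graph are joined iff every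
colouring that is constant along edges gives them the same colour, and in a finite graph the
colourings with prescribed values on `E` number 2 to the power of the loops avoiding `E`
(`card_compat_eq`). A concatenation is therefore encoded by the number of its colourings as a
function of the colours of its ends, and deleting glued points means summing over their colours.
Through-strings carry labels whose colours are independent; a diagram with its number of loops, or
the zero state, can be recovered from its function (`Rep.unique`). An identity between such
functions is thus an identity between diagrams and loop counts, valid for every `q`. The
Temperley-Lieb relations, the compatibility of product and action (`actL_mulL`) and the
self-adjointness of the generators (`formB_E`) are obtained in this way. That a concatenation is
again a noncrossing diagram follows by building every pairing from the unit by caps on either side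
(`Pairing.induction`).

The second basis is well defined because two different last boxes never touch, so their operators
commute. The decisive fact is `E_secondBasis_of_isSlope`: `e_i` kills `ξ'_b` if the path of `b` goes
twice in the same direction at `i`. It comes from the braid relation `e_i e_j e_i = e_i` and the
identity `μ_{k+1} (q - μ_k) = 1`, for which the `μ_k` are chosen. For `b = ◇_i(a)` the operator
`e_i` preserves the plane of `ξ'_a` and `ξ'_b`. Self-adjointness then yields orthogonality, and with
`h` the height of the minimum it yields `N_b = μ_{h+1} (q - μ_{h+1}) N_a`, where the factor is `Δ_h
Δ_{h+2} / Δ_{h+1}^2`. The recursion starts from `q^p`, so all norms are real and nonzero, and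
positive if all the `Δ_k` with `k < n` are.

The heart of the theorem is `e'_{a ⊗ b} v = ⟨v, ξ'_b⟩ ξ'_a`, up to complex conjugation, which does
not affect the second basis, together with the vanishing of `e'_{a ⊗ b}` on the other modules. Boxes
on the left half of a pairing act on `a`, boxes on the right half pass by adjointness to `b`, so it
suffices to treat `a = b` minimal with `r` arches. By triangularity (`secondBasis_triangular`) this
`e'` is `e_{a ⊗ a}` plus diagrams with more than `r` arches in each half, and those vanish on `U(n;
p)` for `p ≤ r`. The remaining product of caps is zero for `p < r` and of rank one for `p = r`. For
`p > r` every vector in the image is a `q`-eigenvector of the first `r` alternate generators and is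
killed by all generators further right; it is then orthogonal to the whole module, hence zero.

Consequently all elementary matrices lie in the image of the matrix representation, and equality of
dimensions makes it an isomorphism; this also shows that the `e'_P` form a basis. The statement on
the involution is checked on that basis: transposing a pairing respects boxes and heights, and a
square root `s` of a real number satisfies `conj s * sgn (s^2) = s`. -/

noncomputable section

namespace TemperleyLieb

/-! ### Colourings of graphs -/

/-- A colouring that is constant along the edges. -/
def Compat {V : Type} (r : V → V → Prop) (f : V → Bool) : Prop := ∀ u v, r u v → f u = f v

theorem Compat.eq_of_joined {V : Type} {r : V → V → Prop} {f : V → Bool} (hf : Compat r f) {u v : V}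
    (h : Joined r u v) : f u = f v :=
  congrArg (Quot.lift f hf) h

-- The indicator function of the component of `u` is itself compatible, so two colours already
-- separate components.
open Classical in
theorem joined_of_forall_compat {V : Type} {r : V → V → Prop} {u v : V}
    (h : ∀ f, Compat r f → f u = f v) : Joined r u v := by
  have h1 := h (fun w => decide (Quot.mk r w = Quot.mk r u))
    (fun x y hxy => by simp only [Quot.sound hxy])
  simpa [Joined, eq_comm] using h1

theorem joined_iff_forall_compat {V : Type} {r : V → V → Prop} {u v : V} :
    Joined r u v ↔ ∀ f, Compat r f → f u = f v :=
  ⟨fun h _ hf => hf.eq_of_joined h, joined_of_forall_compat⟩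

open Classical in
/-- The compatible colourings with prescribed values on `E` are counted by the components that avoid
`E`. -/
theorem card_compat_eq {V : Type} [Finite V] (r : V → V → Prop) (E : Set V) (f₀ : V → Bool)
    (h₀ : Compat r f₀) :
    Nat.card {f : V → Bool // Compat r f ∧ ∀ v ∈ E, f v = f₀ v} = 2 ^ loops r E := by
  have e : {f : V → Bool // Compat r f ∧ ∀ v ∈ E, f v = f₀ v} ≃
      ({C : Quot r // ∀ v ∈ E, Quot.mk r v ≠ C} → Bool) :=
    { toFun := fun f C => Quot.lift f.1 f.2.1 C.1
      -- A component that meets `E` has no freedom: there the colour is the constant value of `f₀`.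
      invFun := fun g => ⟨fun v => if h : ∀ w ∈ E, Quot.mk r w ≠ Quot.mk r v then
          g ⟨Quot.mk r v, h⟩ else f₀ v, by
        constructor
        · intro u v huv
          simp only [Quot.sound huv, h₀ u v huv]
        · intro v hv
          exact dif_neg fun h => h v hv rfl⟩
      left_inv := by
        rintro ⟨f, hf, hE⟩
        ext v
        simp only
        split_ifs with h
        · rfl
        · push Not at h
          obtain ⟨w, hw, h⟩ := h
          have h1 := hf.eq_of_joined h
          have h2 := h₀.eq_of_joined h
          rw [← h1, ← h2, hE w hw]
      right_inv := by
        intro g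
        funext ⟨C, hC⟩
        obtain ⟨v, rfl⟩ := Quot.exists_rep C
        simp only
        rw [dif_pos hC] }
  rw [Nat.card_congr e, Nat.card_fun]
  simp [loops]

end TemperleyLieb

end

/-! ### Bracket sequences, closing counts and heights of half-diagrams -/

noncomputable section

namespace TemperleyLieb

namespace HalfDiagram

variable {n p p' : ℕ}

theorem partner_injective (a : HalfDiagram n p) : Function.Injective a.partner :=
  Function.LeftInverse.injective a.invol

/-- The structure field only forbids leaving an arch to the right. A strand leaving to the left is
an arch ending at `k` that has `i` under it, so the field applied to that arch excludes it. -/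
theorem inner (a : HalfDiagram n p) {i k : Fin n} (h1 : i < k) (h2 : k < a.partner i) :
    i < a.partner k ∧ a.partner k < a.partner i ∧ a.partner k ≠ k := by
  have h3 := a.noncrossing i k h1 h2
  have h4 : a.partner k ≠ a.partner i := fun h => h1.ne' (a.partner_injective h)
  refine ⟨?_, by grind, h3.1⟩
  by_contra h
  have h5 : a.partner k ≠ i := fun h => by rw [← h, a.invol] at h2; exact lt_irrefl _ h2
  have h6 := a.noncrossing (a.partner k) i (by grind) (by rw [a.invol]; exact h1)
  rw [a.invol] at h6
  exact h6.2 h2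

theorem partner_lt_of_not_isOpening {a : HalfDiagram n p} {i : Fin n} (h : ¬ a.IsOpening i) :
    a.partner i < i := not_le.mp h

theorem isOpening_partner {a : HalfDiagram n p} {i : Fin n} (h : ¬ a.IsOpening i) :
    a.IsOpening (a.partner i) := by
  unfold IsOpening at *
  rw [a.invol]
  grind

/-- If the `a`-arch ending at `k` reached further left, the opening bracket `b.partner k` would lie
under it and be closed in `a` by some `z < k`. By the hypothesis on smaller points `b` closes it at
`z` too, although `b` closes it at `k`. -/
theorem not_lt_of_isOpening_iff {a : HalfDiagram n p} {b : HalfDiagram n p'}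
    (h : ∀ i, a.IsOpening i ↔ b.IsOpening i) (k : Fin n)
    (ih : ∀ z < k, ¬ a.IsOpening z → a.partner z = b.partner z) (hk : ¬ a.IsOpening k) :
    ¬ a.partner k < b.partner k := by
  intro hlt
  have hk' := (not_congr (h k)).mp hk
  have h1 := partner_lt_of_not_isOpening hk
  have h2 := partner_lt_of_not_isOpening hk'
  have h3 := (h _).mpr (isOpening_partner hk')
  have h4 := a.inner hlt (by rw [a.invol]; exact h2)
  rw [a.invol] at h4
  have h5 : ¬ a.IsOpening (a.partner (b.partner k)) := by
    unfold IsOpening at *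
    rw [a.invol]
    grind
  have h6 := ih _ h4.2.1 h5
  rw [a.invol] at h6
  have h7 := congrArg b.partner h6
  rw [b.invol, b.invol] at h7
  exact h4.2.1.ne h7.symm

/-- The directions of the brackets determine the matching: closing brackets are matched from left to
right, and the opening ones follow. The arch numbers may differ, so that halves of pairings can be
compared before their sizes are known. -/
theorem partner_eq_of_isOpening_iff {a : HalfDiagram n p} {b : HalfDiagram n p'}
    (h : ∀ i, a.IsOpening i ↔ b.IsOpening i) : a.partner = b.partner := by
  have key : ∀ m : ℕ, ∀ k : Fin n, (k : ℕ) = m → ¬ a.IsOpening k → a.partner k = b.partner k := by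
    intro m
    induction m using Nat.strong_induction_on with
    | _ m ih =>
      intro k hkm hk
      have h1 := not_lt_of_isOpening_iff h k (fun z hz hz' => ih z (by rw [← hkm]; exact hz) z rfl hz') hk
      have h2 := not_lt_of_isOpening_iff (fun i => (h i).symm) k (fun z hz hz' =>
        (ih z (by rw [← hkm]; exact hz) z rfl ((not_congr (h z)).mpr hz')).symm)
        ((not_congr (h k)).mp hk)
      exact le_antisymm (not_lt.mp h2) (not_lt.mp h1)
  have key2 : ∀ k, ¬ a.IsOpening k → a.partner k = b.partner k := fun k => key k k rfl
  funext j
  by_cases hj : a.IsOpening j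
  · by_cases h1 : a.partner j = j
    · by_cases h2 : b.partner j = j
      · rw [h1, h2]
      · have h3 : ¬ b.IsOpening (b.partner j) := by
          have := (h j).mp hj
          unfold IsOpening at *
          rw [b.invol]
          grind
        have h4 := key2 _ ((not_congr (h _)).mpr h3)
        rw [b.invol] at h4
        have h5 := congrArg a.partner h4
        rw [a.invol] at h5
        rw [h5]
    · have h3 : ¬ a.IsOpening (a.partner j) := by
        unfold IsOpening at *
        rw [a.invol]
        grind
      have h4 := key2 _ h3
      rw [a.invol] at h4
      have h5 := congrArg b.partner h4
      rw [b.invol] at h5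
      exact h5.symm
  · exact key2 j hj

theorem ext_of_isOpening {a b : HalfDiagram n p} (h : ∀ i, a.IsOpening i ↔ b.IsOpening i) : a = b :=
  HalfDiagram.ext (partner_eq_of_isOpening_iff h)

theorem arches_eq {a : HalfDiagram n p} {b : HalfDiagram n p'} (h : a.partner = b.partner) :
    p = p' := by
  have h1 := a.card_through
  have h2 := b.card_through
  rw [h] at h1
  omega

/-! ### Closing brackets and heights -/

/-- The number of closing brackets among the first `k` brackets. -/
def cl (a : HalfDiagram n p) (k : ℕ) : ℕ :=
  (Finset.univ.filter fun j : Fin n => (j : ℕ) < k ∧ ¬ a.IsOpening j).card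

@[simp] theorem cl_zero (a : HalfDiagram n p) : a.cl 0 = 0 := by simp [cl]

theorem cl_mono (a : HalfDiagram n p) : Monotone a.cl := by
  intro k l hkl
  refine Finset.card_le_card fun j hj => ?_
  simp only [Finset.mem_filter, Finset.mem_univ, true_and] at hj ⊢
  exact ⟨by omega, hj.2⟩

theorem cl_succ_of_isOpening (a : HalfDiagram n p) {i : Fin n} (h : a.IsOpening i) :
    a.cl (i + 1) = a.cl i := by
  unfold cl
  congr 1
  ext j
  simp only [Finset.mem_filter, Finset.mem_univ, true_and, and_congr_left_iff]
  intro hj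
  have : j ≠ i := fun h' => hj (h' ▸ h)
  rw [ne_eq, Fin.ext_iff] at this
  omega

theorem cl_succ_of_not_isOpening (a : HalfDiagram n p) {i : Fin n} (h : ¬ a.IsOpening i) :
    a.cl (i + 1) = a.cl i + 1 := by
  unfold cl
  rw [← Finset.card_insert_of_notMem (a := i)]
  · congr 1
    ext j
    simp only [Finset.mem_filter, Finset.mem_univ, true_and, Finset.mem_insert, Fin.ext_iff]
    constructor
    · rintro ⟨h1, h2⟩
      by_cases h3 : (j : ℕ) = i
      · exact Or.inl h3
      · exact Or.inr ⟨by omega, h2⟩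
    · rintro (h1 | h1)
      · have := Fin.ext h1
        subst this
        exact ⟨by omega, h⟩
      · exact ⟨by omega, h1.2⟩
  · simp

theorem card_filter_val_lt {k : ℕ} (hk : k ≤ n) :
    (Finset.univ.filter fun j : Fin n => (j : ℕ) < k).card = k := by
  rw [Fin.card_filter_val_lt]; omega

theorem height_eq (a : HalfDiagram n p) {k : ℕ} (hk : k ≤ n) : a.height k = k - 2 * a.cl k := by
  have h := Finset.card_filter_add_card_filter_not (s := Finset.univ.filter fun j : Fin n => (j : ℕ) < k)
    (fun j => a.IsOpening j)
  rw [Finset.filter_filter, Finset.filter_filter, card_filter_val_lt hk] at h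
  unfold height cl
  omega

theorem height_succ_of_isOpening (a : HalfDiagram n p) {i : Fin n} (h : a.IsOpening i) :
    a.height (i + 1) = a.height i + 1 := by
  rw [a.height_eq (by omega), a.height_eq (by omega), a.cl_succ_of_isOpening h]
  push_cast; ring

theorem height_succ_of_not_isOpening (a : HalfDiagram n p) {i : Fin n} (h : ¬ a.IsOpening i) :
    a.height (i + 1) = a.height i - 1 := by
  rw [a.height_eq (by omega), a.height_eq (by omega), a.cl_succ_of_not_isOpening h]
  push_cast; ring

/-- `partner` injects the closing brackets among the first `k` into the opening ones: the path never
goes below zero. -/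
theorem two_mul_cl_le (a : HalfDiagram n p) {k : ℕ} (hk : k ≤ n) : 2 * a.cl k ≤ k := by
  have h := Finset.card_filter_add_card_filter_not (s := Finset.univ.filter fun j : Fin n => (j : ℕ) < k)
    (fun j => a.IsOpening j)
  rw [Finset.filter_filter, Finset.filter_filter, card_filter_val_lt hk] at h
  have h2 : a.cl k ≤ (Finset.univ.filter fun j : Fin n => (j : ℕ) < k ∧ a.IsOpening j).card := by
    refine Finset.card_le_card_of_injOn a.partner ?_ a.partner_injective.injOn
    intro j hj
    simp only [Finset.coe_filter, Finset.mem_univ, true_and, Set.mem_ofPred_eq] at hj ⊢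
    have := partner_lt_of_not_isOpening hj.2
    exact ⟨by grind, isOpening_partner hj.2⟩
  unfold cl at *
  omega

theorem height_nonneg (a : HalfDiagram n p) {k : ℕ} (hk : k ≤ n) : 0 ≤ a.height k := by
  rw [a.height_eq hk]
  have := a.two_mul_cl_le hk
  omega

theorem cl_self (a : HalfDiagram n p) : a.cl n = p := by
  have h1 : a.cl n = (Finset.univ.filter fun j : Fin n => j < a.partner j).card := by
    refine Finset.card_bij (fun j _ => a.partner j) ?_ ?_ ?_
    · intro j hj
      simp only [Finset.mem_filter, Finset.mem_univ, true_and] at hj ⊢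
      rw [a.invol]
      exact partner_lt_of_not_isOpening hj.2
    · intro i _ j _ h
      exact a.partner_injective h
    · intro j hj
      simp only [Finset.mem_filter, Finset.mem_univ, true_and] at hj
      refine ⟨a.partner j, Finset.mem_filter.mpr ⟨Finset.mem_univ _, (a.partner j).isLt, ?_⟩,
        a.invol j⟩
      unfold IsOpening
      rw [a.invol]
      exact not_le.mpr hj
  have h2 : a.cl n = (Finset.univ.filter fun j : Fin n => a.partner j < j).card := by
    unfold cl
    congr 1
    ext j
    simp [IsOpening]
  have h3 := Finset.card_filter_add_card_filter_not (s := (Finset.univ : Finset (Fin n)))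
    (fun j => a.partner j = j)
  have h4 := Finset.card_filter_add_card_filter_not
    (s := Finset.univ.filter fun j : Fin n => ¬ a.partner j = j) (fun j => a.partner j < j)
  rw [Finset.filter_filter, Finset.filter_filter] at h4
  have h5 : (Finset.univ.filter fun j : Fin n => ¬ a.partner j = j ∧ a.partner j < j) =
      Finset.univ.filter fun j : Fin n => a.partner j < j := by
    ext j; simp only [Finset.mem_filter, Finset.mem_univ, true_and]; grind
  have h6 : (Finset.univ.filter fun j : Fin n => ¬ a.partner j = j ∧ ¬ a.partner j < j) =
      Finset.univ.filter fun j : Fin n => j < a.partner j := by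
    ext j; simp only [Finset.mem_filter, Finset.mem_univ, true_and]; grind
  rw [h5, h6] at h4
  have h7 := a.card_through
  simp only [Finset.card_univ, Fintype.card_fin] at h3
  omega

theorem two_mul_arches_le (a : HalfDiagram n p) : 2 * p ≤ n := by
  have := a.two_mul_cl_le le_rfl
  rwa [cl_self] at this

theorem ext_of_cl {a b : HalfDiagram n p} (h : ∀ k ≤ n, a.cl k = b.cl k) : a = b := by
  refine ext_of_isOpening fun i => ?_
  have h1 := h i (by omega)
  have h2 := h (i + 1) (by omega)
  by_cases ha : a.IsOpening i <;> by_cases hb : b.IsOpening i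
  · simp [ha, hb]
  · rw [a.cl_succ_of_isOpening ha, b.cl_succ_of_not_isOpening hb] at h2; omega
  · rw [a.cl_succ_of_not_isOpening ha, b.cl_succ_of_isOpening hb] at h2; omega
  · simp [ha, hb]

end HalfDiagram

end TemperleyLieb

end

noncomputable section

namespace TemperleyLieb

namespace HalfDiagram

variable {n p : ℕ}

/-! ### Half-diagrams from ballot sequences -/

/-- Adds a through-string after the last point. -/
def addThrough (a : HalfDiagram n p) : HalfDiagram (n + 1) p where
  partner := Fin.lastCases (Fin.last n) fun i => (a.partner i).castSucc
  invol i := by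
    cases i using Fin.lastCases <;> simp [a.invol]
  noncrossing i k := by
    cases i using Fin.lastCases <;> cases k using Fin.lastCases
    · simp
    · simp only [Fin.lastCases_last]
      intro h1 h2
      exact absurd (h1.trans h2) (lt_irrefl _)
    · simp only [Fin.lastCases_castSucc]
      intro h1 h2
      exact absurd h2 (not_lt.mpr (Fin.le_last _))
    · rename_i i k
      simp only [Fin.lastCases_castSucc, Fin.castSucc_lt_castSucc_iff, ne_eq, Fin.castSucc_inj]
      exact a.noncrossing i k
  card_through := by
    have h := a.card_through
    rw [Finset.card_filter] at h ⊢
    rw [Fin.sum_univ_castSucc]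
    simp only [Fin.lastCases_castSucc, Fin.castSucc_inj, Fin.lastCases_last, if_true]
    omega

theorem isOpening_addThrough_castSucc (a : HalfDiagram n p) (i : Fin n) :
    a.addThrough.IsOpening i.castSucc ↔ a.IsOpening i := by
  simp [IsOpening, addThrough]

theorem isOpening_addThrough_last (a : HalfDiagram n p) : a.addThrough.IsOpening (Fin.last n) := by
  simp [IsOpening, addThrough]

/-- Joins the last through-string to a new last point. -/
def addClose (a : HalfDiagram n p) (x : Fin n) (hx : a.partner x = x)
    (hmax : ∀ y, a.partner y = y → y ≤ x) : HalfDiagram (n + 1) (p + 1) where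
  partner := Fin.lastCases x.castSucc fun i => if i = x then Fin.last n else (a.partner i).castSucc
  invol i := by
    cases i using Fin.lastCases with
    | last => simp
    | cast i =>
      by_cases h : i = x
      · simp [h]
      · have : a.partner i ≠ x := fun h' => h (by rw [← a.invol i, h', hx])
        simp [h, a.invol, this]
  noncrossing i k := by
    cases i using Fin.lastCases with
    | last =>
      intro h1
      exact absurd h1 (not_lt.mpr (Fin.le_last _))
    | cast i =>
      cases k using Fin.lastCases with
      | last =>
        intro _ h2
        exact absurd h2 (not_lt.mpr (Fin.le_last _))
      | cast k =>
        simp only [Fin.lastCases_castSucc, Fin.castSucc_lt_castSucc_iff]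
        intro h1 h2
        by_cases hi : i = x
        · subst hi
          have hk : k ≠ i := h1.ne'
          rw [if_neg hk, if_pos rfl]
          refine ⟨?_, not_lt.mpr (Fin.le_last _)⟩
          rw [ne_eq, Fin.castSucc_inj]
          -- Only the last through-string may be closed: any later one would lie under the new arch.
          exact fun h => absurd (hmax k h) (not_le.mpr h1)
        · rw [if_neg hi, Fin.castSucc_lt_castSucc_iff] at h2
          have h3 := a.noncrossing i k h1 h2
          have hk : k ≠ x := fun h => h3.1 (by rw [h, hx])
          simp only [if_neg hk, if_neg hi, ne_eq, Fin.castSucc_inj, Fin.castSucc_lt_castSucc_iff]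
          exact h3
  card_through := by
    have h := a.card_through
    rw [Finset.card_filter] at h ⊢
    rw [Fin.sum_univ_castSucc]
    simp only [Fin.lastCases_castSucc, Fin.lastCases_last]
    rw [← Finset.add_sum_erase _ _ (Finset.mem_univ x)] at h ⊢
    have h2 : ∑ i ∈ Finset.univ.erase x, (if (if i = x then Fin.last n else (a.partner i).castSucc) =
        i.castSucc then 1 else 0) = ∑ i ∈ Finset.univ.erase x, if a.partner i = i then 1 else 0 := by
      refine Finset.sum_congr rfl fun i hi => ?_
      rw [if_neg (Finset.ne_of_mem_erase hi)]
      simp only [Fin.castSucc_inj]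
    rw [h2]
    simp only [if_true, hx] at h ⊢
    rw [if_neg (Fin.castSucc_lt_last x).ne', if_neg (Fin.castSucc_lt_last x).ne]
    omega

theorem isOpening_addClose_castSucc (a : HalfDiagram n p) (x : Fin n) (hx : a.partner x = x)
    (hmax : ∀ y, a.partner y = y → y ≤ x) (i : Fin n) :
    (a.addClose x hx hmax).IsOpening i.castSucc ↔ a.IsOpening i := by
  simp only [IsOpening, addClose, Fin.lastCases_castSucc]
  split_ifs with h
  · subst h
    simp [hx, Fin.le_last]
  · simp

theorem not_isOpening_addClose_last (a : HalfDiagram n p) (x : Fin n) (hx : a.partner x = x)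
    (hmax : ∀ y, a.partner y = y → y ≤ x) : ¬ (a.addClose x hx hmax).IsOpening (Fin.last n) := by
  simp only [IsOpening, addClose, Fin.lastCases_last, not_le]
  exact Fin.castSucc_lt_last x

/-- Induction on the last bracket. If it closes, the ballot condition at full length leaves a
through-string in the shorter diagram, and the last of these is joined to the new point. -/
theorem exists_of_ballot (n : ℕ) : ∀ (S : Finset ℕ), (∀ s ∈ S, s < n) →
    (∀ k ≤ n, 2 * (S.filter (· < k)).card ≤ k) → ∀ p, p = S.card →
    ∃ a : HalfDiagram n p, ∀ j : Fin n, a.IsOpening j ↔ (j : ℕ) ∉ S := by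
  induction n with
  | zero =>
    intro S hS _ p hp
    have : S = ∅ := Finset.eq_empty_of_forall_notMem fun s hs => by simpa using hS s hs
    subst this
    rw [Finset.card_empty] at hp
    subst hp
    exact ⟨⟨id, fun i => i.elim0, fun i => i.elim0, by simp⟩, fun i => i.elim0⟩
  | succ n ih =>
    intro S hS hb p hp
    have hfil : ∀ k ≤ n, (S.erase n).filter (· < k) = S.filter (· < k) := by
      intro k hk
      ext s
      simp only [Finset.mem_filter, Finset.mem_erase]
      constructor
      · rintro ⟨⟨_, h⟩, h'⟩; exact ⟨h, h'⟩
      · rintro ⟨h, h'⟩; exact ⟨⟨by omega, h⟩, h'⟩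
    obtain ⟨a, ha⟩ := ih (S.erase n)
      (fun s hs => by
        have h1 := hS s (Finset.mem_of_mem_erase hs)
        have h2 := Finset.ne_of_mem_erase hs
        omega)
      (fun k hk => by rw [hfil k hk]; exact hb k (by omega)) _ rfl
    have ha' : ∀ j : Fin n, a.IsOpening j ↔ (j : ℕ) ∉ S := fun j => by
      rw [ha, Finset.mem_erase]
      have := j.isLt
      constructor
      · intro h h'; exact h ⟨by omega, h'⟩
      · intro h h'; exact h h'.2
    by_cases hn : n ∈ S
    · have hc := Finset.card_erase_add_one hn
      have h1 := a.card_through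
      have h2 := hb (n + 1) le_rfl
      rw [Finset.filter_true_of_mem (fun s hs => hS s hs)] at h2
      have hne : (Finset.univ.filter fun i => a.partner i = i).Nonempty := by
        rw [← Finset.card_pos]; omega
      have hx := Finset.max'_mem _ hne
      set x := Finset.max' _ hne with hxdef
      have hmax : ∀ y, a.partner y = y → y ≤ x := fun y hy =>
        Finset.le_max' _ y (by simpa using hy)
      have hx' : a.partner x = x := by simpa using hx
      obtain rfl : p = (S.erase n).card + 1 := by omega
      refine ⟨a.addClose x hx' hmax, fun j => ?_⟩
      cases j using Fin.lastCases with
      | last => simpa [hn] using not_isOpening_addClose_last a x hx' hmax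
      | cast j => rw [isOpening_addClose_castSucc, ha']; rfl
    · obtain rfl : p = (S.erase n).card := by rw [Finset.erase_eq_of_notMem hn, hp]
      refine ⟨a.addThrough, fun j => ?_⟩
      cases j using Fin.lastCases with
      | last => simpa [hn] using isOpening_addThrough_last a
      | cast j => rw [isOpening_addThrough_castSucc, ha']; rfl

/-- The set of closing brackets. -/
def closers (a : HalfDiagram n p) : Finset ℕ :=
  (Finset.univ.filter fun j : Fin n => ¬ a.IsOpening j).map Fin.valEmbedding

theorem mem_closers {a : HalfDiagram n p} {j : Fin n} : (j : ℕ) ∈ a.closers ↔ ¬ a.IsOpening j := by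
  simp [closers, Fin.ext_iff.symm]

theorem lt_of_mem_closers {a : HalfDiagram n p} {s : ℕ} (h : s ∈ a.closers) : s < n := by
  simp only [closers, Finset.mem_map, Fin.valEmbedding_apply] at h
  obtain ⟨j, _, rfl⟩ := h
  exact j.isLt

theorem card_closers_filter (a : HalfDiagram n p) (k : ℕ) :
    (a.closers.filter (· < k)).card = a.cl k := by
  rw [closers, Finset.filter_map, Finset.card_map, Finset.filter_filter]
  unfold cl
  congr 1
  ext j
  simp [and_comm]

theorem card_closers (a : HalfDiagram n p) : a.closers.card = p := by
  have h := a.cl_self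
  rwa [← card_closers_filter, Finset.filter_true_of_mem fun s hs => lt_of_mem_closers hs] at h

theorem closers_injective : Function.Injective (closers : HalfDiagram n p → Finset ℕ) := by
  intro a b h
  refine ext_of_isOpening fun i => ?_
  rw [← not_iff_not, ← mem_closers, ← mem_closers, h]

/-- The sets of closing brackets of the ballot sequences with `n` steps, `p` of them down-steps. -/
def ballotSets (n p : ℕ) : Finset (Finset ℕ) :=
  (Finset.powersetCard p (Finset.range n)).filter fun S => ∀ k ≤ n, 2 * (S.filter (· < k)).card ≤ k

theorem card_eq_card_ballotSets (n p : ℕ) : Fintype.card (HalfDiagram n p) = (ballotSets n p).card := by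
  rw [← Finset.card_univ]
  refine Finset.card_bij (fun a _ => a.closers) ?_ (fun a _ b _ h => closers_injective h) ?_
  · intro a _
    simp only [ballotSets, Finset.mem_filter, Finset.mem_powersetCard]
    refine ⟨⟨fun s hs => Finset.mem_range.mpr (lt_of_mem_closers hs), a.card_closers⟩, fun k hk => ?_⟩
    rw [card_closers_filter]
    exact a.two_mul_cl_le hk
  · intro S hS
    simp only [ballotSets, Finset.mem_filter, Finset.mem_powersetCard] at hS
    obtain ⟨a, ha⟩ := exists_of_ballot n S (fun s hs => Finset.mem_range.mp (hS.1.1 hs)) hS.2 p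
      hS.1.2.symm
    refine ⟨a, Finset.mem_univ _, ?_⟩
    ext s
    constructor
    · intro hs
      have h := mem_closers (j := ⟨s, lt_of_mem_closers hs⟩).mp hs
      rw [ha] at h
      simpa using h
    · intro hs
      have h : s < n := Finset.mem_range.mp (hS.1.1 hs)
      refine mem_closers (j := ⟨s, h⟩).mpr ?_
      rw [ha]
      simpa using hs

/-- Pascal's rule by the direction of the last step; the bound on `p` makes the ballot condition at
full length automatic. -/
theorem card_ballotSets_succ {n p : ℕ} (h : 2 * (p + 1) ≤ n + 1) :
    (ballotSets (n + 1) (p + 1)).card = (ballotSets n (p + 1)).card + (ballotSets n p).card := by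
  have hins : ∀ T ∈ Finset.powersetCard p (Finset.range n), ∀ k ≤ n,
      (insert n T).filter (· < k) = T.filter (· < k) := by
    intro T hT k hk
    rw [Finset.filter_insert, if_neg (by omega)]
  have hlt : ∀ {r : ℕ} {T}, T ∈ Finset.powersetCard r (Finset.range n) → ∀ s ∈ T, s < n :=
    fun hT s hs => Finset.mem_range.mp ((Finset.mem_powersetCard.mp hT).1 hs)
  unfold ballotSets
  rw [Finset.range_add_one, Finset.powersetCard_succ_insert (by simp), Finset.filter_union,
    Finset.card_union_of_disjoint, Finset.filter_image, Finset.card_image_of_injOn]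
  · congr 1
    · congr 1
      refine Finset.filter_congr fun T hT => ⟨fun h k hk => h k (by omega), fun h' k hk => ?_⟩
      rcases Nat.lt_or_ge k (n + 1) with h1 | h1
      · exact h' k (by omega)
      · rw [Finset.filter_true_of_mem (fun s hs => by have := hlt hT s hs; omega),
          (Finset.mem_powersetCard.mp hT).2]
        omega
    · congr 1
      refine Finset.filter_congr fun T hT => ⟨fun h' k hk => ?_, fun h' k hk => ?_⟩
      · rw [← hins T hT k hk]; exact h' k (by omega)
      · rcases Nat.lt_or_ge k (n + 1) with h1 | h1
        · rw [hins T hT k (by omega)]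
          exact h' k (by omega)
        · refine (Nat.mul_le_mul_left 2 (Finset.card_le_card (Finset.filter_subset _ _))).trans ?_
          refine (Nat.mul_le_mul_left 2 (Finset.card_insert_le _ _)).trans ?_
          rw [(Finset.mem_powersetCard.mp hT).2]
          omega
  · intro S hS T hT hST
    have h1 : n ∉ S := fun h => absurd (hlt (Finset.mem_filter.mp hS).1 n h) (lt_irrefl _)
    have h2 : n ∉ T := fun h => absurd (hlt (Finset.mem_filter.mp hT).1 n h) (lt_irrefl _)
    rw [← Finset.erase_insert h1, ← Finset.erase_insert h2]
    exact congrArg (fun s => Finset.erase s n) hST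
  · rw [Finset.disjoint_left]
    intro S hS hS'
    obtain ⟨T, -, rfl⟩ := Finset.mem_image.mp (Finset.mem_filter.mp hS').1
    exact absurd (hlt (Finset.mem_filter.mp hS).1 n (Finset.mem_insert_self _ _)) (lt_irrefl _)

theorem ballotSets_eq_empty {n p : ℕ} (h : n < 2 * p) : ballotSets n p = ∅ := by
  refine Finset.eq_empty_of_forall_notMem fun S hS => ?_
  simp only [ballotSets, Finset.mem_filter, Finset.mem_powersetCard] at hS
  have h1 := hS.2 n le_rfl
  rw [Finset.filter_true_of_mem (fun s hs => Finset.mem_range.mp (hS.1.1 hs)), hS.1.2] at h1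
  omega

theorem card_ballotSets_zero (n : ℕ) : (ballotSets n 0).card = 1 := by
  simp [ballotSets, Finset.filter_singleton]

/-- The range goes one step beyond the nonempty case because the induction needs it. At that
boundary no ballot sequence exists, and the two binomials agree by symmetry. -/
theorem card_ballotSets (n : ℕ) : ∀ p, 2 * p ≤ n + 1 → ((ballotSets n p).card : ℤ) = genCatalan n p := by
  induction n with
  | zero =>
    intro p hp
    obtain rfl : p = 0 := by omega
    rw [card_ballotSets_zero]; simp [genCatalan]
  | succ n ih =>
    intro p hp
    cases p with
    | zero => rw [card_ballotSets_zero]; simp [genCatalan]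
    | succ p =>
      rcases Nat.lt_or_ge (n + 1) (2 * (p + 1)) with h | h
      · rw [ballotSets_eq_empty h]
        obtain rfl : n = 2 * p := by omega
        have := Nat.choose_symm_half p
        simp only [genCatalan, Finset.card_empty]
        rw [if_neg (by omega), Nat.add_sub_cancel, this]
        simp
      · rw [card_ballotSets_succ h, Nat.cast_add, ih _ (by omega), ih _ (by omega)]
        cases p with
        | zero => simp [genCatalan]
        | succ p =>
          simp only [genCatalan, Nat.add_eq_zero_iff, one_ne_zero, and_false, if_false,
            Nat.add_sub_cancel, Nat.choose_succ_succ]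
          push_cast
          ring

theorem card_eq_genCatalan (p : Fin (n / 2 + 1)) :
    (Fintype.card (HalfDiagram n p) : ℤ) = genCatalan n p := by
  rw [card_eq_card_ballotSets, card_ballotSets]
  omega

end HalfDiagram

end TemperleyLieb

end

noncomputable section

namespace TemperleyLieb

namespace HalfDiagram

variable {n p : ℕ}

/-! ### Box additions -/

theorem cl_succ_le (a : HalfDiagram n p) (k : ℕ) : a.cl (k + 1) ≤ a.cl k + 1 := by
  rcases Nat.lt_or_ge k n with h | h
  · by_cases ho : a.IsOpening ⟨k, h⟩
    · have := a.cl_succ_of_isOpening ho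
      simp only at this; omega
    · have := a.cl_succ_of_not_isOpening ho
      simp only at this; omega
  · have : a.cl (k + 1) = a.cl k := by
      unfold cl
      congr 1
      ext j
      simp only [Finset.mem_filter, Finset.mem_univ, true_and, and_congr_left_iff]
      omega
    omega

theorem cl_add_le (a : HalfDiagram n p) (k d : ℕ) : a.cl (k + d) ≤ a.cl k + d := by
  induction d with
  | zero => simp
  | succ d ih =>
    have := a.cl_succ_le (k + d)
    rw [← add_assoc]; omega

/-- Otherwise the arch closed at `i + 1` would begin before `i`, and the opening point `i` under it
would have to be matched strictly between `i` and `i + 1`. -/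
theorem partner_of_peak {b : HalfDiagram n p} {i : ℕ} {hi : i + 1 < n} (h1 : b.IsOpening ⟨i, by omega⟩)
    (h2 : ¬ b.IsOpening ⟨i + 1, hi⟩) : b.partner ⟨i + 1, hi⟩ = ⟨i, by omega⟩ := by
  have h3 := partner_lt_of_not_isOpening h2
  by_contra h
  have h4 : b.partner ⟨i + 1, hi⟩ < ⟨i, by omega⟩ := by
    rw [Fin.lt_def] at h3 ⊢
    rw [Fin.ext_iff] at h
    simp only at h h3 ⊢
    omega
  have h5 := b.inner h4 (by rw [b.invol, Fin.lt_def]; simp)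
  rw [b.invol, Fin.lt_def (b := (⟨i + 1, hi⟩ : Fin n))] at h5
  unfold IsOpening at h1
  rw [Fin.le_def] at h1
  have h6 := h5.2.2
  rw [ne_eq, Fin.ext_iff] at h6
  simp only at *
  omega

namespace IsBoxAddition

variable {i : ℕ} {hi : i + 1 < n} {a a' b b' : HalfDiagram n p}

theorem left_unique (h : IsBoxAddition i hi a b) (h' : IsBoxAddition i hi a' b) : a = a' := by
  refine ext_of_isOpening fun j => ?_
  by_cases h1 : (j : ℕ) = i
  · obtain rfl : j = ⟨i, Nat.lt_of_succ_lt hi⟩ := Fin.ext h1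
    simp [h.1, h'.1]
  · by_cases h2 : (j : ℕ) = i + 1
    · obtain rfl : j = ⟨i + 1, hi⟩ := Fin.ext h2
      simp [h.2.1, h'.2.1]
    · rw [← h.2.2.2.2 j h1 h2, h'.2.2.2.2 j h1 h2]

theorem right_unique (h : IsBoxAddition i hi a b) (h' : IsBoxAddition i hi a b') : b = b' := by
  refine ext_of_isOpening fun j => ?_
  by_cases h1 : (j : ℕ) = i
  · obtain rfl : j = ⟨i, Nat.lt_of_succ_lt hi⟩ := Fin.ext h1
    simp [h.2.2.1, h'.2.2.1]
  · by_cases h2 : (j : ℕ) = i + 1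
    · obtain rfl : j = ⟨i + 1, hi⟩ := Fin.ext h2
      simp [h.2.2.2.1, h'.2.2.2.1]
    · rw [h.2.2.2.2 j h1 h2, h'.2.2.2.2 j h1 h2]

theorem cl_eq_of_le (h : IsBoxAddition i hi a b) {k : ℕ} (hk : k ≤ i) : b.cl k = a.cl k := by
  unfold cl
  congr 1
  ext j
  simp only [Finset.mem_filter, Finset.mem_univ, true_and, and_congr_right_iff]
  intro hj
  rw [h.2.2.2.2 j (by omega) (by omega)]

theorem cl_left (h : IsBoxAddition i hi a b) : a.cl (i + 1) = a.cl i + 1 :=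
  a.cl_succ_of_not_isOpening h.1

theorem cl_right (h : IsBoxAddition i hi a b) : b.cl (i + 1) = a.cl i := by
  rw [← h.cl_eq_of_le le_rfl]
  exact b.cl_succ_of_isOpening h.2.2.1

theorem cl_eq_of_ge (h : IsBoxAddition i hi a b) {k : ℕ} (hk : i + 2 ≤ k) : b.cl k = a.cl k := by
  induction k, hk using Nat.le_induction with
  | base =>
    have h1 := a.cl_succ_of_isOpening h.2.1
    have h2 := b.cl_succ_of_not_isOpening h.2.2.2.1
    have h3 := h.cl_left
    have h4 := h.cl_right
    simp only [add_assoc, Nat.reduceAdd] at h1 h2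
    omega
  | succ k hk ih =>
    rcases Nat.lt_or_ge k n with hkn | hkn
    · by_cases ho : a.IsOpening ⟨k, hkn⟩
      · have h1 := a.cl_succ_of_isOpening ho
        have h2 := b.cl_succ_of_isOpening ((h.2.2.2.2 _ (by simp; omega) (by simp; omega)).mpr ho)
        simp only at h1 h2
        omega
      · have h1 := a.cl_succ_of_not_isOpening ho
        have h2 := b.cl_succ_of_not_isOpening
          ((not_congr (h.2.2.2.2 _ (by simp; omega) (by simp; omega))).mpr ho)
        simp only at h1 h2
        omega
    · have h1 : ∀ c : HalfDiagram n p, c.cl (k + 1) = c.cl k := by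
        intro c
        unfold cl
        congr 1
        ext j
        simp only [Finset.mem_filter, Finset.mem_univ, true_and, and_congr_left_iff]
        omega
      rw [h1, h1, ih]

theorem cl_eq (h : IsBoxAddition i hi a b) {k : ℕ} (hk : k ≠ i + 1) : b.cl k = a.cl k := by
  rcases Nat.lt_or_ge k (i + 1) with h1 | h1
  · exact h.cl_eq_of_le (by omega)
  · exact h.cl_eq_of_ge (by omega)

theorem cl_le (h : IsBoxAddition i hi a b) (k : ℕ) : b.cl k ≤ a.cl k := by
  by_cases hk : k = i + 1
  · rw [hk, h.cl_left, h.cl_right]; omega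
  · rw [h.cl_eq hk]

theorem height_eq (h : IsBoxAddition i hi a b) {k : ℕ} (hk : k ≤ n) (hk' : k ≠ i + 1) :
    b.height k = a.height k := by
  rw [a.height_eq hk, b.height_eq hk, h.cl_eq hk']

theorem height_left (h : IsBoxAddition i hi a b) : a.height i = a.height (i + 1) + 1 := by
  have := a.height_succ_of_not_isOpening h.1
  simp only at this
  omega

/-- Bounds the index of `μ` in a box addition. Only `n - i - 2` steps follow, and at least one
closing bracket precedes, so the index stays below `n - p`. -/
theorem height_add_one_lt (h : IsBoxAddition i hi a b) : a.height (i + 1) + 1 < n - p := by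
  have h1 := a.cl_add_le (i + 2) (n - (i + 2))
  have h2 := a.cl_succ_of_isOpening h.2.1
  have h3 := h.cl_left
  rw [Nat.add_sub_cancel' (by omega), cl_self] at h1
  simp only [add_assoc, Nat.reduceAdd] at h2
  rw [a.height_eq (by omega)]
  have h4 := a.two_mul_arches_le
  push_cast
  omega

theorem arches_pos (h : IsBoxAddition i hi a b) : 0 < p := by
  have h1 := a.cl_mono (show i + 1 ≤ n by omega)
  rw [cl_self, h.cl_left] at h1
  omega

end IsBoxAddition

/-- A measure that increases under box addition. -/
def area (a : HalfDiagram n p) : ℕ := ∑ k ∈ Finset.range (n + 1), (k - a.cl k)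

theorem IsBoxAddition.area_lt {i : ℕ} {hi : i + 1 < n} {a b : HalfDiagram n p}
    (h : IsBoxAddition i hi a b) : a.area < b.area := by
  refine Finset.sum_lt_sum (fun k _ => Nat.sub_le_sub_left (h.cl_le k) k)
    ⟨i + 1, Finset.mem_range.mpr (by omega), ?_⟩
  have h1 := a.two_mul_cl_le (show i + 1 ≤ n by omega)
  have h2 := h.cl_left
  have h3 := h.cl_right
  omega

/-- Removing a box moves a closing bracket from `i + 1` to `i`. The path drops only after `i + 1`
steps, and there the hypothesis on the height keeps it nonnegative. -/
theorem exists_isBoxAddition {b : HalfDiagram n p} {i : ℕ} {hi : i + 1 < n}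
    (h1 : b.IsOpening ⟨i, by omega⟩) (h2 : ¬ b.IsOpening ⟨i + 1, hi⟩) (h3 : 1 ≤ b.height i) :
    ∃ a, IsBoxAddition i hi a b := by
  have hmem1 : i ∉ b.closers := fun h => (mem_closers (j := ⟨i, by omega⟩)).mp h h1
  have hmem2 : i + 1 ∈ b.closers := (mem_closers (j := ⟨i + 1, hi⟩)).mpr h2
  set S := insert i (b.closers.erase (i + 1)) with hS
  have hcard : S.card = p := by
    have h := Finset.card_erase_add_one hmem2
    rw [b.card_closers] at h
    rw [hS, Finset.card_insert_of_notMem (by simp [hmem1]), h]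
  rw [b.height_eq (by omega)] at h3
  have hcl := b.cl_succ_of_isOpening h1
  simp only at hcl
  obtain ⟨a, ha⟩ := exists_of_ballot n S
    (by
      intro s hs
      rcases Finset.mem_insert.mp hs with rfl | hs
      · omega
      · exact lt_of_mem_closers (Finset.mem_of_mem_erase hs))
    (by
      intro k hk
      have hb := b.two_mul_cl_le hk
      rcases Nat.lt_or_ge k (i + 1) with hk1 | hk1
      · have : S.filter (· < k) ⊆ b.closers.filter (· < k) := by
          intro s hs
          simp only [hS, Finset.mem_filter, Finset.mem_insert, Finset.mem_erase] at hs ⊢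
          rcases hs with ⟨h | h, h'⟩
          · omega
          · exact ⟨h.2, h'⟩
        have := Finset.card_le_card this
        rw [card_closers_filter] at this
        omega
      · by_cases hk2 : k = i + 1
        · subst hk2
          have : S.filter (· < i + 1) ⊆ insert i (b.closers.filter (· < i + 1)) := by
            intro s hs
            simp only [hS, Finset.mem_filter, Finset.mem_insert, Finset.mem_erase] at hs ⊢
            rcases hs with ⟨h | h, h'⟩
            · exact Or.inl h
            · exact Or.inr ⟨h.2, h'⟩
          have := (Finset.card_le_card this).trans (Finset.card_insert_le _ _)
          rw [card_closers_filter] at this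
          omega
        · have : S.filter (· < k) = insert i ((b.closers.filter (· < k)).erase (i + 1)) := by
            ext s
            simp only [hS, Finset.mem_filter, Finset.mem_insert, Finset.mem_erase]
            constructor
            · rintro ⟨h | h, h'⟩
              · exact Or.inl h
              · exact Or.inr ⟨h.1, h.2, h'⟩
            · rintro (h | h)
              · exact ⟨Or.inl h, by omega⟩
              · exact ⟨Or.inr ⟨h.1, h.2.1⟩, h.2.2⟩
          have hm : i + 1 ∈ b.closers.filter (· < k) := Finset.mem_filter.mpr ⟨hmem2, by omega⟩
          have h4 := Finset.card_erase_add_one hm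
          rw [card_closers_filter] at h4
          have h5 := Finset.card_insert_le i ((b.closers.filter (· < k)).erase (i + 1))
          rw [← this] at h5
          omega)
    p hcard.symm
  refine ⟨a, ?_, ?_, h1, h2, fun j hj1 hj2 => ?_⟩
  · rw [ha]; simp [hS]
  · rw [ha]; simp [hS]
  · rw [ha, hS, Finset.mem_insert, Finset.mem_erase, mem_closers]
    tauto

/-- Two distinct peaks of a path are never adjacent, so both boxes can be removed in either order.
This is the confluence behind the second basis being well defined. -/
theorem IsBoxAddition.diamond {i j : ℕ} {hi : i + 1 < n} {hj : j + 1 < n} {a a' b : HalfDiagram n p}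
    (h : IsBoxAddition i hi a b) (h' : IsBoxAddition j hj a' b) (hij : i ≠ j) :
    (i + 1 < j ∨ j + 1 < i) ∧ ∃ c, IsBoxAddition j hj c a ∧ IsBoxAddition i hi c a' := by
  have h1 : i + 1 ≠ j := by rintro rfl; exact h.2.2.2.1 h'.2.2.1
  have h2 : j + 1 ≠ i := by rintro rfl; exact h'.2.2.2.1 h.2.2.1
  refine ⟨by omega, ?_⟩
  have hA : ∀ k : Fin n, (k : ℕ) ≠ i → (k : ℕ) ≠ i + 1 → (b.IsOpening k ↔ a.IsOpening k) := h.2.2.2.2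
  have hA' : ∀ k : Fin n, (k : ℕ) ≠ j → (k : ℕ) ≠ j + 1 → (b.IsOpening k ↔ a'.IsOpening k) :=
    h'.2.2.2.2
  obtain ⟨c, hc⟩ := exists_isBoxAddition (b := a') (hi := hi)
    ((hA' _ (by simp; omega) (by simp; omega)).mp h.2.2.1)
    ((not_congr (hA' _ (by simp; omega) (by simp; omega))).mp h.2.2.2.1)
    (by
      rw [← h'.height_eq (by omega) (by omega), h.height_eq (by omega) (by omega), h.height_left]
      have := a.height_nonneg (show i + 1 ≤ n by omega)
      omega)
  have hC : ∀ k : Fin n, (k : ℕ) ≠ i → (k : ℕ) ≠ i + 1 → (a'.IsOpening k ↔ c.IsOpening k) :=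
    hc.2.2.2.2
  refine ⟨c, ⟨?_, ?_, ?_, ?_, fun k hk1 hk2 => ?_⟩, hc⟩
  · rw [← hC _ (by simp; omega) (by simp; omega)]; exact h'.1
  · rw [← hC _ (by simp; omega) (by simp; omega)]; exact h'.2.1
  · rw [← hA _ (by simp; omega) (by simp; omega)]; exact h'.2.2.1
  · rw [← hA _ (by simp; omega) (by simp; omega)]; exact h'.2.2.2.1
  · by_cases hk3 : (k : ℕ) = i
    · obtain rfl : k = ⟨i, Nat.lt_of_succ_lt hi⟩ := Fin.ext hk3
      simp [h.1, hc.1]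
    · by_cases hk4 : (k : ℕ) = i + 1
      · obtain rfl : k = ⟨i + 1, hi⟩ := Fin.ext hk4
        simp [h.2.1, hc.2.1]
      · rw [← hA k hk3 hk4, hA' k hk1 hk2, hC k hk3 hk4]

/-! ### The minimal half-diagram -/

/-- The half-diagram with the arches `{2 t, 2 t + 1}` for `t < p`. -/
def minimal (n p : ℕ) (h : 2 * p ≤ n) : HalfDiagram n p where
  partner x := ⟨if (x : ℕ) < 2 * p then (if (x : ℕ) % 2 = 0 then (x : ℕ) + 1 else (x : ℕ) - 1) else x, by
    have := x.isLt
    split_ifs <;> omega⟩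
  invol x := by
    rw [Fin.ext_iff]
    dsimp only
    split_ifs <;> omega
  noncrossing x y := by
    simp only [Fin.lt_def, ne_eq, Fin.ext_iff]
    intro h1 h2
    split_ifs at h2 ⊢ <;> omega
  card_through := by
    have h1 : (Finset.univ.filter fun i : Fin n => (⟨if (i : ℕ) < 2 * p then (if (i : ℕ) % 2 = 0 then
        (i : ℕ) + 1 else (i : ℕ) - 1) else i, by split_ifs <;> omega⟩ : Fin n) = i) =
        Finset.univ.filter fun i : Fin n => ¬ (i : ℕ) < 2 * p := by
      refine Finset.filter_congr fun i _ => ?_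
      rw [Fin.ext_iff]
      dsimp only
      split_ifs <;> omega
    rw [h1]
    have h2 := Finset.card_filter_add_card_filter_not (s := (Finset.univ : Finset (Fin n)))
      (fun j => (j : ℕ) < 2 * p)
    rw [card_filter_val_lt h, Finset.card_univ, Fintype.card_fin] at h2
    omega

theorem isMinimal_minimal (h : 2 * p ≤ n) : (minimal n p h).IsMinimal := fun _ => rfl

theorem IsMinimal.eq {a b : HalfDiagram n p} (ha : a.IsMinimal) (hb : b.IsMinimal) : a = b := by
  ext i
  rw [ha, hb]

theorem IsMinimal.isOpening_iff {a : HalfDiagram n p} (ha : a.IsMinimal) (i : Fin n) :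
    a.IsOpening i ↔ ((i : ℕ) < 2 * p → (i : ℕ) % 2 = 0) := by
  unfold IsOpening
  rw [Fin.le_def, ha]
  split_ifs <;> omega

theorem IsMinimal.cl_eq {a : HalfDiagram n p} (ha : a.IsMinimal) {k : ℕ} (hk : k ≤ n) :
    a.cl k = min (k / 2) p := by
  induction k with
  | zero => simp
  | succ k ih =>
    have h1 := ih (by omega)
    have h2 := ha.isOpening_iff ⟨k, hk⟩
    simp only at h2
    by_cases ho : a.IsOpening ⟨k, hk⟩
    · have h3 := a.cl_succ_of_isOpening ho
      have h4 := h2.mp ho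
      simp only at h3
      by_cases h5 : k < 2 * p
      · have := h4 h5; omega
      · omega
    · have h3 := a.cl_succ_of_not_isOpening ho
      obtain ⟨h4, h5⟩ := Classical.not_imp.mp fun h => ho (h2.mpr h)
      simp only at h3
      omega

/-- At the first deviation `t` from the zigzag the path must open where the zigzag closes, so its
height before `t` is 1. The next closing bracket then ends a peak whose base has height at least 1,
and a box can be removed. -/
theorem exists_isBoxAddition_of_not_isMinimal {b : HalfDiagram n p} (hb : ¬ b.IsMinimal) :
    ∃ i hi a, IsBoxAddition i hi a b := by
  have hp := b.two_mul_arches_le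
  have hm := isMinimal_minimal hp
  have hne : ∃ t : ℕ, ∃ ht : t < n, ¬ (b.IsOpening ⟨t, ht⟩ ↔ (minimal n p hp).IsOpening ⟨t, ht⟩) := by
    by_contra! hcon
    exact hb ((ext_of_isOpening fun i => hcon i i.isLt : b = _) ▸ hm)
  classical
  have hspec := Nat.find_spec hne
  have hmin := fun m => @Nat.find_min _ _ hne m
  set t := Nat.find hne
  obtain ⟨ht, hdiff⟩ := hspec
  have hcl : b.cl t = min (t / 2) p := by
    rw [← hm.cl_eq ht.le]
    unfold cl
    congr 1
    ext j
    simp only [Finset.mem_filter, Finset.mem_univ, true_and, and_congr_right_iff]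
    intro hj
    have := hmin j hj
    push Not at this
    exact not_congr (this j.isLt)
  have hop := hm.isOpening_iff ⟨t, ht⟩
  have hn := b.cl_self
  simp only at hop
  -- An extra closing bracket would take the path below zero at a return of the zigzag, or exceed
  -- the total of `p` after the zigzag has ended.
  have hbo : b.IsOpening ⟨t, ht⟩ := by
    by_contra hbo
    have h1 := b.cl_succ_of_not_isOpening hbo
    have h2 := b.two_mul_cl_le (show t + 1 ≤ n by omega)
    have h3 := b.cl_mono (show t + 1 ≤ n by omega)
    simp only at h1
    have h4 : ¬ (t < 2 * p → t % 2 = 0) := by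
      intro h
      by_cases h5 : t < 2 * p
      · have := h h5; omega
      · omega
    exact hdiff (by simp only [hbo, hop, h4])
  have hto : t < 2 * p ∧ t % 2 = 1 := by
    have h4 : ¬ (t < 2 * p → t % 2 = 0) := fun h => hdiff (by simp only [hbo, hop]; simpa using h)
    omega
  -- Fewer than `p` brackets have closed before `t`, so another one must close later.
  have hne2 : ∃ k : ℕ, t ≤ k ∧ ∃ hk : k < n, ¬ b.IsOpening ⟨k, hk⟩ := by
    by_contra! hcon
    have : ∀ k, t ≤ k → k ≤ n → b.cl k = b.cl t := by
      intro k hk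
      induction k, hk using Nat.le_induction with
      | base => intro _; rfl
      | succ k hk ih =>
        intro hkn
        rw [← ih (by omega)]
        exact b.cl_succ_of_isOpening (hcon k hk hkn)
    have := this n ht.le le_rfl
    omega
  have hspec2 := Nat.find_spec hne2
  have hmin2 := fun m => @Nat.find_min _ _ hne2 m
  set k := Nat.find hne2
  obtain ⟨htk, hkn, hko⟩ := hspec2
  have htk' : t ≠ k := by
    intro h
    exact hko (by simpa only [← h] using hbo)
  obtain ⟨i, hik⟩ : ∃ i, k = i + 1 := ⟨k - 1, by omega⟩
  have hopen : ∀ m, t ≤ m → (hmk : m < k) → b.IsOpening ⟨m, by omega⟩ := by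
    intro m htm hmk
    have := hmin2 m hmk
    push Not at this
    exact this htm _
  have hcl2 : ∀ m, t ≤ m → m ≤ k → b.cl m = b.cl t := by
    intro m hm
    induction m, hm using Nat.le_induction with
    | base => intro _; rfl
    | succ m hm ih =>
      intro hmk
      rw [← ih (by omega)]
      exact b.cl_succ_of_isOpening (hopen m hm hmk)
  have hin : i + 1 < n := hik ▸ hkn
  refine ⟨i, hin, exists_isBoxAddition (hopen i (by omega) (by omega)) (by simpa only [hik] using hko) ?_⟩
  rw [b.height_eq (by omega), hcl2 i (by omega) (by omega)]
  omega

theorem box_induction {P : HalfDiagram n p → Prop} (hmin : ∀ a, a.IsMinimal → P a)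
    (hbox : ∀ i hi a b, IsBoxAddition i hi a b → P a → P b) (b : HalfDiagram n p) : P b := by
  suffices h : ∀ m, ∀ b : HalfDiagram n p, b.area = m → P b from h _ b rfl
  intro m
  induction m using Nat.strong_induction_on with
  | _ m ih =>
    intro b hb
    by_cases h : b.IsMinimal
    · exact hmin b h
    · obtain ⟨i, hi, a, hab⟩ := exists_isBoxAddition_of_not_isMinimal h
      exact hbox i hi a b hab (ih _ (hb ▸ hab.area_lt) a rfl)

/-- The minimal diagram has the largest possible closing counts `min (k / 2) p`, whereas a box
lowers the count after `i + 1` steps. -/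
theorem IsBoxAddition.not_isMinimal {i : ℕ} {hi : i + 1 < n} {a b : HalfDiagram n p}
    (h : IsBoxAddition i hi a b) : ¬ b.IsMinimal := by
  intro hb
  have h1 := h.cl_right
  have h2 := h.cl_left
  have h3 := a.two_mul_cl_le (show i + 1 ≤ n by omega)
  have h4 := hb.cl_eq (show i + 1 ≤ n by omega)
  have h5 := h.arches_pos
  have h6 := a.cl_mono (show i + 1 ≤ n by omega)
  rw [cl_self] at h6
  omega

end HalfDiagram

end TemperleyLieb

end

noncomputable section

namespace TemperleyLieb

namespace HalfDiagram

variable {n p : ℕ}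

/-! ### The action of a generator on a half-diagram -/

/-- The partner function after the points `u` and `v` have been joined to each other and their
former partners to one another. -/
def capPartner (a : HalfDiagram n p) (u v j : Fin n) : Fin n :=
  if j = u then v else if j = v then u
  else if a.partner j = u then (if a.partner v = v then j else a.partner v)
  else if a.partner j = v then (if a.partner u = u then j else a.partner u)
  else a.partner j

theorem capPartner_invol (a : HalfDiagram n p) {u v : Fin n} (hv : (v : ℕ) = u + 1) (j : Fin n) :
    a.capPartner u v (a.capPartner u v j) = j := by
  have huv : u ≠ v := by rintro rfl; omega
  have h1 := a.invol u
  have h2 := a.invol v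
  have h3 := a.invol j
  unfold capPartner
  grind

theorem capPartner_cases (a : HalfDiagram n p) {u v : Fin n} (huv : u ≠ v) (x : Fin n) :
    (x = u ∧ a.capPartner u v x = v) ∨ (x = v ∧ a.capPartner u v x = u) ∨
      (x ≠ u ∧ x ≠ v ∧ a.partner x = u ∧ a.partner v = v ∧ a.capPartner u v x = x) ∨
      (x ≠ u ∧ x ≠ v ∧ a.partner x = u ∧ a.partner v ≠ v ∧ a.capPartner u v x = a.partner v) ∨
      (x ≠ u ∧ x ≠ v ∧ a.partner x = v ∧ a.partner u = u ∧ a.capPartner u v x = x) ∨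
      (x ≠ u ∧ x ≠ v ∧ a.partner x = v ∧ a.partner u ≠ u ∧ a.capPartner u v x = a.partner u) ∨
      (x ≠ u ∧ x ≠ v ∧ a.partner x ≠ u ∧ a.partner x ≠ v ∧ a.capPartner u v x = a.partner x) := by
  unfold capPartner
  by_cases c1 : x = u <;> by_cases c2 : x = v <;> by_cases c3 : a.partner x = u <;>
    by_cases c4 : a.partner x = v <;> by_cases c5 : a.partner u = u <;>
    by_cases c6 : a.partner v = v <;> simp_all

/-- Since `u` and `v` are adjacent, nothing lies between them. The only other new arch joins their
old partners, and each possible crossing with it is traced back to nesting under an old arch. -/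
theorem capPartner_noncrossing (a : HalfDiagram n p) {u v : Fin n} (hv : (v : ℕ) = u + 1) (i k : Fin n)
    (hik : i < k) (hk : k < a.capPartner u v i) :
    a.capPartner u v k ≠ k ∧ ¬ a.capPartner u v i < a.capPartner u v k := by
  have huv : u ≠ v := by rintro rfl; omega
  have h1 := a.invol u
  have h2 := a.invol v
  have h3 := a.invol i
  have h4 := a.invol k
  have key := a.capPartner_cases huv
  have I := fun x y => @inner n p a x y
  rcases key i with ⟨e1, e2⟩ | ⟨e1, e2⟩ | ⟨n1, n2, e1, e3, e2⟩ | ⟨n1, n2, e1, e3, e2⟩ |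
    ⟨n1, n2, e1, e3, e2⟩ | ⟨n1, n2, e1, e3, e2⟩ | ⟨n1, n2, n3, n4, e2⟩ <;> rw [e2] at hk ⊢
  · simp only [Fin.lt_def, Fin.ext_iff] at *; omega
  · simp only [Fin.lt_def, Fin.ext_iff] at *; omega
  · exact absurd (hik.trans hk) (lt_irrefl _)
  · have i1 := I i k
    have i2 := I v k
    have i3 := I i (a.partner v)
    clear I
    rw [e1] at h3
    rcases key k with ⟨f1, f2⟩ | ⟨f1, f2⟩ | ⟨m1, m2, f1, f3, f2⟩ | ⟨m1, m2, f1, f3, f2⟩ |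
      ⟨m1, m2, f1, f3, f2⟩ | ⟨m1, m2, f1, f3, f2⟩ | ⟨m1, m2, m3, m4, f2⟩ <;> rw [f2] <;>
      clear key <;> simp only [Fin.lt_def, Fin.ext_iff, ne_eq] at * <;> grind
  · exact absurd (hik.trans hk) (lt_irrefl _)
  · have i1 := I i k
    have i2 := I u k
    have i3 := I (a.partner u) (a.partner k)
    clear I
    rcases key k with ⟨f1, f2⟩ | ⟨f1, f2⟩ | ⟨m1, m2, f1, f3, f2⟩ | ⟨m1, m2, f1, f3, f2⟩ |
      ⟨m1, m2, f1, f3, f2⟩ | ⟨m1, m2, f1, f3, f2⟩ | ⟨m1, m2, m3, m4, f2⟩ <;> rw [f2] <;>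
      clear key <;> simp only [Fin.lt_def, Fin.ext_iff, ne_eq] at * <;> grind
  · have i1 := I i k
    have i2 := I i u
    have i3 := I i v
    clear I
    rcases key k with ⟨f1, f2⟩ | ⟨f1, f2⟩ | ⟨m1, m2, f1, f3, f2⟩ | ⟨m1, m2, f1, f3, f2⟩ |
      ⟨m1, m2, f1, f3, f2⟩ | ⟨m1, m2, f1, f3, f2⟩ | ⟨m1, m2, m3, m4, f2⟩ <;> rw [f2] <;>
      clear key <;> simp only [Fin.lt_def, Fin.ext_iff, ne_eq] at * <;> grind

/-- If one of the two points carries a through-string, that string continues to the old partner of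
the other point; otherwise none is affected. -/
theorem card_capPartner (a : HalfDiagram n p) {u v : Fin n} (hv : (v : ℕ) = u + 1)
    (h : ¬ (a.partner u = u ∧ a.partner v = v)) :
    (Finset.univ.filter fun i => a.capPartner u v i = i).card =
      (Finset.univ.filter fun i => a.partner i = i).card := by
  have huv : u ≠ v := by rintro rfl; omega
  have h1 := a.invol u
  have h2 := a.invol v
  by_cases hu : a.partner u = u
  · have hvv : a.partner v ≠ v := fun h' => h ⟨hu, h'⟩
    have : (Finset.univ.filter fun i => a.capPartner u v i = i) =
        insert (a.partner v) ((Finset.univ.filter fun i => a.partner i = i).erase u) := by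
      ext j
      have h3 := a.invol j
      simp only [Finset.mem_filter, Finset.mem_univ, true_and, Finset.mem_insert, Finset.mem_erase]
      unfold capPartner
      grind
    rw [this, Finset.card_insert_of_notMem (by simp [h2, hvv.symm]), Finset.card_erase_add_one]
    simpa using hu
  · by_cases hvv : a.partner v = v
    · have : (Finset.univ.filter fun i => a.capPartner u v i = i) =
          insert (a.partner u) ((Finset.univ.filter fun i => a.partner i = i).erase v) := by
        ext j
        have h3 := a.invol j
        simp only [Finset.mem_filter, Finset.mem_univ, true_and, Finset.mem_insert, Finset.mem_erase]
        unfold capPartner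
        grind
      rw [this, Finset.card_insert_of_notMem (by simp [h1, Ne.symm hu]), Finset.card_erase_add_one]
      simpa using hvv
    · congr 1
      ext j
      have h3 := a.invol j
      simp only [Finset.mem_filter, Finset.mem_univ, true_and]
      unfold capPartner
      grind

/-- The half-diagram obtained by joining the points `u` and `v = u + 1`, not both of which are
through-strings. -/
def cap (a : HalfDiagram n p) (u v : Fin n) (hv : (v : ℕ) = u + 1)
    (h : ¬ (a.partner u = u ∧ a.partner v = v)) : HalfDiagram n p where
  partner := a.capPartner u v
  invol := a.capPartner_invol hv
  noncrossing := a.capPartner_noncrossing hv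
  card_through := by rw [a.card_capPartner hv h]; exact a.card_through

end HalfDiagram

end TemperleyLieb

end

noncomputable section

namespace TemperleyLieb

open HalfDiagram

variable {n p : ℕ} {ι : Type}

/-! ### Colourings of half-diagrams -/

/-- The colouring `c` of the points is constant on the arches of `b`, and takes at each
through-string the colour of the label of the through-string. -/
def CompatWith (b : HalfDiagram n p) (τ : Fin n → ι) (c : Fin n → Bool) (t : ι → Bool) : Prop :=
  (∀ i, c (b.partner i) = c i) ∧ ∀ i, b.partner i = i → c i = t (τ i)

open Classical in
/-- The indicator function of the compatible colourings. -/
def wt (b : HalfDiagram n p) (τ : Fin n → ι) (c : Fin n → Bool) (t : ι → Bool) : ℕ :=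
  if CompatWith b τ c t then 1 else 0

theorem wt_congr {b b' : HalfDiagram n p} {τ τ' : Fin n → ι} {c c' : Fin n → Bool} {t t' : ι → Bool}
    (h : CompatWith b τ c t ↔ CompatWith b' τ' c' t') : wt b τ c t = wt b' τ' c' t' := by
  unfold wt
  split_ifs <;> tauto

/-- Gives the colour `x` to the points `u` and `v`. -/
def recolor (u v : Fin n) (c : Fin n → Bool) (x : Bool) (j : Fin n) : Bool :=
  if j = u ∨ j = v then x else c j

/-- The operator on functions of colourings that belongs to a generator. -/
def capOp (u v : Fin n) (f : (Fin n → Bool) → ℕ) (c : Fin n → Bool) : ℕ :=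
  if c u = c v then ∑ x : Bool, f (recolor u v c x) else 0

/-- The labels of the through-strings after a cap. -/
def capLabel (b : HalfDiagram n p) (τ : Fin n → ι) (u v j : Fin n) : ι :=
  if b.partner u = u ∧ j = b.partner v then τ u
  else if b.partner v = v ∧ j = b.partner u then τ v else τ j

/-- When `u` and `v` are not joined to each other, the strand leaving `u` forces the common colour
`x`. The condition left over from `v` says that the two strands agree, which is the arch or moved
through-string of the cap. -/
theorem compatWith_cap_iff (b : HalfDiagram n p) (τ : Fin n → ι) {u v : Fin n} (hv : (v : ℕ) = u + 1)
    (h : ¬ (b.partner u = u ∧ b.partner v = v)) (huv : b.partner u ≠ v) (c : Fin n → Bool)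
    (t : ι → Bool) (hc : c u = c v) (x : Bool) :
    CompatWith b τ (recolor u v c x) t ↔ x = (if b.partner u = u then t (τ u) else c (b.partner u)) ∧
      CompatWith (b.cap u v hv h) (capLabel b τ u v) c t := by
  have hne : u ≠ v := by rintro rfl; omega
  have hvu : b.partner v ≠ u := fun h' => huv (by rw [← h', b.invol])
  have hu2 := b.invol u
  have hv2 := b.invol v
  have key := b.capPartner_cases hne
  constructor
  · rintro ⟨h1, h2⟩
    have a1 := h1 u
    have a2 := h1 v
    have a3 := h2 u
    have a4 := h2 v
    refine ⟨by unfold recolor at *; grind, fun i => ?_, fun i => ?_⟩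
    · have b1 := h1 i
      have b2 := b.invol i
      change c (b.capPartner u v i) = c i
      clear h1 h2
      rcases key i with ⟨e1, e2⟩ | ⟨e1, e2⟩ | ⟨n1, n2, e1, e3, e2⟩ | ⟨n1, n2, e1, e3, e2⟩ |
        ⟨n1, n2, e1, e3, e2⟩ | ⟨n1, n2, e1, e3, e2⟩ | ⟨n1, n2, n3, n4, e2⟩ <;> rw [e2] <;>
        clear key <;> unfold recolor at * <;> grind
    · have b1 := h1 i
      have b2 := b.invol i
      have b3 := h2 i
      change b.capPartner u v i = i → c i = t (capLabel b τ u v i)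
      clear h1 h2
      rcases key i with ⟨e1, e2⟩ | ⟨e1, e2⟩ | ⟨n1, n2, e1, e3, e2⟩ | ⟨n1, n2, e1, e3, e2⟩ |
        ⟨n1, n2, e1, e3, e2⟩ | ⟨n1, n2, e1, e3, e2⟩ | ⟨n1, n2, n3, n4, e2⟩ <;> rw [e2] <;>
        clear key <;> unfold recolor capLabel at * <;> grind
  · rintro ⟨hx, h1, h2⟩
    change ∀ i, c (b.capPartner u v i) = c i at h1
    change ∀ i, b.capPartner u v i = i → c i = t (capLabel b τ u v i) at h2
    have a1 := h1 (b.partner u)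
    have a2 := h1 (b.partner v)
    have a3 := h2 (b.partner u)
    have a4 := h2 (b.partner v)
    refine ⟨fun i => ?_, fun i => ?_⟩
    · have b1 := h1 i
      have b2 := b.invol i
      clear h1 h2 key
      unfold recolor capPartner capLabel at *
      grind
    · have b1 := h1 i
      have b2 := b.invol i
      have b3 := h2 i
      clear h1 h2 key
      unfold recolor capPartner capLabel at *
      grind

theorem cap_of_partner_eq (b : HalfDiagram n p) {u v : Fin n} (hv : (v : ℕ) = u + 1)
    (h : ¬ (b.partner u = u ∧ b.partner v = v)) (huv : b.partner u = v) : b.cap u v hv h = b := by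
  ext1
  funext i
  have b2 := b.invol i
  have b1 := b.invol u
  change b.capPartner u v i = b.partner i
  unfold capPartner
  grind

/-- If `u` and `v` form an arch, capping closes a loop, whose colour is free. -/
theorem compatWith_recolor_iff (b : HalfDiagram n p) (τ : Fin n → ι) {u v : Fin n} (hne : u ≠ v)
    (huv : b.partner u = v) (c : Fin n → Bool) (t : ι → Bool) (hc : c u = c v) (x : Bool) :
    CompatWith b τ (recolor u v c x) t ↔ CompatWith b τ c t := by
  have hvu : b.partner v = u := by rw [← huv, b.invol]
  unfold CompatWith recolor
  constructor
  · rintro ⟨h1, h2⟩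
    refine ⟨fun i => ?_, fun i => ?_⟩
    · have b1 := h1 i
      have b2 := b.invol i
      clear h1 h2
      grind
    · have b1 := h2 i
      clear h1 h2
      grind
  · rintro ⟨h1, h2⟩
    refine ⟨fun i => ?_, fun i => ?_⟩
    · have b1 := h1 i
      have b2 := b.invol i
      clear h1 h2
      grind
    · have b1 := h2 i
      clear h1 h2
      grind

/-- A closed loop contributes 2, the number of colours; without one, exactly one value of the summed
colour can survive. -/
theorem capOp_wt (b : HalfDiagram n p) (τ : Fin n → ι) {u v : Fin n} (hv : (v : ℕ) = u + 1)
    (h : ¬ (b.partner u = u ∧ b.partner v = v)) (c : Fin n → Bool) (t : ι → Bool) :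
    capOp u v (fun c => wt b τ c t) c =
      2 ^ (if b.partner u = v then 1 else 0) * wt (b.cap u v hv h) (capLabel b τ u v) c t := by
  have hne : u ≠ v := by rintro rfl; omega
  by_cases hc : c u = c v
  · rw [capOp, if_pos hc, Fintype.sum_bool]
    by_cases huv : b.partner u = v
    · have hvu : b.partner v = u := by rw [← huv, b.invol]
      have hτ : capLabel b τ u v = τ := by
        funext j
        unfold capLabel
        grind
      rw [if_pos huv, cap_of_partner_eq b hv h huv, hτ]
      have e : ∀ x, wt b τ (recolor u v c x) t = wt b τ c t := fun x =>
        wt_congr (compatWith_recolor_iff b τ hne huv c t hc x)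
      rw [e, e, pow_one, two_mul]
    · have e := compatWith_cap_iff b τ hv h huv c t hc
      by_cases hA : CompatWith (b.cap u v hv h) (capLabel b τ u v) c t
      · simp only [hA, and_true] at e
        simp only [wt, hA, e, if_neg huv, if_true]
        cases (if b.partner u = u then t (τ u) else c (b.partner u)) <;> simp
      · simp only [hA, and_false] at e
        simp [wt, hA, e]
  · rw [capOp, if_neg hc]
    have : ¬ CompatWith (b.cap u v hv h) (capLabel b τ u v) c t := by
      intro h'
      apply hc
      rw [← h'.1 u]
      congr 1
      simp [cap, capPartner]
    rw [wt, if_neg this, mul_zero]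

/-- A through-string at `u` or `v` moves to the old partner of the other point and takes its label
along; no label is duplicated. -/
theorem capLabel_injOn (b : HalfDiagram n p) (τ : Fin n → ι) {u v : Fin n} (hv : (v : ℕ) = u + 1)
    (h : ¬ (b.partner u = u ∧ b.partner v = v)) (hτ : Set.InjOn τ {i | b.partner i = i}) :
    Set.InjOn (capLabel b τ u v) {i | (b.cap u v hv h).partner i = i} := by
  intro i hi j hj hij
  change b.capPartner u v i = i at hi
  change b.capPartner u v j = j at hj
  have h1 : ∀ i j, b.partner i = i → b.partner j = j → τ i = τ j → i = j := fun i j a b c => hτ a b c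
  have c1 := h1 u i
  have c2 := h1 v i
  have c3 := h1 u j
  have c4 := h1 v j
  have c5 := h1 i j
  have c6 := b.invol i
  have c7 := b.invol j
  have c8 := b.invol u
  have c9 := b.invol v
  clear h1
  unfold capPartner capLabel at *
  grind (splits := 20)

theorem capLabel_mapsTo (b : HalfDiagram n p) (τ : Fin n → ι) {u v : Fin n} (hv : (v : ℕ) = u + 1)
    (h : ¬ (b.partner u = u ∧ b.partner v = v)) {T : Set ι} (hτ : Set.MapsTo τ {i | b.partner i = i} T) :
    Set.MapsTo (capLabel b τ u v) {i | (b.cap u v hv h).partner i = i} T := by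
  intro i hi
  change b.capPartner u v i = i at hi
  have h1 : ∀ i, b.partner i = i → τ i ∈ T := fun i a => hτ a
  have c1 := h1 u
  have c2 := h1 v
  have c3 := h1 i
  have c6 := b.invol i
  have c8 := b.invol u
  have c9 := b.invol v
  clear h1
  unfold capPartner capLabel at *
  grind (splits := 20)

/-! ### States -/

/-- A half-diagram with a number of closed loops, or zero. -/
abbrev State (n p : ℕ) : Type := Option (HalfDiagram n p × ℕ)

/-- The result of joining the points `u` and `v = u + 1`. -/
def capState (u v : Fin n) (hv : (v : ℕ) = u + 1) (b : HalfDiagram n p) : State n p :=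
  if h : b.partner u = u ∧ b.partner v = v then none
  else some (b.cap u v hv h, if b.partner u = v then 1 else 0)

/-- Adds closed loops. -/
def State.addLoops (s : State n p) (l : ℕ) : State n p := s.map fun r => (r.1, l + r.2)

/-- The state `s` describes the function `Z` of the colourings of the points and of the labels. -/
def Rep (T : Set ι) (Z : (Fin n → Bool) → (ι → Bool) → ℕ) : State n p → Prop
  | none => ∃ x ∈ T, ∃ y ∈ T, x ≠ y ∧ ∀ c t, Z c t ≠ 0 → t x = t y
  | some (b, l) => ∃ τ : Fin n → ι, Set.InjOn τ {i | b.partner i = i} ∧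
      Set.MapsTo τ {i | b.partner i = i} T ∧ ∀ c t, Z c t = 2 ^ l * wt b τ c t

theorem capOp_mul (u v : Fin n) (f : (Fin n → Bool) → ℕ) (m : ℕ) (c : Fin n → Bool) :
    capOp u v (fun c => m * f c) c = m * capOp u v f c := by
  unfold capOp
  split_ifs
  · rw [Finset.mul_sum]
  · simp

theorem capOp_ne_zero {u v : Fin n} {f : (Fin n → Bool) → ℕ} {c : Fin n → Bool} (h : capOp u v f c ≠ 0) :
    c u = c v ∧ ∃ x, f (recolor u v c x) ≠ 0 := by
  unfold capOp at h
  split_ifs at h with hc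
  · refine ⟨hc, ?_⟩
    by_contra! hcon
    exact h (Finset.sum_eq_zero fun x _ => hcon x)
  · exact absurd rfl h

/-- Capping diagrams corresponds to `capOp` on functions. Joining two through-strings equates the
colours of their distinct labels, which is what the zero state records, and this constraint survives
later caps. -/
theorem Rep.cap {T : Set ι} {Z : (Fin n → Bool) → (ι → Bool) → ℕ} {s : State n p} (h : Rep T Z s)
    {u v : Fin n} (hv : (v : ℕ) = u + 1) :
    Rep T (fun c t => capOp u v (fun c => Z c t) c)
      (s.bind fun r => (capState u v hv r.1).addLoops r.2) := by
  have hne : u ≠ v := by rintro rfl; omega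
  match s, h with
  | none, ⟨x, hx, y, hy, hxy, h⟩ =>
    exact ⟨x, hx, y, hy, hxy, fun c t hZ => by
      obtain ⟨_, z, hz⟩ := capOp_ne_zero hZ
      exact h _ _ hz⟩
  | some (b, l), ⟨τ, h1, h2, h3⟩ =>
    simp only [Option.bind_some]
    by_cases hb : b.partner u = u ∧ b.partner v = v
    · simp only [capState, dif_pos hb]
      refine ⟨τ u, h2 hb.1, τ v, h2 hb.2, fun h => hne (h1 hb.1 hb.2 h), fun c t hZ => ?_⟩
      obtain ⟨_, z, hz⟩ := capOp_ne_zero hZ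
      rw [h3] at hz
      have : CompatWith b τ (recolor u v c z) t := by
        by_contra hcon
        exact hz (by rw [wt, if_neg hcon, mul_zero])
      have e1 := this.2 u hb.1
      have e2 := this.2 v hb.2
      rw [← e1, ← e2]
      simp [recolor]
    · simp only [capState, dif_neg hb]
      refine ⟨capLabel b τ u v, capLabel_injOn b τ hv hb h1, capLabel_mapsTo b τ hv hb h2,
        fun c t => ?_⟩
      simp only [h3, capOp_mul]
      rw [capOp_wt b τ hv hb, pow_add, mul_assoc]

/-- Two labelled colourings suffice to distinguish states. -/
theorem exists_compatWith (b : HalfDiagram n p) {τ : Fin n → ι} (h : Set.InjOn τ {i | b.partner i = i})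
    (c : Fin n → Bool) (hc : ∀ i, c (b.partner i) = c i) : ∃ t, CompatWith b τ c t := by
  classical
  refine ⟨fun l => decide (∃ k, b.partner k = k ∧ τ k = l ∧ c k = true), hc, fun i hi => ?_⟩
  by_cases hci : c i = true
  · rw [hci, eq_comm, decide_eq_true_iff]
    exact ⟨i, hi, rfl, hci⟩
  · have : ¬ ∃ k, b.partner k = k ∧ τ k = τ i ∧ c k = true := by
      rintro ⟨k, hk, hki, hck⟩
      rw [h hk hi hki] at hck
      exact hci hck
    simp [this, hci]

theorem exists_compatWith_label (b : HalfDiagram n p) (τ : Fin n → ι) (t : ι → Bool) :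
    ∃ c, CompatWith b τ c t := by
  refine ⟨fun i => if b.partner i = i then t (τ i) else false, fun i => ?_, fun i hi => by simp [hi]⟩
  have := b.invol i
  by_cases hi : b.partner i = i
  · simp [hi]
  · have : b.partner (b.partner i) ≠ b.partner i := fun h => hi (b.partner_injective h)
    simp [hi, this]

theorem wt_ne_zero {b : HalfDiagram n p} {τ : Fin n → ι} {c : Fin n → Bool} {t : ι → Bool} :
    wt b τ c t ≠ 0 ↔ CompatWith b τ c t := by
  simp [wt]

/-- In a nonzero state the colours of distinct labels are independent: colour only `x` and extend.
This separates nonzero states from the zero state. -/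
theorem Rep.label_eq_iff {T : Set ι} {Z : (Fin n → Bool) → (ι → Bool) → ℕ} {b : HalfDiagram n p} {l : ℕ}
    (h : Rep T Z (some (b, l))) (x y : ι) : (∀ c t, Z c t ≠ 0 → t x = t y) ↔ x = y := by
  classical
  obtain ⟨τ, h1, h2, h3⟩ := h
  refine ⟨fun h => ?_, fun h => by simp [h]⟩
  by_contra hxy
  obtain ⟨c, hc⟩ := exists_compatWith_label b τ (fun l => decide (l = x))
  have := h c _ (by rw [h3]; exact mul_ne_zero (by positivity) (wt_ne_zero.mpr hc))
  simp [Ne.symm hxy] at this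

/-- Arches can be read off the function: colouring exactly `i` and its partner distinguishes `i`
from every other point. -/
theorem Rep.partner_eq_iff {T : Set ι} {Z : (Fin n → Bool) → (ι → Bool) → ℕ} {b : HalfDiagram n p} {l : ℕ}
    (h : Rep T Z (some (b, l))) {i j : Fin n} (hij : i ≠ j) :
    (∀ c t, Z c t ≠ 0 → c i = c j) ↔ b.partner i = j := by
  classical
  obtain ⟨τ, h1, h2, h3⟩ := h
  constructor
  · intro h
    by_contra hb
    obtain ⟨t, ht⟩ := exists_compatWith b h1 (fun k => decide (k = i ∨ k = b.partner i)) (fun k => by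
      have := b.invol k
      have := b.invol i
      rw [decide_eq_decide]
      grind)
    have := h _ t (by rw [h3]; exact mul_ne_zero (by positivity) (wt_ne_zero.mpr ht))
    grind
  · intro hb c t hZ
    rw [h3] at hZ
    have := wt_ne_zero.mp (right_ne_zero_of_mul hZ)
    rw [← this.1 i, hb]

theorem Rep.loops_eq {T : Set ι} {Z : (Fin n → Bool) → (ι → Bool) → ℕ} {b : HalfDiagram n p} {l : ℕ}
    (h : Rep T Z (some (b, l))) : Z (fun _ => false) (fun _ => false) = 2 ^ l := by
  obtain ⟨τ, h1, h2, h3⟩ := h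
  rw [h3, wt, if_pos ⟨fun _ => rfl, fun _ _ => rfl⟩, mul_one]

/-- Labels decide whether the state vanishes, pairs of points give the arches, and the constant
colouring gives the loops. Hence identities of two-colour functions yield identities of states,
which can be evaluated at any `q`. -/
theorem Rep.unique {T : Set ι} {Z : (Fin n → Bool) → (ι → Bool) → ℕ} {s s' : State n p}
    (h : Rep T Z s) (h' : Rep T Z s') : s = s' := by
  match s, s', h, h' with
  | none, none, _, _ => rfl
  | none, some (b, l), ⟨x, _, y, _, hxy, h⟩, h' => exact absurd ((h'.label_eq_iff x y).mp h) hxy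
  | some (b, l), none, h', ⟨x, _, y, _, hxy, h⟩ => exact absurd ((h'.label_eq_iff x y).mp h) hxy
  | some (b, l), some (b', l'), h, h' =>
    have e1 : b = b' := by
      ext1
      funext i
      by_cases hb : b.partner i = i
      · by_cases hb' : b'.partner i = i
        · rw [hb, hb']
        · have := (h.partner_eq_iff (Ne.symm hb')).mp ((h'.partner_eq_iff (Ne.symm hb')).mpr rfl)
          exact this
      · have := (h'.partner_eq_iff (Ne.symm hb)).mp ((h.partner_eq_iff (Ne.symm hb)).mpr rfl)
        exact this.symm
    have e2 : l = l' := Nat.pow_right_injective le_rfl (h.loops_eq.symm.trans h'.loops_eq)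
    rw [e1, e2]

theorem Rep.relabel {κ : Type} {T : Set ι} {T' : Set κ} {Z : (Fin n → Bool) → (ι → Bool) → ℕ} {s : State n p}
    (h : Rep T Z s) (σ : ι → κ) (h1 : Set.InjOn σ T) (h2 : Set.MapsTo σ T T') :
    Rep T' (fun c t => Z c (t ∘ σ)) s := by
  match s, h with
  | none, ⟨x, hx, y, hy, hxy, h⟩ =>
    exact ⟨σ x, h2 hx, σ y, h2 hy, fun h' => hxy (h1 hx hy h'), fun c t hZ => h _ _ hZ⟩
  | some (b, l), ⟨τ, h3, h4, h5⟩ =>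
    exact ⟨σ ∘ τ, h1.comp h3 h4, h2.comp h4, fun c t => h5 c (t ∘ σ)⟩

theorem Rep.mul {T : Set ι} {Z : (Fin n → Bool) → (ι → Bool) → ℕ} {s : State n p} (h : Rep T Z s)
    (m : ℕ) : Rep T (fun c t => 2 ^ m * Z c t) (s.addLoops m) := by
  match s, h with
  | none, ⟨x, hx, y, hy, hxy, h⟩ =>
    exact ⟨x, hx, y, hy, hxy, fun c t hZ => h c t (right_ne_zero_of_mul hZ)⟩
  | some (b, l), ⟨τ, h3, h4, h5⟩ =>
    exact ⟨τ, h3, h4, fun c t => by simp only [h5]; rw [pow_add, mul_assoc]⟩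

theorem rep_wt (b : HalfDiagram n p) :
    Rep {i | b.partner i = i} (fun c t => wt b id c t) (some (b, 0)) :=
  ⟨id, Set.injOn_id _, Set.mapsTo_id _, fun c t => by simp⟩

end TemperleyLieb

end

noncomputable section

namespace TemperleyLieb

open HalfDiagram

variable {n p : ℕ}

/-! ### The Temperley-Lieb relations -/

theorem capOp_capOp_self (u v : Fin n) (f : (Fin n → Bool) → ℕ) (c : Fin n → Bool) :
    capOp u v (capOp u v f) c = 2 ^ 1 * capOp u v f c := by
  have h1 : ∀ x y, recolor u v (recolor u v c x) y = recolor u v c y := by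
    intro x y; funext j; unfold recolor; split_ifs <;> rfl
  have h2 : ∀ x, recolor u v c x u = x ∧ recolor u v c x v = x := by
    intro x; simp [recolor]
  by_cases hc : c u = c v
  · simp only [capOp, if_pos hc, h1, (h2 _).1, (h2 _).2, if_true, Finset.sum_const]
    simp
  · simp [capOp, if_neg hc]

theorem capOp_comm (u v : Fin n) (f : (Fin n → Bool) → ℕ) : capOp u v f = capOp v u f := by
  funext c
  have h : ∀ x, recolor u v c x = recolor v u c x := by
    intro x; funext j; simp [recolor, or_comm]
  unfold capOp
  simp only [h, eq_comm]

/-- Two colours are summed, but the middle cap equates the first with `c w` and the last cap equates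
the second with the first, so only the outer sum remains. -/
theorem capOp_braid {u v w : Fin n} (huv : u ≠ v) (huw : u ≠ w) (hvw : v ≠ w)
    (f : (Fin n → Bool) → ℕ) (c : Fin n → Bool) :
    capOp u v (capOp v w (capOp u v f)) c = capOp u v f c := by
  have h1 : ∀ x z, recolor u v (recolor v w (recolor u v c x) (c w)) z = recolor u v c z := by
    intro x z; funext j; unfold recolor; grind
  have h2 : ∀ x, recolor u v c x v = x ∧ recolor u v c x w = c w := by
    intro x; simp [recolor, huw.symm, hvw.symm]
  have h3 : ∀ x y, recolor v w (recolor u v c x) y u = x ∧ recolor v w (recolor u v c x) y v = y := by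
    intro x y; simp [recolor, huv, huw]
  by_cases hc : c u = c v
  · simp only [capOp, if_pos hc, (h2 _).1, (h2 _).2, (h3 _ _).1, (h3 _ _).2]
    rw [Finset.sum_ite_eq' Finset.univ (c w), if_pos (Finset.mem_univ _), Finset.sum_ite_eq,
      if_pos (Finset.mem_univ _)]
    simp only [h1]
  · simp [capOp, if_neg hc]

theorem capOp_commute {u v w x : Fin n} (h1 : u ≠ w) (h2 : u ≠ x) (h3 : v ≠ w) (h4 : v ≠ x)
    (f : (Fin n → Bool) → ℕ) (c : Fin n → Bool) :
    capOp u v (capOp w x f) c = capOp w x (capOp u v f) c := by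
  have e1 : ∀ y z, recolor w x (recolor u v c y) z = recolor u v (recolor w x c z) y := by
    intro y z; funext j; unfold recolor; grind
  have e2 : ∀ y, recolor u v c y w = c w ∧ recolor u v c y x = c x := by
    intro y; simp [recolor, h1.symm, h2.symm, h3.symm, h4.symm]
  have e3 : ∀ y, recolor w x c y u = c u ∧ recolor w x c y v = c v := by
    intro y; simp [recolor, h1, h2, h3, h4]
  simp only [capOp, (e2 _).1, (e2 _).2, (e3 _).1, (e3 _).2, e1]
  by_cases hc : c u = c v <;> by_cases hc' : c w = c x
  · simp only [if_pos hc, if_pos hc']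
    rw [Finset.sum_comm]
  all_goals simp [hc, hc']

/-! ### The generators as operators on `U(n; p)` -/

/-- The vector described by a state: every closed loop contributes a factor `q`. -/
def State.vec (q : ℝ) : State n p → U n p
  | none => 0
  | some (b, l) => (q : ℂ) ^ l • Pi.single b 1

theorem State.vec_addLoops (q : ℝ) (s : State n p) (m : ℕ) :
    (s.addLoops m).vec q = (q : ℂ) ^ m • s.vec q := by
  match s with
  | none => simp [State.addLoops, State.vec]
  | some (b, l) => simp [State.addLoops, State.vec, pow_add, smul_smul]

/-- The action of the generator on `U(n; p)`. -/
def E (q : ℝ) (i : ℕ) (hi : i + 1 < n) : U n p →ₗ[ℂ] U n p :=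
  Fintype.linearCombination ℂ fun a => (capState ⟨i, Nat.lt_of_succ_lt hi⟩ ⟨i + 1, hi⟩ rfl a).vec q

theorem E_single (q : ℝ) (i : ℕ) (hi : i + 1 < n) (a : HalfDiagram n p) :
    E q i hi (Pi.single a 1) = (capState ⟨i, Nat.lt_of_succ_lt hi⟩ ⟨i + 1, hi⟩ rfl a).vec q := by
  simp [E, Fintype.linearCombination_apply_single]

/-- The result of joining the points `i` and `i + 1`. -/
def State.cap (i : ℕ) (hi : i + 1 < n) (s : State n p) : State n p :=
  s.bind fun r => (capState ⟨i, Nat.lt_of_succ_lt hi⟩ ⟨i + 1, hi⟩ rfl r.1).addLoops r.2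

theorem E_vec (q : ℝ) (i : ℕ) (hi : i + 1 < n) (s : State n p) :
    E q i hi (s.vec q) = (s.cap i hi).vec q := by
  match s with
  | none => simp [State.vec, State.cap]
  | some (b, l) =>
    simp only [State.cap, Option.bind_some, State.vec_addLoops]
    simp only [State.vec, map_smul, E_single]

theorem single_eq_vec (q : ℝ) (a : HalfDiagram n p) :
    (Pi.single a 1 : U n p) = State.vec q (some (a, 0)) := by
  simp [State.vec]

theorem U_hom_ext {M : Type*} [AddCommMonoid M] [Module ℂ M] {f g : U n p →ₗ[ℂ] M}
    (h : ∀ a, f (Pi.single a 1) = g (Pi.single a 1)) : f = g := by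
  refine LinearMap.pi_ext' fun a => ?_
  refine LinearMap.ext_ring ?_
  simpa using h a

/-- The factor 2 of the two-colour identity is one closed loop by `Rep.unique`, and a loop evaluates
to `q`. -/
theorem E_E_self (q : ℝ) (i : ℕ) (hi : i + 1 < n) (x : U n p) :
    E q i hi (E q i hi x) = (q : ℂ) • E q i hi x := by
  suffices h : E q i hi ∘ₗ E q i hi = (q : ℂ) • (E q i hi : U n p →ₗ[ℂ] U n p) from
    LinearMap.congr_fun h x
  refine U_hom_ext fun a => ?_
  have h0 := rep_wt a
  have h1 := h0.cap (u := ⟨i, Nat.lt_of_succ_lt hi⟩) (v := ⟨i + 1, hi⟩) rfl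
  have h2 := h1.cap (u := ⟨i, Nat.lt_of_succ_lt hi⟩) (v := ⟨i + 1, hi⟩) rfl
  have h3 := h1.mul 1
  have h4 := h2.unique (by simpa only [capOp_capOp_self] using h3)
  simp only [LinearMap.comp_apply, LinearMap.smul_apply, single_eq_vec q, E_vec]
  rw [← pow_one (q : ℂ), ← State.vec_addLoops]
  exact congrArg (State.vec q) h4

theorem E_braid (q : ℝ) (i j : ℕ) (hi : i + 1 < n) (hj : j + 1 < n) (hij : j = i + 1 ∨ i = j + 1)
    (x : U n p) : E q i hi (E q j hj (E q i hi x)) = E q i hi x := by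
  suffices h : E q i hi ∘ₗ E q j hj ∘ₗ E q i hi = (E q i hi : U n p →ₗ[ℂ] U n p) from
    LinearMap.congr_fun h x
  refine U_hom_ext fun a => ?_
  have h0 := rep_wt a
  have h1 := h0.cap (u := ⟨i, Nat.lt_of_succ_lt hi⟩) (v := ⟨i + 1, hi⟩) rfl
  have h2 := h1.cap (u := ⟨j, Nat.lt_of_succ_lt hj⟩) (v := ⟨j + 1, hj⟩) rfl
  have h3 := h2.cap (u := ⟨i, Nat.lt_of_succ_lt hi⟩) (v := ⟨i + 1, hi⟩) rfl
  have h4 : ∀ (f : (Fin n → Bool) → ℕ) c, capOp ⟨i, Nat.lt_of_succ_lt hi⟩ ⟨i + 1, hi⟩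
      (capOp ⟨j, Nat.lt_of_succ_lt hj⟩ ⟨j + 1, hj⟩ (capOp ⟨i, Nat.lt_of_succ_lt hi⟩ ⟨i + 1, hi⟩ f)) c =
      capOp ⟨i, Nat.lt_of_succ_lt hi⟩ ⟨i + 1, hi⟩ f c := by
    intro f c
    rcases hij with rfl | rfl
    · exact capOp_braid (by simp) (by simp; omega) (by simp) f c
    -- The common point `j + 1` has to be the middle one of the triple, so each pair is reversed.
    · rw [capOp_comm ⟨j + 1, _⟩ ⟨j + 1 + 1, _⟩, capOp_comm ⟨j + 1, _⟩ ⟨j + 1 + 1, _⟩,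
        capOp_comm ⟨j, _⟩ ⟨j + 1, _⟩]
      exact capOp_braid (by simp) (by simp; omega) (by simp) f c
  have h5 := h3.unique (by simpa only [h4] using h1)
  simp only [LinearMap.comp_apply, single_eq_vec q, E_vec]
  exact congrArg (State.vec q) h5

theorem E_commute (q : ℝ) (i j : ℕ) (hi : i + 1 < n) (hj : j + 1 < n) (hij : i + 1 < j ∨ j + 1 < i)
    (x : U n p) : E q i hi (E q j hj x) = E q j hj (E q i hi x) := by
  suffices h : E q i hi ∘ₗ E q j hj = E q j hj ∘ₗ (E q i hi : U n p →ₗ[ℂ] U n p) from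
    LinearMap.congr_fun h x
  refine U_hom_ext fun a => ?_
  have h0 := rep_wt a
  have h1 := (h0.cap (u := ⟨j, Nat.lt_of_succ_lt hj⟩) (v := ⟨j + 1, hj⟩) rfl).cap
    (u := ⟨i, Nat.lt_of_succ_lt hi⟩) (v := ⟨i + 1, hi⟩) rfl
  have h2 := (h0.cap (u := ⟨i, Nat.lt_of_succ_lt hi⟩) (v := ⟨i + 1, hi⟩) rfl).cap
    (u := ⟨j, Nat.lt_of_succ_lt hj⟩) (v := ⟨j + 1, hj⟩) rfl
  have h4 : ∀ (f : (Fin n → Bool) → ℕ) c, capOp ⟨i, Nat.lt_of_succ_lt hi⟩ ⟨i + 1, hi⟩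
      (capOp ⟨j, Nat.lt_of_succ_lt hj⟩ ⟨j + 1, hj⟩ f) c = capOp ⟨j, Nat.lt_of_succ_lt hj⟩ ⟨j + 1, hj⟩
      (capOp ⟨i, Nat.lt_of_succ_lt hi⟩ ⟨i + 1, hi⟩ f) c := fun f c =>
    capOp_commute (by simp; omega) (by simp; omega) (by simp; omega) (by simp; omega) f c
  have h5 := h1.unique (by simpa only [h4] using h2)
  simp only [LinearMap.comp_apply, single_eq_vec q, E_vec]
  exact congrArg (State.vec q) h5

end TemperleyLieb

end

/-! ### Caps at minima as box additions -/

noncomputable section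

namespace TemperleyLieb

open HalfDiagram

variable {n p p' : ℕ}

/-- At a minimum the strand from `i` goes left, and that from `i + 1` goes right or is a
through-string. Joining them keeps the left end opening and the right end, if any, closing. -/
theorem isBoxAddition_cap {a : HalfDiagram n p} {i : ℕ} {hi : i + 1 < n}
    (h1 : ¬ a.IsOpening ⟨i, Nat.lt_of_succ_lt hi⟩) (h2 : a.IsOpening ⟨i + 1, hi⟩)
    (h : ¬ (a.partner ⟨i, Nat.lt_of_succ_lt hi⟩ = ⟨i, Nat.lt_of_succ_lt hi⟩ ∧
      a.partner ⟨i + 1, hi⟩ = ⟨i + 1, hi⟩)) :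
    IsBoxAddition i hi a (a.cap ⟨i, Nat.lt_of_succ_lt hi⟩ ⟨i + 1, hi⟩ rfl h) := by
  set u : Fin n := ⟨i, Nat.lt_of_succ_lt hi⟩
  set v : Fin n := ⟨i + 1, hi⟩
  have huv : u < v := by simp [u, v, Fin.lt_def]
  have hop : ∀ j, (a.cap u v rfl h).IsOpening j ↔ j ≤ a.capPartner u v j := fun j => Iff.rfl
  have hu : a.capPartner u v u = v := by simp [capPartner]
  have hv : a.capPartner u v v = u := by simp [capPartner, huv.ne']
  refine ⟨h1, h2, ?_, ?_, fun j hj1 hj2 => ?_⟩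
  · rw [hop]; simp only [u, v] at hu ⊢; rw [hu]; exact huv.le
  · rw [hop]; simp only [u, v] at hv ⊢; rw [hv]; exact not_le.mpr huv
  · rw [hop]
    unfold IsOpening at *
    have hju : j ≠ u := fun h => hj1 (by rw [h])
    have hjv : j ≠ v := fun h => hj2 (by rw [h])
    have b1 := a.invol j
    have b2 := a.invol u
    have b3 := a.invol v
    have hv1 : (v : ℕ) = u + 1 := rfl
    change ¬ u ≤ a.partner u at h1
    change v ≤ a.partner v at h2
    rcases a.capPartner_cases huv.ne j with ⟨e1, e2⟩ | ⟨e1, e2⟩ | ⟨n1, n2, e1, e3, e2⟩ |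
      ⟨n1, n2, e1, e3, e2⟩ | ⟨n1, n2, e1, e3, e2⟩ | ⟨n1, n2, e1, e3, e2⟩ | ⟨n1, n2, n3, n4, e2⟩ <;>
      rw [e2] <;> clear e2 hop hu hv hj1 hj2 h <;> simp only [Fin.le_def, Fin.lt_def, Fin.ext_iff] at * <;>
      grind

theorem capState_of_isBoxAddition {a b : HalfDiagram n p} {i : ℕ} {hi : i + 1 < n}
    (h : IsBoxAddition i hi a b) :
    capState ⟨i, Nat.lt_of_succ_lt hi⟩ ⟨i + 1, hi⟩ rfl a = some (b, 0) := by
  have h1 := h.1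
  have h2 : ¬ (a.partner ⟨i, Nat.lt_of_succ_lt hi⟩ = ⟨i, Nat.lt_of_succ_lt hi⟩ ∧
      a.partner ⟨i + 1, hi⟩ = ⟨i + 1, hi⟩) := fun h' => h1 h'.1.ge
  have h3 := isBoxAddition_cap h.1 h.2.1 h2
  have h4 : a.partner ⟨i, Nat.lt_of_succ_lt hi⟩ ≠ ⟨i + 1, hi⟩ := by
    intro h'
    apply h1
    unfold IsOpening
    rw [h', Fin.le_def]
    simp
  rw [capState, dif_neg h2, if_neg h4, h3.right_unique h]

theorem exists_isBoxAddition_right {a : HalfDiagram n p} {i : ℕ} {hi : i + 1 < n}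
    (h1 : ¬ a.IsOpening ⟨i, Nat.lt_of_succ_lt hi⟩) (h2 : a.IsOpening ⟨i + 1, hi⟩) :
    ∃ b, IsBoxAddition i hi a b :=
  ⟨_, isBoxAddition_cap h1 h2 fun h' => h1 h'.1.ge⟩

/-! ### Pairings: transposition, the two halves and tensor products -/

namespace Pairing

theorem partner_ne (P : Pairing n) (x : Fin (n + n)) : P.partner x ≠ x := by
  intro hx
  have h := P.card_through
  have h2 : 0 < (Finset.univ.filter fun i => P.partner i = i).card :=
    Finset.card_pos.mpr ⟨x, by simpa using hx⟩
  omega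

theorem transpose_transpose (P : Pairing n) : P.transpose.transpose = P := by
  ext i
  simp [transpose]

theorem isOpening_transpose (P : Pairing n) (x : Fin (n + n)) :
    P.transpose.IsOpening x ↔ ¬ P.IsOpening x.rev := by
  have h := P.partner_ne x.rev
  have h2 : P.transpose.IsOpening x ↔ x ≤ (P.partner x.rev).rev := Iff.rfl
  rw [h2, Fin.le_rev_iff]
  unfold IsOpening
  grind

/-- Read backwards, opening and closing brackets are exchanged; the last `k` points of `P` contain
`k - n + P.cl (n + n - k)` opening ones. -/
theorem cl_transpose (P : Pairing n) {k : ℕ} (hk : k ≤ n + n) :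
    P.transpose.cl k + n = k + P.cl (n + n - k) := by
  induction k with
  | zero => simp [P.cl_self]
  | succ k ih =>
    have h1 := ih (by omega)
    have h2 := P.isOpening_transpose ⟨k, hk⟩
    have h3 : n + n - k = n + n - (k + 1) + 1 := by omega
    have h4 : (⟨k, hk⟩ : Fin (n + n)).rev = ⟨n + n - (k + 1), by omega⟩ := rfl
    rw [h4] at h2
    by_cases ho : P.IsOpening ⟨n + n - (k + 1), by omega⟩
    · have e1 := P.cl_succ_of_isOpening ho
      have e2 := P.transpose.cl_succ_of_not_isOpening (i := ⟨k, hk⟩) (by rw [h2]; simpa using ho)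
      simp only at e1 e2
      rw [h3] at h1
      omega
    · have e1 := P.cl_succ_of_not_isOpening ho
      have e2 := P.transpose.cl_succ_of_isOpening (i := ⟨k, hk⟩) (by rw [h2]; exact ho)
      simp only at e1 e2
      rw [h3] at h1
      omega

theorem height_transpose (P : Pairing n) {k : ℕ} (hk : k ≤ n + n) :
    P.transpose.height k = P.height (n + n - k) := by
  have h := P.cl_transpose hk
  rw [P.transpose.height_eq hk, P.height_eq (by omega)]
  omega

/-- The left half of a pairing; the through-strings are the points joined to right points. -/
def leftPartner (P : Pairing n) (i : Fin n) : Fin n :=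
  if h : (P.partner (Fin.castAdd n i) : ℕ) < n then ⟨P.partner (Fin.castAdd n i), h⟩ else i

theorem leftPartner_eq_iff (P : Pairing n) {i j : Fin n} (hij : i ≠ j) :
    P.leftPartner i = j ↔ P.partner (Fin.castAdd n i) = Fin.castAdd n j := by
  unfold leftPartner
  split_ifs with h
  · simp [Fin.ext_iff]
  · constructor
    · intro h'; exact absurd h' hij
    · intro h'; rw [h'] at h; simp at h

theorem leftPartner_self_iff (P : Pairing n) (i : Fin n) :
    P.leftPartner i = i ↔ n ≤ P.partner (Fin.castAdd n i) := by
  unfold leftPartner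
  split_ifs with h
  · have := P.partner_ne (Fin.castAdd n i)
    rw [ne_eq, Fin.ext_iff] at this
    rw [Fin.ext_iff]
    simp only [Fin.val_castAdd] at this ⊢
    simp [this, h]
  · simpa using h

theorem leftPartner_cases (P : Pairing n) (i : Fin n) :
    (P.leftPartner i = i ∧ n ≤ (P.partner (Fin.castAdd n i) : ℕ)) ∨
      (P.leftPartner i ≠ i ∧ P.partner (Fin.castAdd n i) = Fin.castAdd n (P.leftPartner i)) := by
  by_cases h : P.leftPartner i = i
  · exact Or.inl ⟨h, (P.leftPartner_self_iff i).mp h⟩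
  · exact Or.inr ⟨h, (P.leftPartner_eq_iff (Ne.symm h)).mp rfl⟩

theorem leftPartner_invol (P : Pairing n) (i : Fin n) : P.leftPartner (P.leftPartner i) = i := by
  rcases P.leftPartner_cases i with ⟨h1, _⟩ | ⟨h1, h2⟩
  · rw [h1, h1]
  · rw [P.leftPartner_eq_iff h1, ← h2, P.invol]

/-- A bracket closing among the first `n` points has its partner there as well, so the left half has
`P.cl n` arches. -/
theorem card_leftPartner (P : Pairing n) :
    (Finset.univ.filter fun i => P.leftPartner i = i).card + 2 * P.cl n = n := by
  have hc : (Finset.univ.filter fun i => P.leftPartner i < i).card = P.cl n := by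
    refine Finset.card_bij (fun i _ => Fin.castAdd n i) ?_ ?_ ?_
    · intro i hi
      simp only [Finset.mem_filter, Finset.mem_univ, true_and] at hi
      refine Finset.mem_filter.mpr ⟨Finset.mem_univ _, i.isLt, ?_⟩
      rcases P.leftPartner_cases i with ⟨h1, _⟩ | ⟨h1, h2⟩
      · exact absurd h1 hi.ne
      · unfold IsOpening
        rw [h2, not_le]
        exact hi
    · intro i _ j _ h
      exact Fin.castAdd_injective n n h
    · intro x hx
      obtain ⟨h1, h2⟩ := (Finset.mem_filter.mp hx).2
      refine ⟨⟨x, h1⟩, ?_, rfl⟩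
      simp only [Finset.mem_filter, Finset.mem_univ, true_and]
      have h3 := partner_lt_of_not_isOpening h2
      rcases P.leftPartner_cases ⟨x, h1⟩ with ⟨h4, h5⟩ | ⟨h4, h5⟩
      · have : Fin.castAdd n ⟨x, h1⟩ = x := rfl
        rw [this] at h5
        rw [Fin.lt_def] at h3
        omega
      · have : Fin.castAdd n ⟨x, h1⟩ = x := rfl
        rw [this] at h5
        rw [h5] at h3
        exact h3
  have hd : (Finset.univ.filter fun i => i < P.leftPartner i).card =
      (Finset.univ.filter fun i => P.leftPartner i < i).card := by
    refine Finset.card_bij (fun i _ => P.leftPartner i) ?_ ?_ ?_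
    · intro i hi
      simp only [Finset.mem_filter, Finset.mem_univ, true_and] at hi ⊢
      rwa [P.leftPartner_invol]
    · intro i _ j _ h
      rw [← P.leftPartner_invol i, h, P.leftPartner_invol]
    · intro i hi
      refine ⟨P.leftPartner i, ?_, P.leftPartner_invol i⟩
      simp only [Finset.mem_filter, Finset.mem_univ, true_and] at hi ⊢
      rwa [P.leftPartner_invol]
  have h3 := Finset.card_filter_add_card_filter_not (s := (Finset.univ : Finset (Fin n)))
    (fun j => P.leftPartner j = j)
  have h4 := Finset.card_filter_add_card_filter_not
    (s := Finset.univ.filter fun j : Fin n => ¬ P.leftPartner j = j) (fun j => P.leftPartner j < j)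
  rw [Finset.filter_filter, Finset.filter_filter] at h4
  have h5 : (Finset.univ.filter fun j : Fin n => ¬ P.leftPartner j = j ∧ P.leftPartner j < j) =
      Finset.univ.filter fun j : Fin n => P.leftPartner j < j := by
    ext j; simp only [Finset.mem_filter, Finset.mem_univ, true_and]; grind
  have h6 : (Finset.univ.filter fun j : Fin n => ¬ P.leftPartner j = j ∧ ¬ P.leftPartner j < j) =
      Finset.univ.filter fun j : Fin n => j < P.leftPartner j := by
    ext j; simp only [Finset.mem_filter, Finset.mem_univ, true_and]; grind
  rw [h5, h6] at h4
  simp only [Finset.card_univ, Fintype.card_fin] at h3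
  omega

/-- The left half of a pairing. -/
def left (P : Pairing n) (hp : P.cl n = p) : HalfDiagram n p where
  partner := P.leftPartner
  invol := P.leftPartner_invol
  noncrossing i k hik hk := by
    rcases P.leftPartner_cases i with ⟨h1, _⟩ | ⟨h1, h2⟩
    · rw [h1] at hk
      exact absurd (hik.trans hk) (lt_irrefl _)
    · have h3 := P.inner (i := Fin.castAdd n i) (k := Fin.castAdd n k) hik (by rw [h2]; exact hk)
      rcases P.leftPartner_cases k with ⟨h4, h5⟩ | ⟨h4, h5⟩
      · rw [h2] at h3
        have := h3.2.1
        rw [Fin.lt_def] at this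
        simp only [Fin.val_castAdd] at this
        omega
      · rw [h2, h5] at h3
        exact ⟨h4, h3.2.1.le.not_gt⟩
  card_through := by rw [← hp]; exact P.card_leftPartner

theorem isTensor_left (P : Pairing n) (hp : P.cl n = p) (hp' : P.transpose.cl n = p) :
    IsTensor (left P hp) (left P.transpose hp') P := by
  intro i j hij
  refine ⟨(P.leftPartner_eq_iff hij).symm, ?_⟩
  refine Iff.trans ?_ (leftPartner_eq_iff (P.transpose : Pairing n) hij).symm
  change _ ↔ (P.partner _).rev = _
  rw [Fin.rev_eq_iff]

theorem cl_transpose_self (P : Pairing n) : P.transpose.cl n = P.cl n := by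
  have := P.cl_transpose (k := n) (by omega)
  rw [Nat.add_sub_cancel] at this
  omega

theorem exists_isTensor (P : Pairing n) :
    ∃ t : (p : Fin (n / 2 + 1)) × (HalfDiagram n p × HalfDiagram n p), IsTensor t.2.1 t.2.2 P := by
  have h := P.two_mul_cl_le (show n ≤ n + n by omega)
  exact ⟨⟨⟨P.cl n, by omega⟩, left P rfl, left P.transpose P.cl_transpose_self⟩,
    isTensor_left P rfl P.cl_transpose_self⟩

theorem fin_cases_rev (x : Fin (n + n)) :
    (∃ i : Fin n, x = Fin.castAdd n i) ∨ ∃ i : Fin n, x = (Fin.castAdd n i).rev := by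
  rcases Nat.lt_or_ge x n with h | h
  · exact Or.inl ⟨⟨x, h⟩, rfl⟩
  · refine Or.inr ⟨⟨n + n - 1 - x, by omega⟩, ?_⟩
    rw [Fin.ext_iff, Fin.val_rev]
    simp only [Fin.val_castAdd]
    omega

theorem castAdd_lt_rev (i j : Fin n) : Fin.castAdd n i < (Fin.castAdd n j).rev := by
  rw [Fin.lt_def, Fin.val_rev]
  simp only [Fin.val_castAdd]
  omega

namespace IsTensor

variable {a : HalfDiagram n p} {b : HalfDiagram n p} {P : Pairing n}

/-- A strand to the right half opens on the left, just as the through-string that replaces it does.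
-/
theorem isOpening_left (h : IsTensor a b P) (i : Fin n) :
    P.IsOpening (Fin.castAdd n i) ↔ a.IsOpening i := by
  unfold IsOpening
  have h0 := P.partner_ne (Fin.castAdd n i)
  rcases fin_cases_rev (P.partner (Fin.castAdd n i)) with ⟨j, hj⟩ | ⟨j, hj⟩
  · have hij : i ≠ j := by rintro rfl; exact h0 hj
    rw [(h i j hij).1.mp hj, hj]
    rfl
  · have hai : a.partner i = i := by
      by_contra hne
      have := (h i _ (Ne.symm hne)).1.mpr rfl
      rw [hj] at this
      exact (castAdd_lt_rev _ _).ne' this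
    rw [hai, hj]
    simp [(castAdd_lt_rev i j).le]

theorem isOpening_right (h : IsTensor a b P) (i : Fin n) :
    P.IsOpening (Fin.castAdd n i).rev ↔ ¬ b.IsOpening i := by
  unfold IsOpening
  have h0 := P.partner_ne (Fin.castAdd n i).rev
  rcases fin_cases_rev (P.partner (Fin.castAdd n i).rev) with ⟨j, hj⟩ | ⟨j, hj⟩
  · have hbi : b.partner i = i := by
      by_contra hne
      have := (h i _ (Ne.symm hne)).2.mpr rfl
      rw [hj] at this
      exact (castAdd_lt_rev _ _).ne this
    rw [hbi, hj]
    simp [castAdd_lt_rev j i]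
  · have hij : i ≠ j := by rintro rfl; exact h0 hj
    rw [(h i j hij).2.mp hj, hj, Fin.rev_le_rev, Fin.le_def, Fin.le_def]
    rw [ne_eq, Fin.ext_iff] at hij
    simp only [Fin.val_castAdd]
    omega

theorem transpose (h : IsTensor a b P) : IsTensor b a P.transpose := by
  intro i j hij
  obtain ⟨h1, h2⟩ := h i j hij
  change ((P.partner _).rev = _ ↔ _) ∧ ((P.partner _).rev = _ ↔ _)
  rw [Fin.rev_eq_iff, Fin.rev_eq_iff, Fin.rev_rev, Fin.rev_rev]
  exact ⟨h2, h1⟩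

theorem unique {P' : Pairing n} (h : IsTensor a b P) (h' : IsTensor a b P') : P = P' := by
  refine ext_of_isOpening fun x => ?_
  rcases fin_cases_rev x with ⟨i, rfl⟩ | ⟨i, rfl⟩
  · rw [h.isOpening_left, h'.isOpening_left]
  · rw [h.isOpening_right, h'.isOpening_right]

theorem cl_eq (h : IsTensor a b P) {k : ℕ} (hk : k ≤ n) : P.cl k = a.cl k := by
  induction k with
  | zero => simp
  | succ k ih =>
    have e := h.isOpening_left ⟨k, hk⟩
    have h1 := ih (by omega)
    by_cases ho : a.IsOpening ⟨k, hk⟩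
    · have e1 := a.cl_succ_of_isOpening ho
      have e2 := P.cl_succ_of_isOpening (e.mpr ho)
      simp only [Fin.val_castAdd] at e1 e2
      omega
    · have e1 := a.cl_succ_of_not_isOpening ho
      have e2 := P.cl_succ_of_not_isOpening ((not_congr e).mpr ho)
      simp only [Fin.val_castAdd] at e1 e2
      omega

theorem height_eq (h : IsTensor a b P) {k : ℕ} (hk : k ≤ n) : P.height k = a.height k := by
  rw [P.height_eq (by omega), a.height_eq hk, h.cl_eq hk]

theorem height_eq_right (h : IsTensor a b P) {k : ℕ} (hk : k ≤ n) :
    P.height (n + n - k) = b.height k := by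
  rw [← P.height_transpose (by omega), h.transpose.height_eq hk]

theorem isBoxAddition_left {a' : HalfDiagram n p} {P' : Pairing n} {i : ℕ} {hi : i + 1 < n}
    (h : IsTensor a b P) (h' : IsTensor a' b P') (hb : IsBoxAddition i hi a a') :
    IsBoxAddition i (by omega) P P' := by
  refine ⟨?_, ?_, ?_, ?_, fun j hj1 hj2 => ?_⟩
  · exact (not_congr (h.isOpening_left _)).mpr hb.1
  · exact (h.isOpening_left _).mpr hb.2.1
  · exact (h'.isOpening_left _).mpr hb.2.2.1
  · exact (not_congr (h'.isOpening_left _)).mpr hb.2.2.2.1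
  · rcases fin_cases_rev j with ⟨k, rfl⟩ | ⟨k, rfl⟩
    · rw [h.isOpening_left, h'.isOpening_left]
      exact hb.2.2.2.2 k hj1 hj2
    · rw [h.isOpening_right, h'.isOpening_right]

/-- Points `i` and `i + 1` of `b` sit at `2n - 1 - i` and `2n - 2 - i`, whence the index. Reversing
the order and exchanging bracket directions turns a minimum into a minimum. -/
theorem isBoxAddition_right {b' : HalfDiagram n p} {P' : Pairing n} {i : ℕ} {hi : i + 1 < n}
    (h : IsTensor a b P) (h' : IsTensor a b' P') (hb : IsBoxAddition i hi b b') :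
    IsBoxAddition (n + n - 2 - i) (by omega) P P' := by
  have e1 : (⟨n + n - 2 - i, by omega⟩ : Fin (n + n)) = (Fin.castAdd n ⟨i + 1, hi⟩).rev := by
    rw [Fin.ext_iff, Fin.val_rev]; simp only [Fin.val_castAdd]; omega
  have e2 : (⟨n + n - 2 - i + 1, by omega⟩ : Fin (n + n)) =
      (Fin.castAdd n ⟨i, Nat.lt_of_succ_lt hi⟩).rev := by
    rw [Fin.ext_iff, Fin.val_rev]; simp only [Fin.val_castAdd]; omega
  refine ⟨?_, ?_, ?_, ?_, fun j hj1 hj2 => ?_⟩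
  · rw [e1, h.isOpening_right, not_not]; exact hb.2.1
  · rw [e2, h.isOpening_right]; exact hb.1
  · rw [e1, h'.isOpening_right]; exact hb.2.2.2.1
  · rw [e2, h'.isOpening_right, not_not]; exact hb.2.2.1
  · rcases fin_cases_rev j with ⟨k, rfl⟩ | ⟨k, rfl⟩
    · rw [h.isOpening_left, h'.isOpening_left]
    · rw [h.isOpening_right, h'.isOpening_right, not_iff_not]
      rw [Fin.val_rev] at hj1 hj2
      simp only [Fin.val_castAdd] at hj1 hj2
      exact hb.2.2.2.2 k (by omega) (by omega)

end IsTensor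

theorem isTensor_of_isOpening {a b : HalfDiagram n p} {P : Pairing n}
    (h1 : ∀ i, P.IsOpening (Fin.castAdd n i) ↔ a.IsOpening i)
    (h2 : ∀ i, P.IsOpening (Fin.castAdd n i).rev ↔ ¬ b.IsOpening i) : IsTensor a b P := by
  obtain ⟨⟨r, a', b'⟩, h⟩ := exists_isTensor P
  have ha : a.partner = a'.partner := partner_eq_of_isOpening_iff fun i => by
    rw [← h1, h.isOpening_left]
  have hb : b.partner = b'.partner := partner_eq_of_isOpening_iff fun i => by
    rw [← not_iff_not, ← h2, h.isOpening_right]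
  intro i j hij
  rw [ha, hb]
  exact h i j hij

theorem IsTensor.ext_iff {a b : HalfDiagram n p} {a' b' : HalfDiagram n p'} {P : Pairing n}
    (h : IsTensor a b P) (h' : IsTensor a' b' P) : a.partner = a'.partner ∧ b.partner = b'.partner :=
  ⟨partner_eq_of_isOpening_iff fun i => by rw [← h.isOpening_left, h'.isOpening_left],
    partner_eq_of_isOpening_iff fun i => by
      rw [← not_iff_not, ← h.isOpening_right, h'.isOpening_right]⟩

theorem existsUnique_sigma (P : Pairing n) :
    ∃! t : (p : Fin (n / 2 + 1)) × (HalfDiagram n p × HalfDiagram n p), IsTensor t.2.1 t.2.2 P := by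
  obtain ⟨t, ht⟩ := exists_isTensor P
  refine ⟨t, ht, fun t' ht' => ?_⟩
  obtain ⟨p, a, b⟩ := t
  obtain ⟨p', a', b'⟩ := t'
  obtain ⟨h1, h2⟩ := ht'.ext_iff ht
  obtain rfl : p' = p := Fin.ext (arches_eq h1)
  obtain rfl : a' = a := HalfDiagram.ext h1
  obtain rfl : b' = b := HalfDiagram.ext h2
  rfl

/-! ### Existence of tensor products and generation of all pairings by caps -/

/-- The pairing `a ⊗ a` for the minimal half-diagram `a`. -/
def minTensor (n p : ℕ) (h : 2 * p ≤ n) : Pairing n where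
  partner x := ⟨if (x : ℕ) < 2 * p ∨ n + n ≤ x + 2 * p then
      (if (x : ℕ) % 2 = 0 then x + 1 else x - 1) else n + n - 1 - x, by
    have := x.isLt
    split_ifs <;> omega⟩
  invol x := by
    have := x.isLt
    rw [Fin.ext_iff]
    dsimp only
    split_ifs <;> omega
  noncrossing x y := by
    have := x.isLt
    have := y.isLt
    simp only [Fin.lt_def, ne_eq, Fin.ext_iff]
    intro h1 h2
    split_ifs at h2 ⊢ <;> omega
  card_through := by
    rw [Finset.filter_eq_empty_iff.mpr, Finset.card_empty]
    · omega
    · intro x _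
      have := x.isLt
      rw [Fin.ext_iff]
      dsimp only
      split_ifs <;> omega

theorem isTensor_minTensor (h : 2 * p ≤ n) :
    IsTensor (minimal n p h) (minimal n p h) (minTensor n p h) := by
  refine isTensor_of_isOpening (fun i => ?_) (fun i => ?_)
  · rw [(isMinimal_minimal h).isOpening_iff]
    simp only [IsOpening, minTensor, Fin.le_def, Fin.val_castAdd]
    have := i.isLt
    split_ifs <;> omega
  · rw [(isMinimal_minimal h).isOpening_iff]
    simp only [IsOpening, minTensor, Fin.le_def, Fin.val_castAdd, Fin.val_rev]
    have := i.isLt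
    split_ifs <;> omega

/-- Start from the explicit tensor of the minimal diagrams; a box on either half is a box on the
pairing, which a cap at the minimum provides. -/
theorem exists_isTensor_pair (a b : HalfDiagram n p) : ∃ P, IsTensor a b P := by
  induction a using box_induction with
  | hmin a ha =>
    induction b using box_induction with
    | hmin b hb =>
      rw [ha.eq (isMinimal_minimal b.two_mul_arches_le), hb.eq (isMinimal_minimal b.two_mul_arches_le)]
      exact ⟨_, isTensor_minTensor _⟩
    | hbox i hi b b' hbb' ih =>
      obtain ⟨P, hP⟩ := ih
      have e1 : (⟨n + n - 2 - i, by omega⟩ : Fin (n + n)) = (Fin.castAdd n ⟨i + 1, hi⟩).rev := by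
        rw [Fin.ext_iff, Fin.val_rev]; simp only [Fin.val_castAdd]; omega
      have e2 : (⟨n + n - 2 - i + 1, by omega⟩ : Fin (n + n)) =
          (Fin.castAdd n ⟨i, Nat.lt_of_succ_lt hi⟩).rev := by
        rw [Fin.ext_iff, Fin.val_rev]; simp only [Fin.val_castAdd]; omega
      obtain ⟨P', hP'⟩ := exists_isBoxAddition_right (a := P) (i := n + n - 2 - i) (hi := by omega)
        (by rw [e1, hP.isOpening_right, not_not]; exact hbb'.2.1)
        (by rw [e2, hP.isOpening_right]; exact hbb'.1)
      refine ⟨P', isTensor_of_isOpening (fun k => ?_) (fun k => ?_)⟩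
      · rw [← hP.isOpening_left]
        exact hP'.2.2.2.2 _ (by simp only [Fin.val_castAdd]; omega) (by simp only [Fin.val_castAdd]; omega)
      · by_cases h1 : (k : ℕ) = i
        · obtain rfl : k = ⟨i, Nat.lt_of_succ_lt hi⟩ := Fin.ext h1
          rw [← e2]
          simp only [hP'.2.2.2.1, hbb'.2.2.1, not_true]
        · by_cases h2 : (k : ℕ) = i + 1
          · obtain rfl : k = ⟨i + 1, hi⟩ := Fin.ext h2
            rw [← e1]
            simp only [hP'.2.2.1, hbb'.2.2.2.1, not_false_iff]
          · rw [hbb'.2.2.2.2 k h1 h2, ← hP.isOpening_right]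
            exact hP'.2.2.2.2 _ (by rw [Fin.val_rev]; simp only [Fin.val_castAdd]; omega)
              (by rw [Fin.val_rev]; simp only [Fin.val_castAdd]; omega)
  | hbox i hi a a' haa' ih =>
    obtain ⟨P, hP⟩ := ih
    obtain ⟨P', hP'⟩ := exists_isBoxAddition_right (a := P) (i := i) (hi := by omega)
      ((not_congr (hP.isOpening_left ⟨i, Nat.lt_of_succ_lt hi⟩)).mpr haa'.1)
      ((hP.isOpening_left ⟨i + 1, hi⟩).mpr haa'.2.1)
    refine ⟨P', isTensor_of_isOpening (fun k => ?_) (fun k => ?_)⟩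
    · by_cases h1 : (k : ℕ) = i
      · obtain rfl : k = ⟨i, Nat.lt_of_succ_lt hi⟩ := Fin.ext h1
        exact iff_of_true hP'.2.2.1 haa'.2.2.1
      · by_cases h2 : (k : ℕ) = i + 1
        · obtain rfl : k = ⟨i + 1, hi⟩ := Fin.ext h2
          exact iff_of_false hP'.2.2.2.1 haa'.2.2.2.1
        · rw [haa'.2.2.2.2 k h1 h2, ← hP.isOpening_left]
          exact hP'.2.2.2.2 _ h1 h2
    · rw [← hP.isOpening_right]
      exact hP'.2.2.2.2 _ (by rw [Fin.val_rev]; simp only [Fin.val_castAdd]; omega)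
        (by rw [Fin.val_rev]; simp only [Fin.val_castAdd]; omega)

theorem minTensor_zero : minTensor n 0 (by omega) = one n := by
  ext x
  have := x.isLt
  simp only [minTensor, one, Fin.val_rev]
  split_ifs <;> omega

/-- The left points `2 p` and `2 p + 1` still carry straight strands, so capping them also joins the
two opposite right points. -/
theorem capState_minTensor (h : 2 * (p + 1) ≤ n) :
    capState ⟨2 * p, by omega⟩ ⟨2 * p + 1, by omega⟩ rfl (minTensor n p (by omega)) =
      some (minTensor n (p + 1) h, 0) := by
  have h1 : ¬ ((minTensor n p (by omega)).partner ⟨2 * p, by omega⟩ = ⟨2 * p, by omega⟩ ∧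
      (minTensor n p (by omega)).partner ⟨2 * p + 1, by omega⟩ = ⟨2 * p + 1, by omega⟩) :=
    fun h => partner_ne _ _ h.1
  have h2 : (minTensor n p (by omega)).partner ⟨2 * p, by omega⟩ ≠ ⟨2 * p + 1, by omega⟩ := by
    rw [ne_eq, Fin.ext_iff]
    simp only [minTensor]
    split_ifs <;> omega
  rw [capState, dif_neg h1, if_neg h2, Option.some_inj, Prod.mk.injEq]
  refine ⟨?_, rfl⟩
  ext x
  have := x.isLt
  change ((minTensor n p _).capPartner _ _ x : ℕ) = _
  unfold capPartner
  simp only [minTensor, Fin.ext_iff, apply_ite Fin.val]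
  split_ifs <;> omega

/-- Every pairing is obtained from the diagram of the unit by joining adjacent points of the left
side or of the right side. -/
theorem induction {motive : Pairing n → Prop} (hone : motive (one n))
    (hleft : ∀ i (hi : i + 1 < n) P P' l, capState ⟨i, by omega⟩ ⟨i + 1, by omega⟩ rfl P = some (P', l) →
      motive P → motive P')
    (hright : ∀ i (hi : i + 1 < n) P P' l, capState ⟨n + n - 2 - i, by omega⟩
      ⟨n + n - 2 - i + 1, by omega⟩ rfl P = some (P', l) → motive P → motive P')
    (P : Pairing n) : motive P := by
  have hmin : ∀ p (h : 2 * p ≤ n), motive (minTensor n p h) := by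
    intro p
    induction p with
    | zero => intro h; rw [minTensor_zero]; exact hone
    | succ p ih => intro h; exact hleft (2 * p) (by omega) _ _ _ (capState_minTensor h) (ih (by omega))
  have key : ∀ {p : ℕ} (a b : HalfDiagram n p), ∀ P, IsTensor a b P → motive P := by
    intro p a b
    induction a using box_induction with
    | hmin a ha =>
      induction b using box_induction with
      | hmin b hb =>
        intro P hP
        rw [ha.eq (isMinimal_minimal b.two_mul_arches_le),
          hb.eq (isMinimal_minimal b.two_mul_arches_le)] at hP
        rw [hP.unique (isTensor_minTensor _)]
        exact hmin p _
      | hbox i hi b b' hbb' ih =>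
        intro P' hP'
        obtain ⟨P, hP⟩ := exists_isTensor_pair a b
        exact hright i hi P P' 0 (capState_of_isBoxAddition (hP.isBoxAddition_right hP' hbb')) (ih P hP)
    | hbox i hi a a' haa' ih =>
      intro P' hP'
      obtain ⟨P, hP⟩ := exists_isTensor_pair a b
      exact hleft i hi P P' 0 (capState_of_isBoxAddition (hP.isBoxAddition_left hP' haa')) (ih P hP)
  obtain ⟨⟨p, a, b⟩, h⟩ := exists_isTensor P
  exact key a b P h

end Pairing

end TemperleyLieb

end

noncomputable section

namespace TemperleyLieb

open HalfDiagram

variable {n p : ℕ}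

/-! ### Concatenation of diagrams in terms of colourings -/

/-- The colouring of the points of a pairing with given colours of the left and right points. -/
def glue (c d : Fin n → Bool) : Fin (n + n) → Bool := Fin.addCases c fun i => d i.rev

theorem glue_castAdd (c d : Fin n → Bool) (i : Fin n) : glue c d (Fin.castAdd n i) = c i := by
  simp [glue]

theorem rev_castAdd (i : Fin n) : (Fin.castAdd n i).rev = Fin.natAdd n i.rev := by
  rw [Fin.ext_iff, Fin.val_rev, Fin.val_natAdd, Fin.val_rev, Fin.val_castAdd]
  omega

theorem glue_rev (c d : Fin n → Bool) (i : Fin n) : glue c d (Fin.castAdd n i).rev = d i := by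
  rw [rev_castAdd, glue, Fin.addCases_right, Fin.rev_rev]

theorem comp_place {m : ℕ} (f : Fin m × Fin n → Bool) (s t : Fin m) (x : Fin (n + n)) :
    f (Pairing.place s t x) = glue (fun i => f (s, i)) (fun i => f (t, i)) x := by
  unfold Pairing.place glue
  cases x using Fin.addCases with
  | left i => rw [Fin.addCases_left, Fin.addCases_left]
  | right i => rw [Fin.addCases_right, Fin.addCases_right]

/-- The indicator function of the colourings that are constant on the strands of a pairing. -/
def pwt (P : Pairing n) (γ : Fin (n + n) → Bool) : ℕ := wt P (fun _ => ()) γ fun _ => false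

theorem pwt_ne_zero {P : Pairing n} {γ : Fin (n + n) → Bool} :
    pwt P γ ≠ 0 ↔ ∀ x, γ (P.partner x) = γ x := by
  rw [pwt, wt_ne_zero]
  exact ⟨fun h => h.1, fun h => ⟨h, fun x hx => absurd hx (Pairing.partner_ne P x)⟩⟩

theorem pwt_le_one (P : Pairing n) (γ : Fin (n + n) → Bool) : pwt P γ ≤ 1 := by
  unfold pwt wt
  split_ifs <;> omega

theorem wt_le_one {ι : Type} (b : HalfDiagram n p) (τ : Fin n → ι) (c : Fin n → Bool) (t : ι → Bool) :
    wt b τ c t ≤ 1 := by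
  unfold wt
  split_ifs <;> omega

theorem sum_eq_card_ne_zero {α : Type} [Fintype α] (f : α → ℕ) (hf : ∀ a, f a ≤ 1) :
    ∑ a, f a = Nat.card {a // f a ≠ 0} := by
  classical
  rw [Nat.card_eq_fintype_card, Fintype.card_subtype, Finset.card_filter]
  refine Finset.sum_congr rfl fun a _ => ?_
  have := hf a
  split_ifs <;> omega

/-- The number of colourings of the concatenation of `P` and `a` with given colours of the left
points and of the through-strings of `a`. -/
def actCount (P : Pairing n) (a : HalfDiagram n p) (c t : Fin n → Bool) : ℕ :=
  ∑ d, pwt P (glue c d) * wt a id d t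

theorem actCount_ne_zero {P : Pairing n} {a : HalfDiagram n p} {c t : Fin n → Bool} :
    actCount P a c t ≠ 0 ↔ ∃ d, (∀ x, glue c d (P.partner x) = glue c d x) ∧
      (∀ i, d (a.partner i) = d i) ∧ ∀ i, a.partner i = i → d i = t i := by
  rw [actCount, ne_eq, Finset.sum_eq_zero_iff]
  simp only [Finset.mem_univ, true_imp_iff, not_forall, ← ne_eq, mul_ne_zero_iff, pwt_ne_zero, wt_ne_zero]
  rfl

theorem compat_actEdge {P : Pairing n} {a : HalfDiagram n p} {f : Fin 2 × Fin n → Bool} :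
    Compat (actEdge P a) f ↔
      (∀ x, glue (fun i => f (0, i)) (fun i => f (1, i)) (P.partner x) =
        glue (fun i => f (0, i)) (fun i => f (1, i)) x) ∧
      ∀ i, f (1, a.partner i) = f (1, i) := by
  simp only [← comp_place]
  constructor
  · intro h
    exact ⟨fun x => (h _ _ (Or.inl ⟨x, rfl, rfl⟩)).symm, fun i => (h _ _ (Or.inr ⟨i, rfl, rfl⟩)).symm⟩
  · rintro ⟨h1, h2⟩ u v (⟨x, rfl, rfl⟩ | ⟨i, rfl, rfl⟩)
    · exact (h1 x).symm
    · exact (h2 i).symm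

/-- The colouring of two columns. -/
def twoCol (c d : Fin n → Bool) (v : Fin 2 × Fin n) : Bool := if v.1 = 0 then c v.2 else d v.2

theorem joined_actEdge_left (P : Pairing n) (a : HalfDiagram n p) (i j : Fin n) :
    Joined (actEdge P a) (0, i) (0, j) ↔ ∀ c t, actCount P a c t ≠ 0 → c i = c j := by
  rw [joined_iff_forall_compat]
  constructor
  · intro h c t hZ
    obtain ⟨d, h1, h2, h3⟩ := actCount_ne_zero.mp hZ
    exact h (twoCol c d) (compat_actEdge.mpr ⟨h1, h2⟩)
  · intro h f hf
    obtain ⟨h1, h2⟩ := compat_actEdge.mp hf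
    exact h _ (fun i => f (1, i)) (actCount_ne_zero.mpr ⟨_, h1, h2, fun _ _ => rfl⟩)

theorem joined_actEdge_right (P : Pairing n) (a : HalfDiagram n p) {i j : Fin n}
    (hi : a.partner i = i) (hj : a.partner j = j) :
    Joined (actEdge P a) (1, i) (1, j) ↔ ∀ c t, actCount P a c t ≠ 0 → t i = t j := by
  rw [joined_iff_forall_compat]
  constructor
  · intro h c t hZ
    obtain ⟨d, h1, h2, h3⟩ := actCount_ne_zero.mp hZ
    rw [← h3 i hi, ← h3 j hj]
    exact h (twoCol c d) (compat_actEdge.mpr ⟨h1, h2⟩)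
  · intro h f hf
    obtain ⟨h1, h2⟩ := compat_actEdge.mp hf
    exact h _ (fun i => f (1, i)) (actCount_ne_zero.mpr ⟨_, h1, h2, fun _ _ => rfl⟩)

/-- Fixing the colour of all ends leaves one free colour for every closed loop. -/
theorem actCount_false (P : Pairing n) (a : HalfDiagram n p) :
    actCount P a (fun _ => false) (fun _ => false) =
      2 ^ loops (actEdge P a) {v | v.1 = 0 ∨ a.IsThrough v.2} := by
  rw [← card_compat_eq (actEdge P a) _ (fun _ => false) (fun _ _ _ => rfl), actCount,
    sum_eq_card_ne_zero _ fun d => Nat.mul_le_mul (pwt_le_one _ _) (wt_le_one _ _ _ _)]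
  refine Nat.card_congr
    { toFun := fun d => ⟨twoCol (fun _ => false) d.1, ?_⟩
      invFun := fun f => ⟨fun i => f.1 (1, i), ?_⟩
      left_inv := fun d => rfl
      right_inv := fun f => ?_ }
  · obtain ⟨d, hd⟩ := d
    rw [mul_ne_zero_iff, pwt_ne_zero, wt_ne_zero] at hd
    refine ⟨compat_actEdge.mpr ⟨hd.1, hd.2.1⟩, ?_⟩
    rintro ⟨k, i⟩ hv
    fin_cases k
    · rfl
    · rcases hv with hv | hv
      · simp at hv
      · exact hd.2.2 i hv
  · obtain ⟨f, hf, hE⟩ := f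
    obtain ⟨h1, h2⟩ := compat_actEdge.mp hf
    have h0 : (fun i => f (0, i)) = fun _ => false := funext fun i => hE (0, i) (Or.inl rfl)
    rw [h0] at h1
    rw [mul_ne_zero_iff, pwt_ne_zero, wt_ne_zero]
    exact ⟨h1, h2, fun i hi => hE (1, i) (Or.inr hi)⟩
  · obtain ⟨f, hf, hE⟩ := f
    refine Subtype.ext (funext ?_)
    rintro ⟨k, i⟩
    fin_cases k
    · exact (hE (0, i) (Or.inl rfl)).symm
    · rfl

theorem eq_of_partner_iff {b b' : HalfDiagram n p}
    (h : ∀ i j, i ≠ j → (b.partner i = j ↔ b'.partner i = j)) : b = b' := by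
  ext1
  funext i
  by_cases hb : b.partner i = i
  · by_cases hb' : b'.partner i = i
    · rw [hb, hb']
    · exact (h i _ (Ne.symm hb')).mpr rfl
  · exact ((h i _ (Ne.symm hb)).mp rfl).symm

/-- The bridge from connected components to states: vanishing, resulting arches and loops are all
read off `actCount`. -/
theorem actCoeff_eq_vec (q : ℝ) {P : Pairing n} {a : HalfDiagram n p} {s : State n p}
    (h : Rep {i | a.partner i = i} (actCount P a) s) (b : HalfDiagram n p) :
    actCoeff q P a b = s.vec q b := by
  match s, h with
  | none, ⟨x, hx, y, hy, hxy, h⟩ =>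
    rw [actCoeff, if_neg]
    · rfl
    · rintro ⟨h1, -⟩
      exact h1 ⟨x, y, hxy, hx, hy, (joined_actEdge_right P a hx hy).mpr h⟩
  | some (b', l), h =>
    have h1 : ¬ ActVanishes P a := by
      rintro ⟨i, j, hij, hi, hj, hJ⟩
      exact hij ((h.label_eq_iff i j).mp ((joined_actEdge_right P a hi hj).mp hJ))
    have h2 : IsActResult P a b ↔ b = b' := by
      unfold IsActResult
      constructor
      · intro h2
        refine eq_of_partner_iff fun i j hij => ?_
        rw [h2 i j hij, joined_actEdge_left, h.partner_eq_iff hij]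
      · rintro rfl i j hij
        rw [joined_actEdge_left, h.partner_eq_iff hij]
    have h3 : loops (actEdge P a) {v | v.1 = 0 ∨ a.IsThrough v.2} = l :=
      Nat.pow_right_injective le_rfl ((actCount_false P a).symm.trans h.loops_eq)
    rw [actCoeff, h3]
    simp only [h1, h2, not_false_iff, true_and, State.vec, Pi.smul_apply, Pi.single_apply, smul_eq_mul,
      mul_ite, mul_one, mul_zero]

/-- The number of colourings of the concatenation of `P` and `Q` with given colours of the ends. -/
def mulCount (P Q : Pairing n) (γ : Fin (n + n) → Bool) : ℕ :=
  ∑ d, pwt P (glue (fun i => γ (Fin.castAdd n i)) d) * pwt Q (glue d fun i => γ (Fin.castAdd n i).rev)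

theorem mulCount_ne_zero {P Q : Pairing n} {γ : Fin (n + n) → Bool} :
    mulCount P Q γ ≠ 0 ↔ ∃ d,
      (∀ x, glue (fun i => γ (Fin.castAdd n i)) d (P.partner x) =
        glue (fun i => γ (Fin.castAdd n i)) d x) ∧
      ∀ x, glue d (fun i => γ (Fin.castAdd n i).rev) (Q.partner x) =
        glue d (fun i => γ (Fin.castAdd n i).rev) x := by
  rw [mulCount, ne_eq, Finset.sum_eq_zero_iff]
  simp only [Finset.mem_univ, true_imp_iff, not_forall, ← ne_eq, mul_ne_zero_iff, pwt_ne_zero]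

theorem compat_mulEdge {P Q : Pairing n} {f : Fin 3 × Fin n → Bool} :
    Compat (mulEdge P Q) f ↔
      (∀ x, glue (fun i => f (0, i)) (fun i => f (1, i)) (P.partner x) =
        glue (fun i => f (0, i)) (fun i => f (1, i)) x) ∧
      ∀ x, glue (fun i => f (1, i)) (fun i => f (2, i)) (Q.partner x) =
        glue (fun i => f (1, i)) (fun i => f (2, i)) x := by
  simp only [← comp_place]
  constructor
  · intro h
    exact ⟨fun x => (h _ _ (Or.inl ⟨x, rfl, rfl⟩)).symm, fun x => (h _ _ (Or.inr ⟨x, rfl, rfl⟩)).symm⟩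
  · rintro ⟨h1, h2⟩ u v (⟨x, rfl, rfl⟩ | ⟨x, rfl, rfl⟩)
    · exact (h1 x).symm
    · exact (h2 x).symm

/-- The colouring of three columns. -/
def threeCol (c d e : Fin n → Bool) (v : Fin 3 × Fin n) : Bool :=
  if v.1 = 0 then c v.2 else if v.1 = 1 then d v.2 else e v.2

theorem glue_left_right (γ : Fin (n + n) → Bool) :
    glue (fun i => γ (Fin.castAdd n i)) (fun i => γ (Fin.castAdd n i).rev) = γ := by
  funext x
  rcases Pairing.fin_cases_rev x with ⟨i, rfl⟩ | ⟨i, rfl⟩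
  · rw [glue_castAdd]
  · rw [glue_rev]

theorem joined_mulEdge (P Q : Pairing n) (x y : Fin (n + n)) :
    Joined (mulEdge P Q) (Pairing.place 0 2 x) (Pairing.place 0 2 y) ↔
      ∀ γ, mulCount P Q γ ≠ 0 → γ x = γ y := by
  rw [joined_iff_forall_compat]
  simp only [comp_place]
  constructor
  · intro h γ hZ
    obtain ⟨d, h1, h2⟩ := mulCount_ne_zero.mp hZ
    have := h (threeCol (fun i => γ (Fin.castAdd n i)) d fun i => γ (Fin.castAdd n i).rev)
      (compat_mulEdge.mpr ⟨h1, h2⟩)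
    have e : ∀ z, glue (fun i => γ (Fin.castAdd n i)) (fun i => γ (Fin.castAdd n i).rev) z = γ z :=
      fun z => congrFun (glue_left_right γ) z
    rw [← e x, ← e y]
    exact this
  · intro h f hf
    obtain ⟨h1, h2⟩ := compat_mulEdge.mp hf
    refine h _ (mulCount_ne_zero.mpr ⟨fun i => f (1, i), ?_⟩)
    simp only [glue_castAdd, glue_rev]
    exact ⟨h1, h2⟩

theorem mulCount_false (P Q : Pairing n) :
    mulCount P Q (fun _ => false) = 2 ^ loops (mulEdge P Q) (Set.range (Pairing.place 0 2)) := by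
  rw [← card_compat_eq (mulEdge P Q) _ (fun _ => false) (fun _ _ _ => rfl), mulCount,
    sum_eq_card_ne_zero _ fun d => Nat.mul_le_mul (pwt_le_one _ _) (pwt_le_one _ _)]
  have hE0 : ∀ i : Fin n, ((0, i) : Fin 3 × Fin n) ∈ Set.range (Pairing.place (n := n) 0 2) :=
    fun i => ⟨Fin.castAdd n i, by simp [Pairing.place]⟩
  have hE2 : ∀ i : Fin n, ((2, i) : Fin 3 × Fin n) ∈ Set.range (Pairing.place (n := n) 0 2) :=
    fun i => ⟨(Fin.castAdd n i).rev, by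
      rw [rev_castAdd, Pairing.place, Fin.addCases_right, Fin.rev_rev]⟩
  refine Nat.card_congr
    { toFun := fun d => ⟨threeCol (fun _ => false) d.1 (fun _ => false), ?_⟩
      invFun := fun f => ⟨fun i => f.1 (1, i), ?_⟩
      left_inv := fun d => rfl
      right_inv := fun f => ?_ }
  · obtain ⟨d, hd⟩ := d
    rw [mul_ne_zero_iff, pwt_ne_zero, pwt_ne_zero] at hd
    refine ⟨compat_mulEdge.mpr ⟨hd.1, hd.2⟩, ?_⟩
    rintro _ ⟨x, rfl⟩
    rw [comp_place (threeCol _ d _)]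
    rcases Pairing.fin_cases_rev x with ⟨i, rfl⟩ | ⟨i, rfl⟩
    · rw [glue_castAdd]; rfl
    · rw [glue_rev]; rfl
  · obtain ⟨f, hf, hE⟩ := f
    obtain ⟨h1, h2⟩ := compat_mulEdge.mp hf
    have h0 : (fun i => f (0, i)) = fun _ => false := funext fun i => hE (0, i) (hE0 i)
    have h3 : (fun i => f (2, i)) = fun _ => false := funext fun i => hE (2, i) (hE2 i)
    rw [h0] at h1
    rw [h3] at h2
    rw [mul_ne_zero_iff, pwt_ne_zero, pwt_ne_zero]
    exact ⟨h1, h2⟩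
  · obtain ⟨f, hf, hE⟩ := f
    refine Subtype.ext (funext ?_)
    rintro ⟨k, i⟩
    fin_cases k
    · exact (hE (0, i) (hE0 i)).symm
    · rfl
    · exact (hE (2, i) (hE2 i)).symm

theorem mulCoeff_eq_vec (q : ℝ) {P Q : Pairing n} {s : State (n + n) n}
    (h : Rep (∅ : Set Unit) (fun γ _ => mulCount P Q γ) s) (R : Pairing n) :
    mulCoeff q P Q R = s.vec q R := by
  match s, h with
  | none, ⟨x, hx, _⟩ => exact absurd hx (Set.notMem_empty _)
  | some (R', l), h =>
    have hj : ∀ x y : Fin (n + n), x ≠ y → (Joined (mulEdge P Q) (Pairing.place 0 2 x)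
        (Pairing.place 0 2 y) ↔ R'.partner x = y) := by
      intro x y hxy
      rw [joined_mulEdge, ← h.partner_eq_iff hxy]
      exact ⟨fun h γ _ => h γ, fun h γ => h γ fun _ => false⟩
    have h2 : IsMulResult P Q R ↔ R = R' := by
      unfold IsMulResult
      constructor
      · intro h2
        refine eq_of_partner_iff fun i j hij => ?_
        rw [h2 i j hij, hj i j hij]
      · rintro rfl i j hij
        rw [hj i j hij]
    have h3 : loops (mulEdge P Q) (Set.range (Pairing.place 0 2)) = l :=
      Nat.pow_right_injective le_rfl ((mulCount_false P Q).symm.trans h.loops_eq)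
    rw [mulCoeff, h3]
    simp only [h2, State.vec, Pi.smul_apply, Pi.single_apply, smul_eq_mul, mul_ite, mul_one, mul_zero]

end TemperleyLieb

end

/-! ### How caps change a concatenation, and why concatenations are diagrams -/

noncomputable section

namespace TemperleyLieb

open HalfDiagram

variable {n p : ℕ} {ι : Type}

theorem capOp_glue_left (i j : Fin n) (f : (Fin (n + n) → Bool) → ℕ) (c d : Fin n → Bool) :
    capOp (Fin.castAdd n i) (Fin.castAdd n j) f (glue c d) = capOp i j (fun c => f (glue c d)) c := by
  have h : ∀ x, recolor (Fin.castAdd n i) (Fin.castAdd n j) (glue c d) x = glue (recolor i j c x) d := by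
    intro x
    funext y
    rcases Pairing.fin_cases_rev y with ⟨k, rfl⟩ | ⟨k, rfl⟩
    · simp only [recolor, glue_castAdd, Fin.castAdd_inj]
    · have h1 := (Pairing.castAdd_lt_rev i k).ne'
      have h2 := (Pairing.castAdd_lt_rev j k).ne'
      simp only [recolor, glue_rev, h1, h2, or_self, if_false]
  unfold capOp
  simp only [glue_castAdd, h]

theorem capOp_glue_right (i j : Fin n) (f : (Fin (n + n) → Bool) → ℕ) (c d : Fin n → Bool) :
    capOp (Fin.castAdd n i).rev (Fin.castAdd n j).rev f (glue c d) =
      capOp i j (fun d => f (glue c d)) d := by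
  have h : ∀ x, recolor (Fin.castAdd n i).rev (Fin.castAdd n j).rev (glue c d) x =
      glue c (recolor i j d x) := by
    intro x
    funext y
    rcases Pairing.fin_cases_rev y with ⟨k, rfl⟩ | ⟨k, rfl⟩
    · have h1 := (Pairing.castAdd_lt_rev k i).ne
      have h2 := (Pairing.castAdd_lt_rev k j).ne
      simp only [recolor, glue_castAdd, h1, h2, or_self, if_false]
    · simp only [recolor, glue_rev, Fin.rev_inj, Fin.castAdd_inj]
  unfold capOp
  simp only [glue_rev, h]

theorem sum_recolor {u v : Fin n} (f : (Fin n → Bool) → ℕ) (c : Fin n → Bool) :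
    ∑ x : Bool, f (recolor u v c x) =
      ∑ d, if d u = d v ∧ ∀ j, j ≠ u → j ≠ v → d j = c j then f d else 0 := by
  rw [← Finset.sum_filter]
  refine Finset.sum_bij' (fun x _ => recolor u v c x) (fun d _ => d u) ?_ ?_ ?_ ?_ ?_
  · intro x _
    simp only [Finset.mem_filter, Finset.mem_univ, true_and]
    exact ⟨by simp [recolor], fun j h1 h2 => by simp [recolor, h1, h2]⟩
  · simp
  · intro x _
    simp [recolor]
  · intro d hd
    simp only [Finset.mem_filter, Finset.mem_univ, true_and] at hd
    funext j
    unfold recolor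
    have := hd.2 j
    grind
  · simp

/-- The kernel of `capOp` at `(c, d)` is the condition that `c` and `d` are each constant on `u, v`
and agree elsewhere, which is symmetric. This moves caps across a gluing and makes the generators
self-adjoint. -/
theorem sum_capOp_mul (u v : Fin n) (f g : (Fin n → Bool) → ℕ) :
    ∑ c, capOp u v f c * g c = ∑ c, f c * capOp u v g c := by
  unfold capOp
  simp only [sum_recolor]
  have h1 : ∀ c, (if c u = c v then ∑ d, if d u = d v ∧ ∀ j, j ≠ u → j ≠ v → d j = c j then f d else 0
      else 0) * g c = ∑ d, if c u = c v ∧ d u = d v ∧ ∀ j, j ≠ u → j ≠ v → d j = c j then f d * g c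
      else 0 := by
    intro c
    by_cases hc : c u = c v
    · simp only [hc, if_true, true_and, Finset.sum_mul, ite_mul, zero_mul]
    · simp [hc]
  have h2 : ∀ c, f c * (if c u = c v then ∑ d, if d u = d v ∧ ∀ j, j ≠ u → j ≠ v → d j = c j then g d else 0
      else 0) = ∑ d, if c u = c v ∧ d u = d v ∧ ∀ j, j ≠ u → j ≠ v → d j = c j then f c * g d
      else 0 := by
    intro c
    by_cases hc : c u = c v
    · simp only [hc, if_true, true_and, Finset.mul_sum, mul_ite, mul_zero]
    · simp [hc]
  simp only [h1, h2]
  rw [Finset.sum_comm]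
  refine Finset.sum_congr rfl fun c _ => Finset.sum_congr rfl fun d _ => if_congr ?_ rfl rfl
  constructor
  · rintro ⟨a, b, c⟩; exact ⟨b, a, fun j h1 h2 => (c j h1 h2).symm⟩
  · rintro ⟨a, b, c⟩; exact ⟨b, a, fun j h1 h2 => (c j h1 h2).symm⟩

theorem sum_capOp {α : Type} [Fintype α] (u v : Fin n) (f : α → (Fin n → Bool) → ℕ) (g : α → ℕ)
    (c : Fin n → Bool) : ∑ x, capOp u v (f x) c * g x = capOp u v (fun c => ∑ x, f x c * g x) c := by
  unfold capOp
  split_ifs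
  · rw [Finset.sum_comm]
    simp only [Finset.sum_mul]
  · simp

theorem capOp_pwt {P P' : Pairing n} {l : ℕ} {u v : Fin (n + n)} {hv : (v : ℕ) = u + 1}
    (h : capState u v hv P = some (P', l)) (γ : Fin (n + n) → Bool) :
    capOp u v (pwt P) γ = 2 ^ l * pwt P' γ := by
  have h1 : ¬ (P.partner u = u ∧ P.partner v = v) := fun h => Pairing.partner_ne _ _ h.1
  rw [capState, dif_neg h1, Option.some_inj, Prod.mk.injEq] at h
  obtain ⟨rfl, rfl⟩ := h
  exact capOp_wt P _ hv h1 γ _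

theorem Pairing.exists_capState (P : Pairing n) {u v : Fin (n + n)} (hv : (v : ℕ) = u + 1) :
    ∃ P' l, capState u v hv P = some (P', l) := by
  have h1 : ¬ (P.partner u = u ∧ P.partner v = v) := fun h => Pairing.partner_ne _ _ h.1
  exact ⟨_, _, by rw [capState, dif_neg h1]⟩

/-- A cap yields the function of the new pairing only up to a power of 2. Its value at the constant
colouring shows that the state has at least that many loops, and they can be removed. -/
theorem Rep.div {T : Set ι} {Z : (Fin n → Bool) → (ι → Bool) → ℕ} {s : State n p} {m : ℕ}
    (h : Rep T (fun c t => 2 ^ m * Z c t) s) (h0 : Z (fun _ => false) (fun _ => false) ≠ 0) :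
    ∃ s' : State n p, Rep T Z s' := by
  match s, h with
  | none, ⟨x, hx, y, hy, hxy, h⟩ =>
    exact ⟨none, x, hx, y, hy, hxy, fun c t hZ => h c t (mul_ne_zero (by positivity) hZ)⟩
  | some (b, l), h =>
    have h1 := h.loops_eq
    obtain ⟨τ, h3, h4, h5⟩ := h
    have hml : m ≤ l := by
      refine (Nat.pow_le_pow_iff_right one_lt_two).mp ?_
      rw [← h1]
      exact Nat.le_mul_of_pos_right _ (Nat.pos_of_ne_zero h0)
    refine ⟨some (b, l - m), τ, h3, h4, fun c t => ?_⟩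
    have := h5 c t
    simp only at this
    rw [show 2 ^ l = 2 ^ m * 2 ^ (l - m) by rw [← pow_add, Nat.add_sub_cancel' hml], mul_assoc] at this
    exact Nat.eq_of_mul_eq_mul_left (by positivity) this

theorem actCount_left {P P' : Pairing n} {l i : ℕ} {hi : i + 1 < n} (a : HalfDiagram n p)
    (h : capState ⟨i, by omega⟩ ⟨i + 1, by omega⟩ rfl P = some (P', l)) (c t : Fin n → Bool) :
    2 ^ l * actCount P' a c t =
      capOp ⟨i, Nat.lt_of_succ_lt hi⟩ ⟨i + 1, hi⟩ (fun c => actCount P a c t) c := by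
  unfold actCount
  rw [← sum_capOp _ _ (fun d c => pwt P (glue c d)) (fun d => wt a id d t), Finset.mul_sum]
  refine Finset.sum_congr rfl fun d _ => ?_
  rw [← mul_assoc, ← capOp_pwt h, ← capOp_glue_left]
  rfl

theorem capOp_pwt_right {P P' : Pairing n} {l i : ℕ} {hi : i + 1 < n}
    (h : capState ⟨n + n - 2 - i, by omega⟩ ⟨n + n - 2 - i + 1, by omega⟩ rfl P = some (P', l))
    (c d : Fin n → Bool) : 2 ^ l * pwt P' (glue c d) =
      capOp ⟨i, Nat.lt_of_succ_lt hi⟩ ⟨i + 1, hi⟩ (fun d => pwt P (glue c d)) d := by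
  have e1 : (⟨n + n - 2 - i, by omega⟩ : Fin (n + n)) = (Fin.castAdd n ⟨i + 1, hi⟩).rev := by
    rw [Fin.ext_iff, Fin.val_rev]; simp only [Fin.val_castAdd]; omega
  have e2 : (⟨n + n - 2 - i + 1, by omega⟩ : Fin (n + n)) =
      (Fin.castAdd n ⟨i, Nat.lt_of_succ_lt hi⟩).rev := by
    rw [Fin.ext_iff, Fin.val_rev]; simp only [Fin.val_castAdd]; omega
  rw [capOp_comm, ← capOp_glue_right, ← capOp_pwt h]
  rw [e1, e2]

/-- A cap on the glued side of `P` can be carried out on the half-diagram instead. -/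
theorem actCount_right {P P' : Pairing n} {l i : ℕ} {hi : i + 1 < n} (a : HalfDiagram n p)
    (h : capState ⟨n + n - 2 - i, by omega⟩ ⟨n + n - 2 - i + 1, by omega⟩ rfl P = some (P', l))
    (c t : Fin n → Bool) :
    2 ^ l * actCount P' a c t = ∑ d, pwt P (glue c d) *
      capOp ⟨i, Nat.lt_of_succ_lt hi⟩ ⟨i + 1, hi⟩ (fun d => wt a id d t) d := by
  unfold actCount
  rw [← sum_capOp_mul, Finset.mul_sum]
  refine Finset.sum_congr rfl fun d _ => ?_
  rw [← mul_assoc, capOp_pwt_right (hi := hi) h]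

theorem pwt_one (c d : Fin n → Bool) : pwt (Pairing.one n) (glue c d) = if d = c then 1 else 0 := by
  by_cases h : d = c
  · subst h
    rw [if_pos rfl]
    refine le_antisymm (pwt_le_one _ _) (Nat.one_le_iff_ne_zero.mpr (pwt_ne_zero.mpr fun x => ?_))
    change glue d d x.rev = _
    rcases Pairing.fin_cases_rev x with ⟨i, rfl⟩ | ⟨i, rfl⟩
    · rw [glue_rev, glue_castAdd]
    · rw [Fin.rev_rev, glue_rev, glue_castAdd]
  · rw [if_neg h]
    by_contra hne
    have h1 := pwt_ne_zero.mp hne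
    refine h (funext fun i => ?_)
    have := h1 (Fin.castAdd n i)
    change glue c d (Fin.castAdd n i).rev = _ at this
    rwa [glue_rev, glue_castAdd] at this

theorem actCount_one (a : HalfDiagram n p) (c t : Fin n → Bool) :
    actCount (Pairing.one n) a c t = wt a id c t := by
  simp [actCount, pwt_one]

theorem rep_actCount_right {P P' : Pairing n} {l i : ℕ} {hi : i + 1 < n} (a : HalfDiagram n p)
    (h : capState ⟨n + n - 2 - i, by omega⟩ ⟨n + n - 2 - i + 1, by omega⟩ rfl P = some (P', l))
    {σ : HalfDiagram n p → State n p} (hσ : ∀ a, Rep {i | a.partner i = i} (actCount P a) (σ a)) :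
    Rep {i | a.partner i = i} (fun c t => 2 ^ l * actCount P' a c t)
      ((capState ⟨i, Nat.lt_of_succ_lt hi⟩ ⟨i + 1, hi⟩ rfl a).bind fun r => (σ r.1).addLoops r.2) := by
  simp only [actCount_right (hi := hi) a h]
  by_cases ha : a.partner ⟨i, Nat.lt_of_succ_lt hi⟩ = ⟨i, Nat.lt_of_succ_lt hi⟩ ∧
    a.partner ⟨i + 1, hi⟩ = ⟨i + 1, hi⟩
  · have h0 := (rep_wt a).cap (u := ⟨i, Nat.lt_of_succ_lt hi⟩) (v := ⟨i + 1, hi⟩) rfl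
    simp only [Option.bind_some, capState, dif_pos ha] at h0 ⊢
    obtain ⟨x, hx, y, hy, hxy, h1⟩ := h0
    refine ⟨x, hx, y, hy, hxy, fun c t hZ => ?_⟩
    rw [ne_eq, Finset.sum_eq_zero_iff] at hZ
    push Not at hZ
    obtain ⟨d, -, hd⟩ := hZ
    exact h1 d t (right_ne_zero_of_mul hd)
  · simp only [capState, dif_neg ha, Option.bind_some]
    have h1 := ((hσ (a.cap ⟨i, Nat.lt_of_succ_lt hi⟩ ⟨i + 1, hi⟩ rfl ha)).relabel
      (capLabel a id ⟨i, Nat.lt_of_succ_lt hi⟩ ⟨i + 1, hi⟩)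
      (capLabel_injOn a id rfl ha (Set.injOn_id _))
      (capLabel_mapsTo a id rfl ha (Set.mapsTo_id _))).mul
      (if a.partner ⟨i, Nat.lt_of_succ_lt hi⟩ = ⟨i + 1, hi⟩ then 1 else 0)
    convert h1 using 3 with c t
    unfold actCount
    rw [Finset.mul_sum]
    refine Finset.sum_congr rfl fun d _ => ?_
    rw [capOp_wt a id rfl ha]
    rw [mul_left_comm]
    rfl

theorem actCount_false_ne_zero (P : Pairing n) (a : HalfDiagram n p) :
    actCount P a (fun _ => false) (fun _ => false) ≠ 0 := by
  rw [actCount_false]; positivity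

/-- Planarity of the concatenation follows from building `P` out of the unit: left caps are caps of
the result, right caps are caps of `a` made beforehand. Quantifying over all `a` inside the
induction makes the latter possible. -/
theorem exists_rep_actCount (P : Pairing n) : ∀ a : HalfDiagram n p,
    ∃ s : State n p, Rep {i | a.partner i = i} (actCount P a) s := by
  induction P using Pairing.induction with
  | hone =>
    intro a
    refine ⟨some (a, 0), ?_⟩
    convert rep_wt a using 2 with c t
    funext t
    exact actCount_one a c t
  | hleft i hi P P' l h ih =>
    intro a
    obtain ⟨s, hs⟩ := ih a
    have h1 := hs.cap (u := ⟨i, Nat.lt_of_succ_lt hi⟩) (v := ⟨i + 1, hi⟩) rfl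
    simp only [← actCount_left (hi := hi) a h] at h1
    exact h1.div (actCount_false_ne_zero P' a)
  | hright i hi P P' l h ih =>
    intro a
    choose σ hσ using ih
    exact (rep_actCount_right (hi := hi) a h hσ).div (actCount_false_ne_zero P' a)

/-- The result of the concatenation of a pairing and a half-diagram. -/
def actState (P : Pairing n) (a : HalfDiagram n p) : State n p := (exists_rep_actCount P a).choose

theorem rep_actState (P : Pairing n) (a : HalfDiagram n p) :
    Rep {i | a.partner i = i} (actCount P a) (actState P a) := (exists_rep_actCount P a).choose_spec

/-! ### The concatenation of two pairings -/

theorem mulCount_left {P P' : Pairing n} {l i : ℕ} {hi : i + 1 < n} (Q : Pairing n)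
    (h : capState ⟨i, by omega⟩ ⟨i + 1, by omega⟩ rfl P = some (P', l)) (γ : Fin (n + n) → Bool) :
    2 ^ l * mulCount P' Q γ =
      capOp ⟨i, by omega⟩ ⟨i + 1, by omega⟩ (mulCount P Q) γ := by
  have e : γ = glue (fun i => γ (Fin.castAdd n i)) (fun i => γ (Fin.castAdd n i).rev) :=
    (glue_left_right γ).symm
  conv_rhs => rw [e]
  have e1 := capOp_glue_left ⟨i, Nat.lt_of_succ_lt hi⟩ ⟨i + 1, hi⟩ (mulCount P Q)
    (fun i => γ (Fin.castAdd n i)) (fun i => γ (Fin.castAdd n i).rev)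
  refine Eq.trans ?_ e1.symm
  unfold mulCount
  simp only [glue_castAdd, glue_rev]
  rw [← sum_capOp _ _ (fun d c => pwt P (glue c d))
    (fun d => pwt Q (glue d fun i => γ (Fin.castAdd n i).rev)), Finset.mul_sum]
  refine Finset.sum_congr rfl fun d _ => ?_
  rw [← mul_assoc, ← capOp_pwt h, ← capOp_glue_left]
  rfl

/-- The cap lies on the glued column and may be assigned to either factor, each time splitting off
its own loops. -/
theorem mulCount_right {P P' Q Q' : Pairing n} {l m i : ℕ} {hi : i + 1 < n}
    (h : capState ⟨n + n - 2 - i, by omega⟩ ⟨n + n - 2 - i + 1, by omega⟩ rfl P = some (P', l))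
    (h' : capState ⟨i, by omega⟩ ⟨i + 1, by omega⟩ rfl Q = some (Q', m))
    (γ : Fin (n + n) → Bool) :
    2 ^ l * mulCount P' Q γ = 2 ^ m * mulCount P Q' γ := by
  unfold mulCount
  rw [Finset.mul_sum, Finset.mul_sum]
  have e1 : ∀ d, 2 ^ l * (pwt P' (glue (fun i => γ (Fin.castAdd n i)) d) *
      pwt Q (glue d fun i => γ (Fin.castAdd n i).rev)) =
      capOp ⟨i, Nat.lt_of_succ_lt hi⟩ ⟨i + 1, hi⟩ (fun d => pwt P (glue (fun i => γ (Fin.castAdd n i)) d)) d *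
      pwt Q (glue d fun i => γ (Fin.castAdd n i).rev) := by
    intro d
    rw [← mul_assoc, capOp_pwt_right (hi := hi) h]
  have e2 : ∀ d, 2 ^ m * (pwt P (glue (fun i => γ (Fin.castAdd n i)) d) *
      pwt Q' (glue d fun i => γ (Fin.castAdd n i).rev)) =
      pwt P (glue (fun i => γ (Fin.castAdd n i)) d) * capOp ⟨i, Nat.lt_of_succ_lt hi⟩ ⟨i + 1, hi⟩
        (fun d => pwt Q (glue d fun i => γ (Fin.castAdd n i).rev)) d := by
    intro d
    rw [mul_left_comm, ← capOp_pwt h']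
    congr 1
    exact capOp_glue_left ⟨i, Nat.lt_of_succ_lt hi⟩ ⟨i + 1, hi⟩ (pwt Q) d _
  simp only [e1, e2]
  exact sum_capOp_mul _ _ _ (fun d => pwt Q (glue d fun i => γ (Fin.castAdd n i).rev))

theorem mulCount_one (Q : Pairing n) (γ : Fin (n + n) → Bool) :
    mulCount (Pairing.one n) Q γ = pwt Q γ := by
  simp [mulCount, pwt_one, glue_left_right]

/-- A pairing has no through-strings, so the labels, and with them the zero state, play no role: the
label set is empty. -/
theorem rep_pwt (Q : Pairing n) : Rep (∅ : Set Unit) (fun γ _ => pwt Q γ) (some (Q, 0)) := by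
  have h : ∀ i, Q.partner i ≠ i := Pairing.partner_ne Q
  refine ⟨fun _ => (), fun i hi => absurd hi (h i), fun i hi => absurd hi (h i), fun γ t => ?_⟩
  rw [pow_zero, one_mul]
  exact wt_congr ⟨fun h' => ⟨h'.1, fun i hi => absurd hi (h i)⟩,
    fun h' => ⟨h'.1, fun i hi => absurd hi (h i)⟩⟩

theorem mulCount_false_ne_zero (P Q : Pairing n) : mulCount P Q (fun _ => false) ≠ 0 := by
  rw [mulCount_false]; positivity

theorem exists_rep_mulCount (P : Pairing n) : ∀ Q : Pairing n,
    ∃ s : State (n + n) n, Rep (∅ : Set Unit) (fun γ _ => mulCount P Q γ) s := by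
  induction P using Pairing.induction with
  | hone =>
    intro Q
    refine ⟨some (Q, 0), ?_⟩
    simp only [mulCount_one]
    exact rep_pwt Q
  | hleft i hi P P' l h ih =>
    intro Q
    obtain ⟨s, hs⟩ := ih Q
    have h1 := hs.cap (u := ⟨i, by omega⟩) (v := ⟨i + 1, by omega⟩) rfl
    simp only [← mulCount_left (hi := hi) Q h] at h1
    exact h1.div (mulCount_false_ne_zero P' Q)
  | hright i hi P P' l h ih =>
    intro Q
    obtain ⟨Q', m, hQ⟩ := Q.exists_capState (u := ⟨i, by omega⟩) (v := ⟨i + 1, by omega⟩) rfl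
    obtain ⟨s, hs⟩ := ih Q'
    have h1 := hs.mul m
    simp only [← mulCount_right (hi := hi) h hQ] at h1
    exact h1.div (mulCount_false_ne_zero P' Q)

/-- The result of the concatenation of two pairings. -/
def mulState (P Q : Pairing n) : State (n + n) n := (exists_rep_mulCount P Q).choose

theorem rep_mulState (P Q : Pairing n) :
    Rep (∅ : Set Unit) (fun γ _ => mulCount P Q γ) (mulState P Q) := (exists_rep_mulCount P Q).choose_spec

end TemperleyLieb

end

noncomputable section

namespace TemperleyLieb

open HalfDiagram

variable {n p : ℕ}

/-! ### The algebra and its action -/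

/-- The action as a bilinear map. -/
def actL (q : ℝ) : U (n + n) n →ₗ[ℂ] U n p →ₗ[ℂ] U n p :=
  LinearMap.mk₂ ℂ (fun ξ v => act (TL.ofU n q ξ) v)
    (fun x y v => by
      funext b
      change ∑ P, ∑ a, (x P + y P) * v a * actCoeff q P a b =
        (∑ P, ∑ a, x P * v a * actCoeff q P a b) + ∑ P, ∑ a, y P * v a * actCoeff q P a b
      simp only [add_mul, Finset.sum_add_distrib])
    (fun c x v => by
      funext b
      change ∑ P, ∑ a, (c * x P) * v a * actCoeff q P a b = c * ∑ P, ∑ a, x P * v a * actCoeff q P a b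
      simp only [Finset.mul_sum, mul_assoc])
    (fun x v w => by
      funext b
      change ∑ P, ∑ a, x P * (v a + w a) * actCoeff q P a b =
        (∑ P, ∑ a, x P * v a * actCoeff q P a b) + ∑ P, ∑ a, x P * w a * actCoeff q P a b
      simp only [mul_add, add_mul, Finset.sum_add_distrib])
    (fun c x v => by
      funext b
      change ∑ P, ∑ a, x P * (c * v a) * actCoeff q P a b = c * ∑ P, ∑ a, x P * v a * actCoeff q P a b
      simp only [Finset.mul_sum, mul_assoc, mul_left_comm])

theorem act_ofU (q : ℝ) (ξ : U (n + n) n) (v : U n p) : act (TL.ofU n q ξ) v = actL q ξ v := rfl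

/-- The product as a bilinear map. -/
def mulL (q : ℝ) : U (n + n) n →ₗ[ℂ] U (n + n) n →ₗ[ℂ] U (n + n) n :=
  LinearMap.mk₂ ℂ (fun ξ η R => ∑ P, ∑ Q, ξ P * η Q * mulCoeff q P Q R)
    (fun x y v => by
      funext b
      simp only [Pi.add_apply, add_mul, Finset.sum_add_distrib])
    (fun c x v => by
      funext b
      simp only [Pi.smul_apply, smul_eq_mul, Finset.mul_sum, mul_assoc])
    (fun x v w => by
      funext b
      simp only [Pi.add_apply, mul_add, add_mul, Finset.sum_add_distrib])
    (fun c x v => by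
      funext b
      simp only [Pi.smul_apply, smul_eq_mul, Finset.mul_sum, mul_assoc, mul_left_comm])

theorem actL_single (q : ℝ) (P : Pairing n) (a : HalfDiagram n p) :
    actL q (Pi.single P 1) (Pi.single a 1) = (actState P a).vec q := by
  funext b
  change ∑ Q, ∑ c, (Pi.single P 1 : U (n + n) n) Q * (Pi.single a 1 : U n p) c * actCoeff q Q c b = _
  rw [Finset.sum_eq_single P (by intro Q _ hQ; simp [hQ]) (by simp),
    Finset.sum_eq_single a (by intro c _ hc; simp [hc]) (by simp),
    Pi.single_eq_same, Pi.single_eq_same, one_mul, one_mul, actCoeff_eq_vec q (rep_actState P a)]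

theorem mulL_single (q : ℝ) (P Q : Pairing n) :
    mulL q (Pi.single P 1) (Pi.single Q 1) = (mulState P Q).vec q := by
  funext b
  change ∑ R, ∑ c, (Pi.single P 1 : U (n + n) n) R * (Pi.single Q 1 : U (n + n) n) c * mulCoeff q R c b = _
  rw [Finset.sum_eq_single P (by intro Q _ hQ; simp [hQ]) (by simp),
    Finset.sum_eq_single Q (by intro c _ hc; simp [hc]) (by simp),
    Pi.single_eq_same, Pi.single_eq_same, one_mul, one_mul, mulCoeff_eq_vec q (rep_mulState P Q)]

theorem actL_single_vec (q : ℝ) (P : Pairing n) (s : State n p) :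
    actL q (Pi.single P 1) (s.vec q) =
      State.vec q (s.bind fun r => (actState P r.1).addLoops r.2) := by
  match s with
  | none => simp [State.vec]
  | some (b, l) =>
    rw [Option.bind_some, State.vec_addLoops, ← actL_single, ← map_smul]
    rfl

theorem actL_E_left (q : ℝ) (i : ℕ) (hi : i + 1 < n) (ξ : U (n + n) n) (v : U n p) :
    actL q (E q i (by omega) ξ) v = E q i hi (actL q ξ v) := by
  suffices h : actL q ∘ₗ E q i (by omega) = (actL q : U (n + n) n →ₗ[ℂ] U n p →ₗ[ℂ] U n p).compr₂ (E q i hi) from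
    LinearMap.congr_fun (LinearMap.congr_fun h ξ) v
  refine U_hom_ext fun P => U_hom_ext fun a => ?_
  obtain ⟨P', l, h⟩ := Pairing.exists_capState P (u := ⟨i, by omega⟩) (v := ⟨i + 1, by omega⟩) rfl
  have h1 := (rep_actState P a).cap (u := ⟨i, Nat.lt_of_succ_lt hi⟩) (v := ⟨i + 1, hi⟩) rfl
  simp only [← actCount_left (hi := hi) a h] at h1
  have h2 := ((rep_actState P' a).mul l).unique h1
  rw [LinearMap.comp_apply, LinearMap.compr₂_apply, E_single, h, State.vec, map_smul,
    LinearMap.smul_apply, actL_single, actL_single, E_vec, ← State.vec_addLoops, h2]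
  rfl

theorem actL_E_right (q : ℝ) (i : ℕ) (hi : i + 1 < n) (ξ : U (n + n) n) (v : U n p) :
    actL q (E q (n + n - 2 - i) (by omega) ξ) v = actL q ξ (E q i hi v) := by
  suffices h : actL q ∘ₗ E q (n + n - 2 - i) (by omega) =
      (actL q : U (n + n) n →ₗ[ℂ] U n p →ₗ[ℂ] U n p).compl₂ (E q i hi) from
    LinearMap.congr_fun (LinearMap.congr_fun h ξ) v
  refine U_hom_ext fun P => U_hom_ext fun a => ?_
  obtain ⟨P', l, h⟩ := Pairing.exists_capState P (u := ⟨n + n - 2 - i, by omega⟩)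
    (v := ⟨n + n - 2 - i + 1, by omega⟩) rfl
  have h1 := rep_actCount_right (hi := hi) a h (rep_actState P)
  have h2 := ((rep_actState P' a).mul l).unique h1
  rw [LinearMap.comp_apply, LinearMap.compl₂_apply, E_single, h, State.vec, map_smul,
    LinearMap.smul_apply, actL_single, E_single, actL_single_vec, ← State.vec_addLoops, h2]

theorem mulL_E_left (q : ℝ) (i : ℕ) (hi : i + 1 < n) (ξ η : U (n + n) n) :
    mulL q (E q i (by omega) ξ) η = E q i (by omega) (mulL q ξ η) := by
  suffices h : mulL q ∘ₗ E q i (by omega) = (mulL q : U (n + n) n →ₗ[ℂ] _).compr₂ (E q i (by omega)) from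
    LinearMap.congr_fun (LinearMap.congr_fun h ξ) η
  refine U_hom_ext fun P => U_hom_ext fun Q => ?_
  obtain ⟨P', l, h⟩ := Pairing.exists_capState P (u := ⟨i, by omega⟩) (v := ⟨i + 1, by omega⟩) rfl
  have h1 := (rep_mulState P Q).cap (u := ⟨i, by omega⟩) (v := ⟨i + 1, by omega⟩) rfl
  simp only [← mulCount_left (hi := hi) Q h] at h1
  have h2 := ((rep_mulState P' Q).mul l).unique h1
  rw [LinearMap.comp_apply, LinearMap.compr₂_apply, E_single, h, State.vec, map_smul,
    LinearMap.smul_apply, mulL_single, mulL_single, E_vec, ← State.vec_addLoops, h2]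
  rfl

theorem mulL_E_right (q : ℝ) (i : ℕ) (hi : i + 1 < n) (ξ η : U (n + n) n) :
    mulL q (E q (n + n - 2 - i) (by omega) ξ) η = mulL q ξ (E q i (by omega) η) := by
  suffices h : mulL q ∘ₗ E q (n + n - 2 - i) (by omega) =
      (mulL q : U (n + n) n →ₗ[ℂ] _).compl₂ (E q i (by omega)) from
    LinearMap.congr_fun (LinearMap.congr_fun h ξ) η
  refine U_hom_ext fun P => U_hom_ext fun Q => ?_
  obtain ⟨P', l, h⟩ := Pairing.exists_capState P (u := ⟨n + n - 2 - i, by omega⟩)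
    (v := ⟨n + n - 2 - i + 1, by omega⟩) rfl
  obtain ⟨Q', m, hQ⟩ := Pairing.exists_capState Q (u := ⟨i, by omega⟩) (v := ⟨i + 1, by omega⟩) rfl
  have h1 := (rep_mulState P Q').mul m
  simp only [← mulCount_right (hi := hi) h hQ] at h1
  have h2 := ((rep_mulState P' Q).mul l).unique h1
  rw [LinearMap.comp_apply, LinearMap.compl₂_apply, E_single, E_single, h, hQ, State.vec, State.vec,
    map_smul, map_smul, LinearMap.smul_apply, mulL_single, mulL_single, ← State.vec_addLoops,
    ← State.vec_addLoops, h2]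

theorem actL_one (q : ℝ) (v : U n p) : actL q (Pi.single (Pairing.one n) 1) v = v := by
  suffices h : actL q (Pi.single (Pairing.one n) 1) = (LinearMap.id : U n p →ₗ[ℂ] U n p) from
    LinearMap.congr_fun h v
  refine U_hom_ext fun a => ?_
  have h1 := rep_wt a
  have h2 := rep_actState (Pairing.one n) a
  have h3 : actCount (Pairing.one n) a = fun c t => wt a id c t := by
    funext c t; exact actCount_one a c t
  rw [h3] at h2
  rw [actL_single, h2.unique h1, LinearMap.id_apply, single_eq_vec q]

theorem mulL_one (q : ℝ) (v : U (n + n) n) : mulL q (Pi.single (Pairing.one n) 1) v = v := by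
  suffices h : mulL q (Pi.single (Pairing.one n) 1) = LinearMap.id from LinearMap.congr_fun h v
  refine U_hom_ext fun Q => ?_
  have h1 := rep_pwt Q
  have h2 := rep_mulState (Pairing.one n) Q
  simp only [mulCount_one] at h2
  rw [mulL_single, h2.unique h1, LinearMap.id_apply, single_eq_vec q]

/-- Induction on the left factor: its left caps pass to the outside on both sides, its right caps
move to `η`. The new pairing appears with a factor `q ^ l`, cancelled because `q ≠ 0`. -/
theorem actL_mulL {q : ℝ} (hq : q ≠ 0) (ξ η : U (n + n) n) (v : U n p) :
    actL q (mulL q ξ η) v = actL q ξ (actL q η v) := by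
  have key : ∀ P : Pairing n, ∀ (η : U (n + n) n) (v : U n p),
      actL q (mulL q (Pi.single P 1) η) v = actL q (Pi.single P 1) (actL q η v) := by
    intro P
    have hq' : ∀ l, (q : ℂ) ^ l ≠ 0 := fun l => pow_ne_zero _ (by exact_mod_cast hq)
    induction P using Pairing.induction with
    | hone => intro η v; rw [mulL_one, actL_one]
    | hleft i hi P P' l h ih =>
      intro η v
      have e : E q i (by omega) (Pi.single P 1) = (q : ℂ) ^ l • (Pi.single P' 1 : U (n + n) n) := by
        rw [E_single, h]; rfl
      refine smul_right_injective _ (hq' l) ?_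
      simp only
      rw [← LinearMap.smul_apply, ← map_smul, ← LinearMap.smul_apply, ← map_smul, ← e, mulL_E_left q i hi,
        actL_E_left q i hi, ih, ← actL_E_left q i hi, e, map_smul, LinearMap.smul_apply]
    | hright i hi P P' l h ih =>
      intro η v
      have e : E q (n + n - 2 - i) (by omega) (Pi.single P 1) =
          (q : ℂ) ^ l • (Pi.single P' 1 : U (n + n) n) := by
        rw [E_single, h]; rfl
      refine smul_right_injective _ (hq' l) ?_
      simp only
      rw [← LinearMap.smul_apply, ← map_smul, ← LinearMap.smul_apply, ← map_smul, ← e, mulL_E_right q i hi,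
        ih, actL_E_left q i hi, ← actL_E_right q i hi, e, map_smul, LinearMap.smul_apply]
  have hx : ξ = ∑ P, ξ P • (Pi.single P 1 : U (n + n) n) := by
    funext P; simp [Pi.single_apply]
  rw [hx]
  simp only [map_sum, map_smul, LinearMap.sum_apply, LinearMap.smul_apply, key]

theorem capState_one (i : ℕ) (hi : i + 1 < n) :
    capState ⟨i, by omega⟩ ⟨i + 1, by omega⟩ rfl (Pairing.one n) = some (Pairing.gen n i hi, 0) := by
  have h1 : ¬ ((Pairing.one n).partner ⟨i, by omega⟩ = ⟨i, by omega⟩ ∧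
      (Pairing.one n).partner ⟨i + 1, by omega⟩ = ⟨i + 1, by omega⟩) :=
    fun h => Pairing.partner_ne _ _ h.1
  have h2 : (Pairing.one n).partner ⟨i, by omega⟩ ≠ ⟨i + 1, by omega⟩ := by
    rw [ne_eq, Fin.ext_iff]
    simp only [Pairing.one, Fin.val_rev]
    omega
  rw [capState, dif_neg h1, if_neg h2, Option.some_inj, Prod.mk.injEq]
  refine ⟨?_, rfl⟩
  ext x
  have := x.isLt
  change ((Pairing.one n).capPartner _ _ x : ℕ) = _
  unfold capPartner
  simp only [Pairing.one, Pairing.gen, Fin.ext_iff, apply_ite Fin.val, Fin.val_rev]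
  split_ifs <;> omega

theorem act_gen (q : ℝ) (i : ℕ) (hi : i + 1 < n) (v : U n p) : act (TL.gen q i hi) v = E q i hi v := by
  have e : E q i (by omega) (Pi.single (Pairing.one n) 1) =
      (Pi.single (Pairing.gen n i hi) 1 : U (n + n) n) := by
    rw [E_single, capState_one i hi, ← single_eq_vec]
  rw [TL.gen, TL.e, act_ofU, ← e, actL_E_left q i hi, actL_one]

theorem isSecondBasis_iff {q : ℝ} {F : HalfDiagram n p → U n p} : IsSecondBasis q F ↔
    (∀ a, a.IsMinimal → F a = Pi.single a 1) ∧
      ∀ (i : ℕ) (hi : i + 1 < n) (a b : HalfDiagram n p), HalfDiagram.IsBoxAddition i hi a b →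
        F b = E q i hi (F a) - ((μ (a.height (i + 1) + 1) q : ℝ) : ℂ) • F a := by
  simp only [IsSecondBasis, act_gen]

/-! ### The form -/

/-- The number of colourings of the gluing of two half-diagrams with given colours of the
through-strings. -/
def formCount (a b : HalfDiagram n p) (t t' : Fin n → Bool) : ℕ := ∑ c, wt a id c t * wt b id c t'

theorem formCount_ne_zero {a b : HalfDiagram n p} {t t' : Fin n → Bool} :
    formCount a b t t' ≠ 0 ↔ ∃ c, CompatWith a id c t ∧ CompatWith b id c t' := by
  rw [formCount, ne_eq, Finset.sum_eq_zero_iff]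
  simp only [Finset.mem_univ, true_imp_iff, not_forall, ← ne_eq, mul_ne_zero_iff, wt_ne_zero]

theorem formCount_swap (a b : HalfDiagram n p) (t t' : Fin n → Bool) :
    formCount a b t t' = formCount b a t' t := by
  simp only [formCount, mul_comm]

theorem compat_formEdge {a b : HalfDiagram n p} {f : Fin n → Bool} :
    Compat (formEdge a b) f ↔ (∀ i, f (a.partner i) = f i) ∧ ∀ i, f (b.partner i) = f i := by
  constructor
  · intro h
    exact ⟨fun i => (h _ _ (Or.inl rfl)).symm, fun i => (h _ _ (Or.inr rfl)).symm⟩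
  · rintro ⟨h1, h2⟩ u v (rfl | rfl)
    · exact (h1 u).symm
    · exact (h2 u).symm

theorem joined_formEdge_left (a b : HalfDiagram n p) {i j : Fin n} (hi : a.partner i = i)
    (hj : a.partner j = j) :
    Joined (formEdge a b) i j ↔ ∀ t t', formCount a b t t' ≠ 0 → t i = t j := by
  rw [joined_iff_forall_compat]
  constructor
  · intro h t t' hZ
    obtain ⟨c, h1, h2⟩ := formCount_ne_zero.mp hZ
    have := h c (compat_formEdge.mpr ⟨h1.1, h2.1⟩)
    rwa [h1.2 i hi, h1.2 j hj] at this
  · intro h f hf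
    obtain ⟨h1, h2⟩ := compat_formEdge.mp hf
    exact h f f (formCount_ne_zero.mpr ⟨f, ⟨h1, fun _ _ => rfl⟩, h2, fun _ _ => rfl⟩)

theorem formEdge_swap (a b : HalfDiagram n p) : formEdge a b = formEdge b a := by
  funext i j
  exact propext or_comm

theorem joined_formEdge_right (a b : HalfDiagram n p) {i j : Fin n} (hi : b.partner i = i)
    (hj : b.partner j = j) :
    Joined (formEdge a b) i j ↔ ∀ t t', formCount a b t t' ≠ 0 → t' i = t' j := by
  rw [formEdge_swap, joined_formEdge_left b a hi hj]
  simp only [formCount_swap a b]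
  exact ⟨fun h t t' => h t' t, fun h t t' => h t' t⟩

theorem formCount_false (a b : HalfDiagram n p) : formCount a b (fun _ => false) (fun _ => false) =
    2 ^ loops (formEdge a b) {i | a.IsThrough i ∨ b.IsThrough i} := by
  rw [← card_compat_eq (formEdge a b) _ (fun _ => false) (fun _ _ _ => rfl), formCount,
    sum_eq_card_ne_zero _ fun d => Nat.mul_le_mul (wt_le_one _ _ _ _) (wt_le_one _ _ _ _)]
  refine Nat.card_congr (Equiv.subtypeEquivRight fun f => ?_)
  rw [mul_ne_zero_iff, wt_ne_zero, wt_ne_zero, compat_formEdge]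
  constructor
  · rintro ⟨h1, h2⟩
    exact ⟨⟨h1.1, h2.1⟩, fun i hi => hi.elim (h1.2 i) (h2.2 i)⟩
  · rintro ⟨h1, h2⟩
    exact ⟨⟨h1.1, fun i hi => h2 i (Or.inl hi)⟩, h1.2, fun i hi => h2 i (Or.inr hi)⟩

/-- The function `G` of the colours of two sets of labels forces two labels of the same set to have
the same colour. -/
def Forces (T T' : Set (Fin n)) (G : (Fin n → Bool) → (Fin n → Bool) → ℕ) : Prop :=
  (∃ x ∈ T, ∃ y ∈ T, x ≠ y ∧ ∀ t t', G t t' ≠ 0 → t x = t y) ∨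
    ∃ x ∈ T', ∃ y ∈ T', x ≠ y ∧ ∀ t t', G t t' ≠ 0 → t' x = t' y

/-- The number of loops described by a function of the colours of two sets of labels. -/
def FormRep (T T' : Set (Fin n)) (G : (Fin n → Bool) → (Fin n → Bool) → ℕ) : Option ℕ → Prop
  | none => Forces T T' G
  | some l => ¬ Forces T T' G ∧ G (fun _ => false) (fun _ => false) = 2 ^ l

theorem FormRep.unique {T T' : Set (Fin n)} {G : (Fin n → Bool) → (Fin n → Bool) → ℕ} {s s' : Option ℕ}
    (h : FormRep T T' G s) (h' : FormRep T T' G s') : s = s' := by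
  match s, s', h, h' with
  | none, none, _, _ => rfl
  | none, some l, h, h' => exact absurd h h'.1
  | some l, none, h, h' => exact absurd h' h.1
  | some l, some l', h, h' =>
    exact congrArg some (Nat.pow_right_injective le_rfl (h.2.symm.trans h'.2))

theorem FormRep.swap {T T' : Set (Fin n)} {G : (Fin n → Bool) → (Fin n → Bool) → ℕ} {s : Option ℕ}
    (h : FormRep T T' G s) : FormRep T' T (fun t t' => G t' t) s := by
  have hF : Forces T' T (fun t t' => G t' t) ↔ Forces T T' G := by
    unfold Forces
    rw [or_comm]
    refine or_congr ?_ ?_ <;>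
    · refine exists_congr fun x => and_congr_right fun _ => exists_congr fun y =>
        and_congr_right fun _ => and_congr_right fun _ => ?_
      exact ⟨fun h t t' => h t' t, fun h t t' => h t' t⟩
  match s, h with
  | none, h => exact hF.mpr h
  | some l, h => exact ⟨fun h' => h.1 (hF.mp h'), h.2⟩

open Classical in
/-- The value of the form on two half-diagrams. -/
def formState (a b : HalfDiagram n p) : Option ℕ :=
  if FormVanishes a b then none else some (loops (formEdge a b) {i | a.IsThrough i ∨ b.IsThrough i})

theorem forces_formCount (a b : HalfDiagram n p) :
    Forces {i | a.partner i = i} {i | b.partner i = i} (formCount a b) ↔ FormVanishes a b := by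
  constructor
  · rintro (⟨x, hx, y, hy, hxy, h⟩ | ⟨x, hx, y, hy, hxy, h⟩)
    · exact ⟨x, y, hxy, (joined_formEdge_left a b hx hy).mpr h, Or.inl ⟨hx, hy⟩⟩
    · exact ⟨x, y, hxy, (joined_formEdge_right a b hx hy).mpr h, Or.inr ⟨hx, hy⟩⟩
  · rintro ⟨x, y, hxy, h, ⟨hx, hy⟩ | ⟨hx, hy⟩⟩
    · exact Or.inl ⟨x, hx, y, hy, hxy, (joined_formEdge_left a b hx hy).mp h⟩
    · exact Or.inr ⟨x, hx, y, hy, hxy, (joined_formEdge_right a b hx hy).mp h⟩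

theorem formRep_formState (a b : HalfDiagram n p) :
    FormRep {i | a.partner i = i} {i | b.partner i = i} (formCount a b) (formState a b) := by
  unfold formState
  split_ifs with h
  · exact (forces_formCount a b).mpr h
  · exact ⟨fun h' => h ((forces_formCount a b).mp h'), formCount_false a b⟩

/-- The value of a number of loops. -/
def loopVal (q : ℝ) (s : Option ℕ) : ℂ := s.elim 0 fun l => (q : ℂ) ^ l

theorem formCoeff_eq (q : ℝ) (a b : HalfDiagram n p) : formCoeff q a b = loopVal q (formState a b) := by
  unfold formCoeff formState
  split_ifs <;> rfl

theorem formState_swap (a b : HalfDiagram n p) : formState a b = formState b a := by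
  have h := (formRep_formState b a).swap
  refine (formRep_formState a b).unique ?_
  convert h using 1
  funext t t'
  exact formCount_swap a b t t'

/-- An injective map between the through-strings before and after the cap, of which there are
equally many. -/
theorem bijOn_capLabel (a : HalfDiagram n p) {u v : Fin n} (hv : (v : ℕ) = u + 1)
    (h : ¬ (a.partner u = u ∧ a.partner v = v)) :
    Set.BijOn (capLabel a id u v) {i | (a.cap u v hv h).partner i = i} {i | a.partner i = i} := by
  have h1 := capLabel_injOn a id hv h (Set.injOn_id _)
  have h2 := capLabel_mapsTo a id hv h (Set.mapsTo_id _)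
  refine ⟨h2, h1, ?_⟩
  have h3 := a.card_capPartner hv h
  have e1 : ((Finset.univ.filter fun i => a.capPartner u v i = i : Finset (Fin n)) : Set (Fin n)) =
      {i | (a.cap u v hv h).partner i = i} := by
    ext i; simp [HalfDiagram.cap]
  have e2 : ((Finset.univ.filter fun i => a.partner i = i : Finset (Fin n)) : Set (Fin n)) =
      {i | a.partner i = i} := by
    ext i; simp
  rw [← e1, ← e2] at h2 ⊢
  rw [← e1] at h1
  exact Finset.surjOn_of_injOn_of_card_le _ h2 h1 h3.ge

/-- The gluing of `e_i a` with `b`, expressed through the through-strings of `a` itself. With the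
original labels kept, the roles of `a` and `b` can be exchanged in `formB_E`. -/
theorem formRep_cap (a b : HalfDiagram n p) {u v : Fin n} (hv : (v : ℕ) = u + 1) :
    FormRep {i | a.partner i = i} {i | b.partner i = i}
      (fun t t' => ∑ c, capOp u v (fun c => wt a id c t) c * wt b id c t')
      ((capState u v hv a).bind fun r => (formState r.1 b).map fun l => r.2 + l) := by
  by_cases ha : a.partner u = u ∧ a.partner v = v
  · have h0 := (rep_wt a).cap (u := u) (v := v) hv
    simp only [Option.bind_some, capState, dif_pos ha] at h0 ⊢
    obtain ⟨x, hx, y, hy, hxy, h1⟩ := h0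
    refine Or.inl ⟨x, hx, y, hy, hxy, fun t t' hZ => ?_⟩
    rw [ne_eq, Finset.sum_eq_zero_iff] at hZ
    push Not at hZ
    obtain ⟨d, -, hd⟩ := hZ
    exact h1 d t (left_ne_zero_of_mul hd)
  · simp only [capState, dif_neg ha, Option.bind_some]
    set a' := a.cap u v hv ha with ha'
    set τ := capLabel a id u v with hτ
    set e := if a.partner u = v then 1 else 0
    have hb : Set.BijOn τ {i | a'.partner i = i} {i | a.partner i = i} := bijOn_capLabel a hv ha
    have hG : (fun t t' => ∑ c, capOp u v (fun c => wt a id c t) c * wt b id c t') =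
        fun t t' => 2 ^ e * formCount a' b (t ∘ τ) t' := by
      funext t t'
      rw [formCount, Finset.mul_sum]
      refine Finset.sum_congr rfl fun c _ => ?_
      rw [capOp_wt a id hv ha, mul_assoc]
      rfl
    -- A colouring of the through-strings after the cap is transported to the original labels along
    -- the inverse of `τ`.
    have hext : ∀ t t' : Fin n → Bool, formCount a' b t t' ≠ 0 →
        ∃ t₁, (2 ^ e * formCount a' b (t₁ ∘ τ) t' ≠ 0) ∧ ∀ x, a'.partner x = x → t₁ (τ x) = t x := by
      intro t t' hZ
      have : Nonempty (Fin n) := ⟨u⟩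
      have hinv : ∀ x, a'.partner x = x → Function.invFunOn τ {i | a'.partner i = i} (τ x) = x :=
        fun x hx => hb.injOn.leftInvOn_invFunOn hx
      refine ⟨t ∘ Function.invFunOn τ {i | a'.partner i = i}, mul_ne_zero (by positivity) ?_, ?_⟩
      · obtain ⟨c, h1, h2⟩ := formCount_ne_zero.mp hZ
        refine formCount_ne_zero.mpr ⟨c, ⟨h1.1, fun i hi => ?_⟩, h2⟩
        rw [h1.2 i hi]
        simp only [Function.comp_apply, id_eq, hinv i hi]
      · intro x hx
        simp only [Function.comp_apply, hinv x hx]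
    have hF : Forces {i | a.partner i = i} {i | b.partner i = i}
        (fun t t' => 2 ^ e * formCount a' b (t ∘ τ) t') ↔
        Forces {i | a'.partner i = i} {i | b.partner i = i} (formCount a' b) := by
      constructor
      · rintro (⟨x, hx, y, hy, hxy, h⟩ | ⟨x, hx, y, hy, hxy, h⟩)
        · obtain ⟨x, hx', rfl⟩ := hb.surjOn hx
          obtain ⟨y, hy', rfl⟩ := hb.surjOn hy
          refine Or.inl ⟨x, hx', y, hy', fun h => hxy (by rw [h]), fun t t' hZ => ?_⟩
          obtain ⟨t₁, h1, h2⟩ := hext t t' hZ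
          rw [← h2 x hx', ← h2 y hy']
          exact h t₁ t' h1
        · refine Or.inr ⟨x, hx, y, hy, hxy, fun t t' hZ => ?_⟩
          obtain ⟨t₁, h1, h2⟩ := hext t t' hZ
          exact h t₁ t' h1
      · rintro (⟨x, hx, y, hy, hxy, h⟩ | ⟨x, hx, y, hy, hxy, h⟩)
        · exact Or.inl ⟨τ x, hb.mapsTo hx, τ y, hb.mapsTo hy, fun h' => hxy (hb.injOn hx hy h'),
            fun t t' hZ => h _ _ (right_ne_zero_of_mul hZ)⟩
        · exact Or.inr ⟨x, hx, y, hy, hxy, fun t t' hZ => h _ _ (right_ne_zero_of_mul hZ)⟩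
    rw [hG]
    have h1 := formRep_formState a' b
    cases hs : formState a' b with
    | none => rw [hs] at h1; exact hF.mpr h1
    | some l =>
      rw [hs] at h1
      refine ⟨fun h => h1.1 (hF.mp h), ?_⟩
      simp only [pow_add]
      rw [← h1.2]
      rfl

/-- The bilinear form with the same values on half-diagrams as the sesquilinear form. -/
def formB (q : ℝ) : U n p →ₗ[ℂ] U n p →ₗ[ℂ] ℂ :=
  LinearMap.mk₂ ℂ (fun ξ η => ∑ a, ∑ b, ξ a * η b * formCoeff q a b)
    (fun x y v => by simp only [Pi.add_apply, add_mul, Finset.sum_add_distrib])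
    (fun c x v => by simp only [Pi.smul_apply, smul_eq_mul, Finset.mul_sum, mul_assoc])
    (fun x v w => by simp only [Pi.add_apply, mul_add, add_mul, Finset.sum_add_distrib])
    (fun c x v => by
      simp only [Pi.smul_apply, smul_eq_mul, Finset.mul_sum, mul_assoc, mul_left_comm])

/-- The second basis has real coefficients (`star_secondBasis`), so on it the bilinear form can
replace the sesquilinear one. -/
theorem form_eq (q : ℝ) (x y : U n p) : form q x y = formB q x (star y) := rfl

theorem formB_single (q : ℝ) (a b : HalfDiagram n p) :
    formB q (Pi.single a 1) (Pi.single b 1) = loopVal q (formState a b) := by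
  change ∑ c, ∑ d, (Pi.single a 1 : U n p) c * (Pi.single b 1 : U n p) d * formCoeff q c d = _
  rw [Finset.sum_eq_single a (by intro Q _ hQ; simp [hQ]) (by simp),
    Finset.sum_eq_single b (by intro c _ hc; simp [hc]) (by simp),
    Pi.single_eq_same, Pi.single_eq_same, one_mul, one_mul, formCoeff_eq]

theorem formB_comm (q : ℝ) (x y : U n p) : formB q x y = formB q y x := by
  suffices h : formB q = (formB q : U n p →ₗ[ℂ] U n p →ₗ[ℂ] ℂ).flip from
    LinearMap.congr_fun (LinearMap.congr_fun h x) y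
  refine U_hom_ext fun a => U_hom_ext fun b => ?_
  rw [LinearMap.flip_apply, formB_single, formB_single, formState_swap]

theorem formB_E_single (q : ℝ) (i : ℕ) (hi : i + 1 < n) (a b : HalfDiagram n p) :
    formB q (E q i hi (Pi.single a 1)) (Pi.single b 1) =
      loopVal q ((capState ⟨i, Nat.lt_of_succ_lt hi⟩ ⟨i + 1, hi⟩ rfl a).bind
        fun r => (formState r.1 b).map fun l => r.2 + l) := by
  rw [E_single]
  cases capState ⟨i, Nat.lt_of_succ_lt hi⟩ ⟨i + 1, hi⟩ rfl a with
  | none => simp [State.vec, loopVal]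
  | some r =>
    obtain ⟨a', e⟩ := r
    rw [State.vec, map_smul, LinearMap.smul_apply, formB_single, Option.bind_some]
    cases formState a' b with
    | none => simp [loopVal]
    | some l => simp [loopVal, pow_add]

/-- By symmetry of `capOp`, capping `a` and capping `b` give the same function of the colours of the
through-strings, hence the same number of loops or the same vanishing. -/
theorem formB_E (q : ℝ) (i : ℕ) (hi : i + 1 < n) (x y : U n p) :
    formB q (E q i hi x) y = formB q x (E q i hi y) := by
  suffices h : formB q ∘ₗ E q i hi = (formB q : U n p →ₗ[ℂ] U n p →ₗ[ℂ] ℂ).compl₂ (E q i hi) from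
    LinearMap.congr_fun (LinearMap.congr_fun h x) y
  refine U_hom_ext fun a => U_hom_ext fun b => ?_
  rw [LinearMap.comp_apply, LinearMap.compl₂_apply, formB_comm q (Pi.single a 1), formB_E_single,
    formB_E_single]
  congr 1
  refine (formRep_cap a b rfl).unique ?_
  convert (formRep_cap b a (u := ⟨i, Nat.lt_of_succ_lt hi⟩) (v := ⟨i + 1, hi⟩) rfl).swap using 1
  funext t t'
  rw [sum_capOp_mul _ _ (fun c => wt a id c t) (fun c => wt b id c t')]
  exact Finset.sum_congr rfl fun c _ => mul_comm _ _

theorem State.star_vec (q : ℝ) (s : State n p) : star (s.vec q) = s.vec q := by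
  match s with
  | none => simp [State.vec]
  | some (b, l) =>
    funext c
    by_cases h : c = b <;> simp [State.vec, h]

theorem E_star (q : ℝ) (i : ℕ) (hi : i + 1 < n) (x : U n p) : E q i hi (star x) = star (E q i hi x) := by
  simp only [E, Fintype.linearCombination_apply, star_sum, star_smul, State.star_vec, Pi.star_apply]

end TemperleyLieb

end

noncomputable section

namespace TemperleyLieb

open HalfDiagram

variable {n p : ℕ}

/-! ### Chebyshev quotients -/

theorem Δ_add_one (k : ℤ) (q : ℝ) : Δ (k + 1) q = q * Δ k q - Δ (k - 1) q := by
  simp [Δ, Polynomial.Chebyshev.S_add_one]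

theorem μ_zero (q : ℝ) : μ 0 q = 0 := by simp [μ, Δ]

theorem q_sub_μ {k : ℤ} {q : ℝ} (h : Δ k q ≠ 0) : q - μ k q = Δ (k + 1) q / Δ k q := by
  rw [Δ_add_one, μ]
  field_simp

theorem μ_add_one (k : ℤ) (q : ℝ) : μ (k + 1) q = Δ k q / Δ (k + 1) q := by
  rw [μ, add_sub_cancel_right]

/-- The Chebyshev recursion in the form that makes the two terms of `e_i (e_j - μ_{k+1}) ξ'` cancel
on a slope. -/
theorem μ_mul {k : ℤ} {q : ℝ} (h : Δ k q ≠ 0) (h' : Δ (k + 1) q ≠ 0) :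
    μ (k + 1) q * (q - μ k q) = 1 := by
  rw [q_sub_μ h, μ_add_one]
  field_simp

theorem μ_mul_complex {k : ℤ} {q : ℝ} (h : Δ k q ≠ 0) (h' : Δ (k + 1) q ≠ 0) :
    ((μ (k + 1) q : ℝ) : ℂ) * ((q : ℂ) - (μ k q : ℝ)) = 1 := by
  exact_mod_cast μ_mul h h'

/-! ### Existence and uniqueness of the second basis -/

/-- The operator by which box addition acts on the second basis. -/
def boxOp (q : ℝ) (i : ℕ) (hi : i + 1 < n) (h : ℤ) (x : U n p) : U n p :=
  E q i hi x - ((μ (h + 1) q : ℝ) : ℂ) • x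

open Classical in
/-- The second basis. -/
def secondBasis (q : ℝ) (b : HalfDiagram n p) : U n p :=
  if h : ∃ (i : ℕ) (hi : i + 1 < n) (a : HalfDiagram n p), IsBoxAddition i hi a b then
    boxOp q h.choose h.choose_spec.choose (h.choose_spec.choose_spec.choose.height (h.choose + 1))
      (secondBasis q h.choose_spec.choose_spec.choose)
  else Pi.single b 1
termination_by b.area
decreasing_by exact h.choose_spec.choose_spec.choose_spec.area_lt

theorem secondBasis_of_isMinimal (q : ℝ) {b : HalfDiagram n p} (hb : b.IsMinimal) :
    secondBasis q b = Pi.single b 1 := by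
  rw [secondBasis, dif_neg]
  rintro ⟨i, hi, a, h⟩
  exact h.not_isMinimal hb

theorem exists_secondBasis_eq (q : ℝ) {i : ℕ} {hi : i + 1 < n} {a b : HalfDiagram n p}
    (h : IsBoxAddition i hi a b) : ∃ (j : ℕ) (hj : j + 1 < n) (a' : HalfDiagram n p),
      IsBoxAddition j hj a' b ∧
        secondBasis q b = boxOp q j hj (a'.height (j + 1)) (secondBasis q a') := by
  have h' : ∃ (i : ℕ) (hi : i + 1 < n) (a : HalfDiagram n p), IsBoxAddition i hi a b := ⟨i, hi, a, h⟩
  refine ⟨h'.choose, h'.choose_spec.choose, h'.choose_spec.choose_spec.choose,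
    h'.choose_spec.choose_spec.choose_spec, ?_⟩
  rw [secondBasis, dif_pos h']

theorem boxOp_commute (q : ℝ) {i j : ℕ} (hi : i + 1 < n) (hj : j + 1 < n)
    (hij : i + 1 < j ∨ j + 1 < i) (h k : ℤ) (x : U n p) :
    boxOp q i hi h (boxOp q j hj k x) = boxOp q j hj k (boxOp q i hi h x) := by
  simp only [boxOp, map_sub, map_smul, E_commute q i j hi hj hij, smul_sub,
    smul_comm ((μ (h + 1) q : ℝ) : ℂ) ((μ (k + 1) q : ℝ) : ℂ)]
  abel

/-- The defining choice of a last box is immaterial: another last box does not touch it, the two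
share a common predecessor, and the operators commute. -/
theorem secondBasis_of_isBoxAddition (q : ℝ) {b : HalfDiagram n p} :
    ∀ {i : ℕ} {hi : i + 1 < n} {a : HalfDiagram n p}, IsBoxAddition i hi a b →
      secondBasis q b = boxOp q i hi (a.height (i + 1)) (secondBasis q a) := by
  suffices H : ∀ m, ∀ b : HalfDiagram n p, b.area = m → ∀ (i : ℕ) (hi : i + 1 < n)
      (a : HalfDiagram n p), IsBoxAddition i hi a b →
      secondBasis q b = boxOp q i hi (a.height (i + 1)) (secondBasis q a) by
    intro i hi a h
    exact H _ b rfl i hi a h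
  intro m
  induction m using Nat.strong_induction_on with
  | _ m ih =>
    rintro b rfl i hi a h
    obtain ⟨j, hj, a', h', e⟩ := exists_secondBasis_eq q h
    rw [e]
    rcases eq_or_ne i j with rfl | hij
    · rw [h.left_unique h']
    · obtain ⟨hij', c, h1, h2⟩ := h.diamond h' hij
      -- Neither box changes the height at the other minimum, so both orders use the same two values
      -- of `μ`.
      rw [ih _ h.area_lt a rfl j hj c h1, ih _ h'.area_lt a' rfl i hi c h2,
        boxOp_commute q hi hj hij', h1.height_eq (by omega) (by omega),
        h2.height_eq (by omega) (by omega)]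

theorem isSecondBasis_secondBasis (q : ℝ) :
    IsSecondBasis q (secondBasis q : HalfDiagram n p → U n p) :=
  isSecondBasis_iff.mpr ⟨fun _ h => secondBasis_of_isMinimal q h,
    fun _ _ _ _ h => secondBasis_of_isBoxAddition q h⟩

theorem IsSecondBasis.eq {q : ℝ} {F : HalfDiagram n p → U n p} (hF : IsSecondBasis q F) :
    F = secondBasis q := by
  rw [isSecondBasis_iff] at hF
  funext b
  induction b using box_induction with
  | hmin a ha => rw [hF.1 a ha, secondBasis_of_isMinimal q ha]
  | hbox i hi a b h ih => rw [hF.2 i hi a b h, ih, secondBasis_of_isBoxAddition q h, boxOp]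

theorem existsUnique_isSecondBasis (q : ℝ) :
    ∃! F : HalfDiagram n p → U n p, IsSecondBasis q F :=
  ⟨_, isSecondBasis_secondBasis q, fun _ h => h.eq⟩

theorem star_secondBasis (q : ℝ) (b : HalfDiagram n p) : star (secondBasis q b) = secondBasis q b := by
  induction b using box_induction with
  | hmin a ha =>
    rw [secondBasis_of_isMinimal q ha]
    funext c
    by_cases h : c = a <;> simp [h]
  | hbox i hi a b h ih =>
    rw [secondBasis_of_isBoxAddition q h, boxOp, star_sub, ← E_star, ih, star_smul, ih]
    simp

/-! ### The action of the generators on the second basis -/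

/-- The brackets of `b` at `i` and `i + 1` have the same direction. -/
def IsSlope (b : HalfDiagram n p) (i : ℕ) (hi : i + 1 < n) : Prop :=
  b.IsOpening ⟨i, Nat.lt_of_succ_lt hi⟩ ↔ b.IsOpening ⟨i + 1, hi⟩

theorem E_secondBasis_of_min (q : ℝ) {i : ℕ} {hi : i + 1 < n} {a b : HalfDiagram n p}
    (h : IsBoxAddition i hi a b) : E q i hi (secondBasis q a) =
      secondBasis q b + ((μ (a.height (i + 1) + 1) q : ℝ) : ℂ) • secondBasis q a := by
  rw [secondBasis_of_isBoxAddition q h, boxOp, sub_add_cancel]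

/-- From `e_i ^ 2 = q e_i` it follows that `e_i (e_i - μ) = (q - μ) e_i`. -/
theorem E_secondBasis_of_isBoxAddition (q : ℝ) {i : ℕ} {hi : i + 1 < n} {a b : HalfDiagram n p}
    (h : IsBoxAddition i hi a b) : E q i hi (secondBasis q b) =
      ((q : ℂ) - (μ (a.height (i + 1) + 1) q : ℝ)) • E q i hi (secondBasis q a) := by
  rw [secondBasis_of_isBoxAddition q h, boxOp, map_sub, map_smul, E_E_self, sub_smul]

theorem E_single_of_peak (q : ℝ) {b : HalfDiagram n p} {i : ℕ} {hi : i + 1 < n}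
    (h1 : b.IsOpening ⟨i, Nat.lt_of_succ_lt hi⟩) (h2 : ¬ b.IsOpening ⟨i + 1, hi⟩) :
    E q i hi (Pi.single b 1) = (q : ℂ) • Pi.single b 1 := by
  have h3 := partner_of_peak h1 h2
  have h4 : b.partner ⟨i, Nat.lt_of_succ_lt hi⟩ = ⟨i + 1, hi⟩ := by
    rw [← h3, b.invol]
  have h5 : ¬ (b.partner ⟨i, Nat.lt_of_succ_lt hi⟩ = ⟨i, Nat.lt_of_succ_lt hi⟩ ∧
      b.partner ⟨i + 1, hi⟩ = ⟨i + 1, hi⟩) := by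
    rw [h4, Fin.ext_iff]; simp
  have h6 : b.cap ⟨i, Nat.lt_of_succ_lt hi⟩ ⟨i + 1, hi⟩ rfl h5 = b := by
    ext j
    have := b.invol j
    change ((b.capPartner _ _ j : Fin n) : ℕ) = _
    congr 1
    unfold capPartner
    grind
  rw [E_single, capState, dif_neg h5, h6, if_pos h4, State.vec, pow_one]

/-- A peak standing on height 0 is not created by a box. Every box lies away from it, so `e_i`
commutes past the box operators down to the minimal diagram, where the arch gives `q`. -/
theorem E_secondBasis_of_peak_zero (q : ℝ) {i : ℕ} {hi : i + 1 < n} {b : HalfDiagram n p}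
    (h1 : b.IsOpening ⟨i, Nat.lt_of_succ_lt hi⟩) (h2 : ¬ b.IsOpening ⟨i + 1, hi⟩)
    (h0 : b.height i = 0) : E q i hi (secondBasis q b) = (q : ℂ) • secondBasis q b := by
  induction b using box_induction with
  | hmin a ha => rw [secondBasis_of_isMinimal q ha, E_single_of_peak q h1 h2]
  | hbox j hj a b h ih =>
    have hji : j ≠ i := by
      rintro rfl
      have e1 := h.height_left
      have e2 := h.height_eq (k := j) (by omega) (by omega)
      have e3 := a.height_nonneg (show j + 1 ≤ n by omega)
      omega
    have hji' : j ≠ i + 1 := by rintro rfl; exact h2 h.2.2.1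
    have hij' : i ≠ j + 1 := by rintro rfl; exact h.2.2.2.1 h1
    have e1 := (h.2.2.2.2 ⟨i, Nat.lt_of_succ_lt hi⟩ (Ne.symm hji) hij').mp h1
    have e2 := mt (h.2.2.2.2 ⟨i + 1, hi⟩ (Ne.symm hji') (fun h => hji (Nat.succ_injective h).symm)).mpr h2
    have e3 := h.height_eq (k := i) (by omega) hij'
    rw [secondBasis_of_isBoxAddition q h, boxOp, map_sub, map_smul,
      E_commute q i j hi hj (by omega), ih e1 e2 (by omega), map_smul, smul_sub, smul_comm]

theorem HalfDiagram.IsMinimal.le_of_isSlope {b : HalfDiagram n p} (hb : b.IsMinimal) {i : ℕ} {hi : i + 1 < n}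
    (h : IsSlope b i hi) : 2 * p ≤ i := by
  rw [IsSlope, hb.isOpening_iff, hb.isOpening_iff] at h
  simp only at h
  omega

/-- Induction on the area by removing a box at `j`. A box away from `i` commutes with `e_i`. A box
next to `i` was added beside a peak at `i`, and the braid relation reduces the claim to `μ_{h+1} (q
- μ_h) = 1`. The indices stay below `n - p`. -/
theorem E_secondBasis_of_isSlope {q : ℝ} (hq : q ≠ 0) (hΔ : ∀ k : ℕ, k + p < n → Δ k q ≠ 0)
    {i : ℕ} {hi : i + 1 < n} {b : HalfDiagram n p} (hb : IsSlope b i hi) :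
    E q i hi (secondBasis q b) = 0 := by
  have hΔ' : ∀ k : ℤ, 0 ≤ k → k < n - p → Δ k q ≠ 0 := by
    intro k h1 h2
    obtain ⟨k, rfl⟩ := Int.eq_ofNat_of_zero_le h1
    exact hΔ k (by omega)
  suffices H : ∀ m, ∀ b : HalfDiagram n p, b.area = m → ∀ (i : ℕ) (hi : i + 1 < n), IsSlope b i hi →
      E q i hi (secondBasis q b) = 0 from H _ b rfl i hi hb
  clear hb b hi i
  intro m
  induction m using Nat.strong_induction_on with
  | _ m ih =>
    rintro b rfl i hi hb
    by_cases hmin : b.IsMinimal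
    · have h1 := hmin.le_of_isSlope hb
      rw [secondBasis_of_isMinimal q hmin, E_single, capState, dif_pos, State.vec]
      simp only [Fin.ext_iff, hmin _]
      constructor <;> rw [if_neg (by omega)]
    · obtain ⟨j, hj, a, h⟩ := exists_isBoxAddition_of_not_isMinimal hmin
      have hji : j ≠ i := by rintro rfl; exact h.2.2.2.1 (hb.mp h.2.2.1)
      have hh := a.height_nonneg (show j + 1 ≤ n by omega)
      have hh' := h.height_add_one_lt
      have hμ := μ_mul_complex (hΔ' _ hh (by omega)) (hΔ' _ (by omega) hh')
      by_cases hadj : j = i + 1 ∨ i = j + 1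
      · have hpeak : a.IsOpening ⟨i, Nat.lt_of_succ_lt hi⟩ ∧ ¬ a.IsOpening ⟨i + 1, hi⟩ := by
          rcases hadj with rfl | rfl
          · exact ⟨(h.2.2.2.2 _ (by simp) (by simp; omega)).mp (hb.mpr h.2.2.1), h.1⟩
          · refine ⟨h.2.1, fun h' => h.2.2.2.1 (hb.mpr ?_)⟩
            exact (h.2.2.2.2 _ (by simp; omega) (by simp)).mpr h'
        have hbase : a.height i = a.height (j + 1) := by
          rcases hadj with rfl | rfl
          · have e1 := a.height_succ_of_isOpening hpeak.1
            have e2 := h.height_left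
            simp only at e1
            omega
          · rfl
        rw [secondBasis_of_isBoxAddition q h, boxOp, map_sub, map_smul]
        rcases hh.eq_or_lt with h0 | h0
        -- Base height 0: `e_i` has eigenvalue `q` on `ξ'_a`, so the braid relation gives `e_i e_j
        -- ξ'_a = ξ'_a` after division by `q`, and `μ_1 q = 1`.
        · have e1 := E_secondBasis_of_peak_zero q hpeak.1 hpeak.2 (hbase.trans h0.symm)
          have e2 := E_braid q i j hi hj hadj (secondBasis q a)
          rw [e1, map_smul, map_smul] at e2
          have e3 := smul_right_injective _ (by exact_mod_cast hq : (q : ℂ) ≠ 0) e2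
          rw [e3, e1, smul_smul]
          rw [← h0, μ_zero, Complex.ofReal_zero, sub_zero] at hμ
          rw [← h0, hμ, one_smul, sub_self]
        -- Positive base height: removing the peak leaves `c` with a slope at `j`, so `e_j ξ'_c =
        -- 0`, and both terms become multiples of `e_i ξ'_c`.
        · obtain ⟨c, hc⟩ := exists_isBoxAddition hpeak.1 hpeak.2 (by omega)
          have e4 := hc.height_left
          have e5 := hc.height_eq (k := i) (by omega) (by omega)
          have hslope : IsSlope c j hj := by
            rcases hadj with rfl | rfl
            · refine iff_of_true hc.2.1 ?_
              exact (hc.2.2.2.2 _ (by simp; omega) (by simp)).mp h.2.1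
            · refine iff_of_false (fun h' => h.1 ?_) hc.1
              exact (hc.2.2.2.2 _ (by simp) (by simp; omega)).mpr h'
          have e6 := ih _ (hc.area_lt.trans h.area_lt) c rfl j hj hslope
          rw [E_secondBasis_of_isBoxAddition q hc, secondBasis_of_isBoxAddition q hc, boxOp,
            map_sub, map_smul, e6, smul_zero, sub_zero, E_braid q i j hi hj hadj, smul_smul]
          rw [show c.height (i + 1) + 1 = a.height (j + 1) by omega, hμ, one_smul, sub_self]
      · have hs : IsSlope a i hi := by
          unfold IsSlope at hb ⊢
          rw [← h.2.2.2.2 _ (by simp; omega) (by simp; omega),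
            ← h.2.2.2.2 _ (by simp; omega) (by simp; omega)]
          exact hb
        rw [secondBasis_of_isBoxAddition q h, boxOp, map_sub, map_smul,
          E_commute q i j hi hj (by omega), ih _ h.area_lt a rfl i hi hs]
        simp

end TemperleyLieb

end

noncomputable section

namespace TemperleyLieb

open HalfDiagram

variable {n p : ℕ}

/-! ### Orthogonality and norms -/

/-- Starting from height 0, a pair of steps that is no slope must go up and down; repeating this `p`
times uses up all closing brackets. -/
theorem eq_of_forall_not_isSlope {a b : HalfDiagram n p} (ha : a.IsMinimal)
    (h : ∀ (j : ℕ) (hj : 2 * j + 1 < n), j < p → ¬ IsSlope b (2 * j) hj) : b = a := by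
  have hp := b.two_mul_arches_le
  have key : ∀ j ≤ p, b.cl (2 * j) = j := by
    intro j
    induction j with
    | zero => simp
    | succ j ih =>
      intro hj
      have e := ih (by omega)
      have hs := h j (by omega) (by omega)
      have h1 := b.cl_succ_le (2 * j)
      have h2 := b.two_mul_cl_le (k := 2 * j + 1) (by omega)
      unfold IsSlope at hs
      have ho : b.IsOpening ⟨2 * j, by omega⟩ := by
        by_contra ho
        have := b.cl_succ_of_not_isOpening ho
        simp only at this
        omega
      have hc : ¬ b.IsOpening ⟨2 * j + 1, by omega⟩ := fun hc => hs (iff_of_true ho hc)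
      have h3 := b.cl_succ_of_isOpening ho
      have h4 := b.cl_succ_of_not_isOpening hc
      simp only at h3 h4
      rw [show 2 * (j + 1) = 2 * j + 1 + 1 by ring]
      omega
  refine ext_of_cl fun k hk => ?_
  rw [ha.cl_eq hk]
  rcases Nat.lt_or_ge (k / 2) p with h1 | h1
  · rw [min_eq_left h1.le]
    have h2 := key (k / 2) h1.le
    have h3 := key (k / 2 + 1) h1
    have h4 := b.cl_mono (show 2 * (k / 2) ≤ k by omega)
    have h5 := b.two_mul_cl_le hk
    omega
  · rw [min_eq_right h1]
    have h2 := key p le_rfl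
    have h3 := b.cl_mono (show 2 * p ≤ k by omega)
    have h4 := b.cl_mono hk
    rw [cl_self] at h4
    omega

/-- Any other `b` has a slope at some `2 j` with `j < p`. There `e_{2j}` kills `ξ'_b` but has
eigenvalue `q` on the minimal vector, so self-adjointness forces orthogonality. -/
theorem formB_secondBasis_minimal {q : ℝ} (hq : q ≠ 0) (hΔ : ∀ k : ℕ, k + p < n → Δ k q ≠ 0)
    {a b : HalfDiagram n p} (ha : a.IsMinimal) (hab : b ≠ a) :
    formB q (secondBasis q a) (secondBasis q b) = 0 := by
  by_contra h0
  refine hab (eq_of_forall_not_isSlope ha fun j hj hjp hs => h0 ?_)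
  have h1 := formB_E q (2 * j) hj (secondBasis q a) (secondBasis q b)
  rw [E_secondBasis_of_isSlope hq hΔ hs, map_zero, secondBasis_of_isMinimal q ha,
    E_single_of_peak q (by rw [ha.isOpening_iff]; simp) (by rw [ha.isOpening_iff]; simp; omega),
    map_smul, LinearMap.smul_apply, smul_eq_zero] at h1
  rw [secondBasis_of_isMinimal q ha]
  exact h1.resolve_left (by exact_mod_cast hq)

/-- Move the box operator of `a'` to `b` and look at `b` near `i`. A slope is killed; at a peak only
`b` and its predecessor occur, neither being `a`; at a minimum the new diagram is not `a`, and for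
`b = a` the two `μ`-terms cancel. -/
theorem formB_secondBasis_of_ne {q : ℝ} (hq : q ≠ 0) (hΔ : ∀ k : ℕ, k + p < n → Δ k q ≠ 0)
    {a b : HalfDiagram n p} (hab : b ≠ a) : formB q (secondBasis q a) (secondBasis q b) = 0 := by
  induction a using box_induction generalizing b with
  | hmin a ha => exact formB_secondBasis_minimal hq hΔ ha hab
  | hbox i hi a a' h ih =>
    rw [secondBasis_of_isBoxAddition q h, boxOp, map_sub, map_smul, LinearMap.sub_apply,
      LinearMap.smul_apply, formB_E]
    have hmin : ∀ {b : HalfDiagram n p}, b.IsOpening ⟨i, Nat.lt_of_succ_lt hi⟩ → b ≠ a := by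
      rintro b hb rfl
      exact h.1 hb
    by_cases hs : IsSlope b i hi
    · have hba : b ≠ a := by rintro rfl; exact h.1 (hs.mpr h.2.1)
      rw [E_secondBasis_of_isSlope hq hΔ hs, ih hba]
      simp
    by_cases ho : b.IsOpening ⟨i, Nat.lt_of_succ_lt hi⟩
    · have hc : ¬ b.IsOpening ⟨i + 1, hi⟩ := fun hc => hs (iff_of_true ho hc)
      rw [ih (hmin ho)]
      rcases (b.height_nonneg (show i ≤ n by omega)).eq_or_lt with h0 | h0
      · rw [E_secondBasis_of_peak_zero q ho hc h0.symm, map_smul, ih (hmin ho)]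
        simp
      · obtain ⟨c, hcb⟩ := exists_isBoxAddition ho hc (by omega)
        have hca : c ≠ a := by rintro rfl; exact hab (hcb.right_unique h)
        rw [E_secondBasis_of_isBoxAddition q hcb, E_secondBasis_of_min q hcb, map_smul, map_add,
          map_smul, ih hca, ih (hmin ho)]
        simp
    · have hc : b.IsOpening ⟨i + 1, hi⟩ := by
        by_contra hc
        exact hs (iff_of_false ho hc)
      obtain ⟨c, hcb⟩ := exists_isBoxAddition_right ho hc
      rw [E_secondBasis_of_min q hcb, map_add, ih (hmin hcb.2.2.1), map_smul, zero_add]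
      by_cases hba : b = a
      · subst hba
        exact sub_self _
      · rw [ih hba]
        simp

/-- The square of the norm of an element of the second basis. -/
def normSq (q : ℝ) (a : HalfDiagram n p) : ℂ := formB q (secondBasis q a) (secondBasis q a)

/-- By orthogonality `⟨ξ'_b, ξ'_b⟩ = ⟨e_i ξ'_a, ξ'_b⟩`; moving `e_i` to `ξ'_b` gives `q - μ`, and
the component of `e_i ξ'_a` along `ξ'_a` gives `μ`. -/
theorem normSq_of_isBoxAddition {q : ℝ} (hq : q ≠ 0) (hΔ : ∀ k : ℕ, k + p < n → Δ k q ≠ 0) {i : ℕ}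
    {hi : i + 1 < n} {a b : HalfDiagram n p} (h : IsBoxAddition i hi a b) :
    normSq q b = ((μ (a.height (i + 1) + 1) q * (q - μ (a.height (i + 1) + 1) q) : ℝ) : ℂ) *
      normSq q a := by
  have hab : b ≠ a := by rintro rfl; exact h.1 h.2.2.1
  have e1 := E_secondBasis_of_isBoxAddition q h
  have e2 := E_secondBasis_of_min q h
  have e3 : formB q (secondBasis q b) (secondBasis q b) =
      formB q (E q i hi (secondBasis q a)) (secondBasis q b) := by
    rw [e2, map_add, map_smul, LinearMap.add_apply, LinearMap.smul_apply,
      formB_secondBasis_of_ne hq hΔ hab]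
    simp
  rw [normSq, normSq, e3, formB_E, e1, e2, map_smul, map_add, map_smul,
    formB_secondBasis_of_ne hq hΔ hab]
  simp only [smul_eq_mul, zero_add]
  push_cast
  ring

theorem normSq_single (q : ℝ) (b : HalfDiagram n p) :
    formB q (Pi.single b 1) (Pi.single b 1) = (q : ℂ) ^ loops (formEdge b b) {i | b.IsThrough i} := by
  have h : ¬ FormVanishes b b := by
    rintro ⟨i, j, hij, hJ, h⟩
    rw [joined_iff_forall_compat] at hJ
    have hij' : b.IsThrough i ∧ b.IsThrough j := h.elim id id
    have := hJ (fun k => decide (k = i)) ?_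
    · simp [hij.symm] at this
    · rintro u v (rfl | rfl) <;>
      · have : b.partner u = i ↔ u = i := by
          rw [← b.partner_injective.eq_iff (b := i), hij'.1, b.invol]
        simp [this]
  rw [formB_single, formState, if_neg h]
  simp [loopVal]

theorem exists_normSq_eq {q : ℝ} (hq : 0 < q) (hΔ : ∀ k : ℕ, k < n → Δ k q ≠ 0) (a : HalfDiagram n p) :
    ∃ r : ℝ, normSq q a = r ∧ r ≠ 0 ∧ ((∀ k : ℕ, k < n → 0 < Δ k q) → 0 < r) := by
  induction a using box_induction with
  | hmin a ha =>
    rw [normSq, secondBasis_of_isMinimal q ha, normSq_single]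
    exact ⟨q ^ _, by push_cast; rfl, (pow_pos hq _).ne', fun _ => pow_pos hq _⟩
  | hbox i hi a b h ih =>
    obtain ⟨r, e, h0, hpos⟩ := ih
    have h1 := h.height_add_one_lt
    have h2 := h.arches_pos
    obtain ⟨k, hk⟩ := Int.eq_ofNat_of_zero_le (a.height_nonneg (show i + 1 ≤ n by omega))
    have hΔ0 := hΔ k (by omega)
    have hΔ1 := hΔ (k + 1) (by omega)
    -- The height bound gives `k + 2 ≤ n - p`, and a box exists only for `p ≥ 1`, so the index stays
    -- below `n`.
    have hΔ2 := hΔ (k + 2) (by omega)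
    push_cast at hΔ0 hΔ1 hΔ2
    have e1 : μ (a.height (i + 1) + 1) q * (q - μ (a.height (i + 1) + 1) q) =
        Δ k q / Δ (k + 1) q * (Δ (k + 2) q / Δ (k + 1) q) := by
      rw [hk, q_sub_μ hΔ1, μ_add_one, add_assoc]
      rfl
    refine ⟨_, by rw [normSq_of_isBoxAddition hq.ne' (fun k hk => hΔ k (by omega)) h, e,
      ← Complex.ofReal_mul], ?_, fun hp => ?_⟩
    · rw [e1]
      positivity
    · have hp0 := hp k (by omega)
      have hp1 := hp (k + 1) (by omega)
      have hp2 := hp (k + 2) (by omega)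
      push_cast at hp0 hp1 hp2
      rw [e1]
      have := hpos hp
      positivity

theorem normSq_ne_zero {q : ℝ} (hq : 0 < q) (hΔ : ∀ k : ℕ, k < n → Δ k q ≠ 0) (a : HalfDiagram n p) :
    normSq q a ≠ 0 := by
  obtain ⟨r, e, h, -⟩ := exists_normSq_eq hq hΔ a
  rw [e]
  exact_mod_cast h

theorem linearIndependent_secondBasis {q : ℝ} (hq : 0 < q) (hΔ : ∀ k : ℕ, k < n → Δ k q ≠ 0) :
    LinearIndependent ℂ (secondBasis q : HalfDiagram n p → U n p) := by
  rw [Fintype.linearIndependent_iff]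
  intro g hg a
  have h := congrArg (fun x => formB q (secondBasis q a) x) hg
  simp only [map_sum, map_smul, map_zero] at h
  rw [Finset.sum_eq_single a (fun b _ hb => by
    rw [formB_secondBasis_of_ne hq.ne' (fun k hk => hΔ k (by omega)) hb, smul_zero]) (by simp)] at h
  exact (smul_eq_zero.mp h).resolve_right (normSq_ne_zero hq hΔ a)

theorem span_secondBasis {q : ℝ} (hq : 0 < q) (hΔ : ∀ k : ℕ, k < n → Δ k q ≠ 0) :
    Submodule.span ℂ (Set.range (secondBasis q : HalfDiagram n p → U n p)) = ⊤ := by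
  refine (linearIndependent_secondBasis hq hΔ).span_eq_top_of_card_eq_finrank' ?_
  rw [Module.finrank_fintype_fun_eq_card]

/-- An orthogonal basis with nonzero norms makes the form nondegenerate. -/
theorem eq_zero_of_formB {q : ℝ} (hq : 0 < q) (hΔ : ∀ k : ℕ, k < n → Δ k q ≠ 0) {v : U n p}
    (h : ∀ c, formB q v (Pi.single c 1) = 0) : v = 0 := by
  have h1 : formB q v = 0 := U_hom_ext fun c => by rw [h c]; rfl
  obtain ⟨g, hg⟩ := (Submodule.mem_span_range_iff_exists_fun ℂ).mp
    ((span_secondBasis hq hΔ).symm ▸ Submodule.mem_top : v ∈ _)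
  rw [← hg]
  refine Finset.sum_eq_zero fun a _ => ?_
  have h2 : formB q v (secondBasis q a) = 0 := by rw [h1]; rfl
  rw [← hg, map_sum, LinearMap.sum_apply, Finset.sum_eq_single a (fun b _ hb => by
    rw [map_smul, LinearMap.smul_apply,
      formB_secondBasis_of_ne hq.ne' (fun k hk => hΔ k (by omega)) hb.symm, smul_zero]) (by simp),
    map_smul, LinearMap.smul_apply] at h2
  rw [(smul_eq_zero.mp h2).resolve_right (normSq_ne_zero hq hΔ a), zero_smul]

end TemperleyLieb

end

noncomputable section

namespace TemperleyLieb

open HalfDiagram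

variable {n p : ℕ}

/-! ### Triangularity of the second basis -/

namespace HalfDiagram

/-- Closing brackets among the first `k` correspond to arches lying entirely there; counting both
ends makes caps easier to follow. -/
theorem two_mul_cl_eq (a : HalfDiagram n p) (k : ℕ) : 2 * a.cl k =
    (Finset.univ.filter fun j : Fin n => (j : ℕ) < k ∧ a.partner j ≠ j ∧ (a.partner j : ℕ) < k).card := by
  have h1 : (Finset.univ.filter fun j : Fin n => (j : ℕ) < k ∧ a.partner j ≠ j ∧ (a.partner j : ℕ) < k) =
      (Finset.univ.filter fun j : Fin n => (j : ℕ) < k ∧ ¬ a.IsOpening j) ∪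
        (Finset.univ.filter fun j : Fin n => (j : ℕ) < k ∧ ¬ a.IsOpening j).image a.partner := by
    ext j
    have hj := a.invol j
    simp only [Finset.mem_filter, Finset.mem_univ, true_and, Finset.mem_union, Finset.mem_image,
      IsOpening, not_le]
    constructor
    · rintro ⟨h1, h2, h3⟩
      rcases lt_or_gt_of_ne h2 with h | h
      · exact Or.inl ⟨h1, h⟩
      · exact Or.inr ⟨a.partner j, ⟨h3, by rwa [hj]⟩, hj⟩
    · rintro (⟨h1, h2⟩ | ⟨i, ⟨h1, h2⟩, rfl⟩)
      · exact ⟨h1, h2.ne, by omega⟩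
      · rw [a.invol]
        exact ⟨by omega, h2.ne', h1⟩
  rw [h1, Finset.card_union_of_disjoint, Finset.card_image_of_injective _ a.partner_injective, cl, two_mul]
  rw [Finset.disjoint_left]
  intro j hj hj'
  simp only [Finset.mem_filter, Finset.mem_univ, true_and, Finset.mem_image] at hj hj'
  obtain ⟨i, ⟨_, hi⟩, rfl⟩ := hj'
  exact hj.2 (isOpening_partner hi)

/-- For `k ≠ u + 1` the cut does not separate `u` from `v`, so the cap cannot reduce the number of
arches before it. -/
theorem cl_le_cl_cap (b : HalfDiagram n p) {u v : Fin n} (hv : (v : ℕ) = u + 1)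
    (h : ¬ (b.partner u = u ∧ b.partner v = v)) {k : ℕ} (hk : k ≠ u + 1) :
    b.cl k ≤ (b.cap u v hv h).cl k := by
  have huv : u ≠ v := by rintro rfl; omega
  have h1 := b.invol u
  have h2 := b.invol v
  suffices h0 : 2 * b.cl k ≤ 2 * (b.cap u v hv h).cl k by omega
  rw [two_mul_cl_eq, two_mul_cl_eq]
  change _ ≤ (Finset.univ.filter fun j : Fin n =>
    (j : ℕ) < k ∧ b.capPartner u v j ≠ j ∧ (b.capPartner u v j : ℕ) < k).card
  rcases Nat.lt_or_ge k (u + 1) with hk' | hk'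
  · refine Finset.card_le_card fun j hj => ?_
    have h3 := b.invol j
    have key := b.capPartner_cases huv j
    simp only [Finset.mem_filter, Finset.mem_univ, true_and] at hj ⊢
    grind
  -- A point whose arch to `u` or `v` is lost, because the strand now leaves the first `k` points or
  -- becomes a through-string, is replaced by the other of `u, v`, which was not counted before.
  · refine Finset.card_le_card_of_injOn (fun j => if b.partner j = u ∧ j ≠ v ∧
      (b.partner v = v ∨ k ≤ b.partner v) then v else if b.partner j = v ∧ j ≠ u ∧
      (b.partner u = u ∨ k ≤ b.partner u) then u else j) ?_ ?_
    · intro j hj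
      have h3 := b.invol j
      have k1 := b.capPartner_cases huv j
      have k2 : b.capPartner u v u = v := by simp [capPartner]
      have k3 : b.capPartner u v v = u := by simp [capPartner, huv.symm]
      simp only [Finset.coe_filter, Finset.mem_univ, true_and, Set.mem_ofPred_eq] at hj ⊢
      split_ifs with c1 c2
      · rw [k3]
        exact ⟨by omega, huv, by omega⟩
      · rw [k2]
        exact ⟨by omega, huv.symm, by omega⟩
      · grind
    · intro j hj j' hj' e
      have h3 := b.invol j
      have h4 := b.invol j'
      simp only [Finset.coe_filter, Finset.mem_univ, true_and, Set.mem_ofPred_eq] at hj hj' e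
      grind

theorem cl_cap_succ (b : HalfDiagram n p) {i : ℕ} {hi : i + 1 < n}
    (h : ¬ (b.partner ⟨i, Nat.lt_of_succ_lt hi⟩ = ⟨i, Nat.lt_of_succ_lt hi⟩ ∧
      b.partner ⟨i + 1, hi⟩ = ⟨i + 1, hi⟩)) :
    (b.cap ⟨i, Nat.lt_of_succ_lt hi⟩ ⟨i + 1, hi⟩ rfl h).cl (i + 1) =
      (b.cap ⟨i, Nat.lt_of_succ_lt hi⟩ ⟨i + 1, hi⟩ rfl h).cl i := by
  refine (b.cap _ _ rfl h).cl_succ_of_isOpening (i := ⟨i, Nat.lt_of_succ_lt hi⟩) ?_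
  change _ ≤ b.capPartner _ _ _
  rw [capPartner, if_pos rfl]
  simp [Fin.le_def]

end HalfDiagram

theorem exists_of_E_apply_ne_zero {q : ℝ} {i : ℕ} {hi : i + 1 < n} {x : U n p} {c : HalfDiagram n p}
    (h : E q i hi x c ≠ 0) : ∃ b, x b ≠ 0 ∧
      ∃ h : ¬ (b.partner ⟨i, Nat.lt_of_succ_lt hi⟩ = ⟨i, Nat.lt_of_succ_lt hi⟩ ∧
        b.partner ⟨i + 1, hi⟩ = ⟨i + 1, hi⟩),
        c = b.cap ⟨i, Nat.lt_of_succ_lt hi⟩ ⟨i + 1, hi⟩ rfl h := by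
  rw [E, Fintype.linearCombination_apply, Finset.sum_apply] at h
  obtain ⟨b, -, hb⟩ := Finset.exists_ne_zero_of_sum_ne_zero h
  rw [Pi.smul_apply, smul_eq_mul] at hb
  refine ⟨b, left_ne_zero_of_mul hb, ?_⟩
  have h2 := right_ne_zero_of_mul hb
  unfold capState at h2
  split_ifs at h2 with h3
  · exact absurd rfl h2
  all_goals
    refine ⟨h3, ?_⟩
    by_contra hc
    simp [State.vec, hc] at h2

/-- Caps only raise closing counts, except possibly after `i + 1` steps; there the cap has an arch
opening at `i`, so its count equals that after `i` steps. -/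
theorem secondBasis_triangular (q : ℝ) (a : HalfDiagram n p) :
    secondBasis q a a = 1 ∧ ∀ b, secondBasis q a b ≠ 0 → ∀ k, a.cl k ≤ b.cl k := by
  induction a using box_induction with
  | hmin a ha =>
    rw [secondBasis_of_isMinimal q ha]
    refine ⟨Pi.single_eq_same _ _, fun b hb k => ?_⟩
    by_cases h : b = a
    · rw [h]
    · exact absurd (Pi.single_eq_of_ne h _) hb
  | hbox i hi a a' h ih =>
    obtain ⟨ih1, ih2⟩ := ih
    have key : ∀ b, secondBasis q a b ≠ 0 → ∀ k, a'.cl k ≤ b.cl k := fun b hb k =>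
      (h.cl_le k).trans (ih2 b hb k)
    rw [secondBasis_of_isBoxAddition q h, boxOp]
    constructor
    · have h1 : secondBasis q a a' = 0 := by
        by_contra h0
        have := ih2 a' h0 (i + 1)
        rw [h.cl_left, h.cl_right] at this
        omega
      rw [Pi.sub_apply, Pi.smul_apply, h1, smul_zero, sub_zero, E, Fintype.linearCombination_apply,
        Finset.sum_apply, Finset.sum_eq_single a]
      · rw [Pi.smul_apply, capState_of_isBoxAddition h, ih1]
        simp [State.vec]
      · intro b _ hba
        rw [Pi.smul_apply, smul_eq_mul]
        by_contra h0
        have hb := left_ne_zero_of_mul h0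
        have h2 : E q i hi (Pi.single b 1) a' ≠ 0 := by
          rw [E_single]
          exact right_ne_zero_of_mul h0
        obtain ⟨b', hb', h3, e⟩ := exists_of_E_apply_ne_zero h2
        obtain rfl : b' = b := by
          by_contra hne
          exact hb' (Pi.single_eq_of_ne hne _)
        -- A diagram whose cap is `a'` has counts at most those of `a` away from `i + 1`, and
        -- triangularity gives the opposite inequality. So only `a` contributes to the leading
        -- coefficient.
        have h4 : ∀ k ≠ i + 1, b'.cl k = a.cl k := by
          intro k hk
          refine le_antisymm ?_ (ih2 b' hb k)
          rw [← h.cl_eq hk, e]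
          exact b'.cl_le_cl_cap rfl h3 hk
        refine hba (ext_of_cl fun k _ => ?_)
        rcases eq_or_ne k (i + 1) with rfl | hk
        · have h5 := ih2 b' hb (i + 1)
          have h6 := b'.cl_succ_le i
          have h7 := h.cl_left
          have h8 := h4 i (by omega)
          omega
        · exact h4 k hk
      · simp
    · intro c hc k
      by_cases h0 : E q i hi (secondBasis q a) c = 0
      · rw [Pi.sub_apply, h0, zero_sub, neg_ne_zero, Pi.smul_apply, smul_eq_mul] at hc
        exact key c (right_ne_zero_of_mul hc) k
      · obtain ⟨b, hb, h3, e⟩ := exists_of_E_apply_ne_zero h0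
        have h4 : ∀ k ≠ i + 1, a'.cl k ≤ c.cl k := fun k hk =>
          (key b hb k).trans (by rw [e]; exact b.cl_le_cl_cap rfl h3 hk)
        rcases eq_or_ne k (i + 1) with rfl | hk
        · have h5 := h4 i (by omega)
          rw [h.cl_right, ← h.cl_eq (k := i) (by omega), e, cl_cap_succ, ← e]
          exact h5
        · exact h4 k hk

end TemperleyLieb

end

noncomputable section

namespace TemperleyLieb

open HalfDiagram

variable {n p : ℕ}

/-! ### The action of the second basis -/

theorem Pairing.IsTensor.induction {motive : HalfDiagram n p → HalfDiagram n p → Pairing n → Prop}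
    (hmin : ∀ h, motive (minimal n p h) (minimal n p h) (Pairing.minTensor n p h))
    (hleft : ∀ i (hi : i + 1 < n) a a' b P P', Pairing.IsTensor a b P → Pairing.IsTensor a' b P' →
      IsBoxAddition i hi a a' → IsBoxAddition i (by omega) P P' → motive a b P → motive a' b P')
    (hright : ∀ i (hi : i + 1 < n) a b b' P P', Pairing.IsTensor a b P → Pairing.IsTensor a b' P' →
      IsBoxAddition i hi b b' → IsBoxAddition (n + n - 2 - i) (by omega) P P' → motive a b P →
      motive a b' P')
    {a b : HalfDiagram n p} {P : Pairing n} (h : Pairing.IsTensor a b P) : motive a b P := by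
  induction a using box_induction generalizing P with
  | hmin a ha =>
    induction b using box_induction generalizing P with
    | hmin b hb =>
      have hp := b.two_mul_arches_le
      obtain rfl := ha.eq (isMinimal_minimal hp)
      obtain rfl := hb.eq (isMinimal_minimal hp)
      rw [h.unique (Pairing.isTensor_minTensor hp)]
      exact hmin hp
    | hbox i hi b b' hb ih =>
      obtain ⟨Q, hQ⟩ := Pairing.exists_isTensor_pair a b
      exact hright i hi a b b' Q P hQ h hb (hQ.isBoxAddition_right h hb) (ih hQ)
  | hbox i hi a a' ha ih =>
    obtain ⟨Q, hQ⟩ := Pairing.exists_isTensor_pair a b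
    exact hleft i hi a a' b Q P hQ h ha (hQ.isBoxAddition_left h ha) (ih hQ)

/-- The product of the generators that join the points `2 j` and `2 j + 1` for `j < k`. -/
def capProd (q : ℝ) : (k : ℕ) → 2 * k ≤ n → (U n p →ₗ[ℂ] U n p)
  | 0, _ => LinearMap.id
  | k + 1, h => E q (2 * k) (by omega) ∘ₗ capProd q k (by omega)

theorem actL_minTensor (q : ℝ) (k : ℕ) (hk : 2 * k ≤ n) (v : U n p) :
    actL q (Pi.single (Pairing.minTensor n k hk) 1) v = capProd q k hk v := by
  induction k with
  | zero => rw [Pairing.minTensor_zero, actL_one]; rfl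
  | succ k ih =>
    have h1 : E q (2 * k) (by omega) (Pi.single (Pairing.minTensor n k (by omega)) 1) =
        (Pi.single (Pairing.minTensor n (k + 1) hk) 1 : U (n + n) n) := by
      rw [E_single, Pairing.capState_minTensor hk, ← single_eq_vec]
    rw [← h1, actL_E_left q (2 * k) (by omega), ih]
    rfl

theorem capProd_apply_ne_zero {q : ℝ} {k : ℕ} {hk : 2 * k ≤ n} {v : U n p} {c : HalfDiagram n p}
    (h : capProd q k hk v c ≠ 0) (j : ℕ) (hj : j < k) :
    c.partner ⟨2 * j, by omega⟩ = ⟨2 * j + 1, by omega⟩ := by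
  induction k generalizing c with
  | zero => omega
  | succ k ih =>
    obtain ⟨b, hb, h3, rfl⟩ := exists_of_E_apply_ne_zero h
    change b.capPartner _ _ _ = _
    rcases Nat.lt_or_ge j k with h4 | h4
    · have h5 := ih hb h4
      unfold capPartner
      rw [h5]
      simp only [Fin.ext_iff]
      rw [if_neg (by omega), if_neg (by omega), if_neg (by omega), if_neg (by omega)]
    · obtain rfl : j = k := by omega
      simp [capPartner]

theorem isOpening_of_arch {c : HalfDiagram n p} {i : ℕ} {hi : i + 1 < n}
    (h : c.partner ⟨i, Nat.lt_of_succ_lt hi⟩ = ⟨i + 1, hi⟩) :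
    c.IsOpening ⟨i, Nat.lt_of_succ_lt hi⟩ ∧ ¬ c.IsOpening ⟨i + 1, hi⟩ := by
  unfold IsOpening
  rw [← h, c.invol, h]
  simp [Fin.le_def]

theorem le_cl_of_forall {k : ℕ} (hk : 2 * k ≤ n) {c : HalfDiagram n p}
    (h : ∀ (j : ℕ) (hj : j < k), c.partner ⟨2 * j, by omega⟩ = ⟨2 * j + 1, by omega⟩) :
    k ≤ c.cl (2 * k) := by
  have key : ∀ j ≤ k, j ≤ c.cl (2 * j) := by
    intro j
    induction j with
    | zero => simp
    | succ j ih =>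
      intro hj
      have h1 := ih (by omega)
      have h2 := c.cl_succ_of_not_isOpening (isOpening_of_arch (hi := by omega) (h j (by omega))).2
      have h3 := c.cl_mono (show 2 * j ≤ 2 * j + 1 by omega)
      simp only at h2
      rw [show 2 * (j + 1) = 2 * j + 1 + 1 by ring]
      omega
  exact key k le_rfl

theorem capProd_eq_zero (q : ℝ) {k : ℕ} (hk : 2 * k ≤ n) (h : p < k) :
    capProd q k hk = (0 : U n p →ₗ[ℂ] U n p) := by
  refine LinearMap.ext fun v => ?_
  funext c
  by_contra h0
  have h1 := le_cl_of_forall hk (capProd_apply_ne_zero h0)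
  have h2 := c.cl_mono hk
  rw [cl_self] at h2
  omega

/-- Every diagram in the image contains the `p` arches of the minimal one, and there are no others.
-/
theorem capProd_arches (q : ℝ) (hp : 2 * p ≤ n) (v : U n p) :
    capProd q p hp v = capProd q p hp v (minimal n p hp) • Pi.single (minimal n p hp) 1 := by
  funext c
  by_cases hc : c = minimal n p hp
  · rw [hc]; simp
  · rw [Pi.smul_apply, Pi.single_eq_of_ne hc, smul_zero]
    by_contra h0
    refine hc (eq_of_forall_not_isSlope (isMinimal_minimal hp) fun j hj hjp hs => ?_)
    have h1 := isOpening_of_arch (hi := hj) (capProd_apply_ne_zero h0 j hjp)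
    exact h1.2 (hs.mp h1.1)

theorem formB_capProd (q : ℝ) {k : ℕ} (hk : 2 * k ≤ n) {w : U n p}
    (hw : ∀ (j : ℕ) (hj : 2 * j + 1 < n), j < k → E q (2 * j) hj w = (q : ℂ) • w) (v : U n p) :
    formB q w (capProd q k hk v) = (q : ℂ) ^ k * formB q w v := by
  induction k with
  | zero => simp [capProd]
  | succ k ih =>
    rw [capProd, LinearMap.comp_apply, ← formB_E, hw k (by omega) (by omega), map_smul,
      LinearMap.smul_apply, ih (by omega) fun j hj hjk => hw j hj (by omega), smul_eq_mul, pow_succ']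
    ring

theorem joined_formEdge_self {b : HalfDiagram n p} {i j : Fin n} (h : Joined (formEdge b b) i j) :
    j = i ∨ j = b.partner i := by
  rw [joined_iff_forall_compat] at h
  have h1 := h (fun k => decide (k = i ∨ k = b.partner i)) ?_
  · simp only [true_or, decide_true] at h1
    exact of_decide_eq_true h1.symm
  · rintro u v (rfl | rfl) <;>
    · have := b.invol u
      have := b.invol i
      simp only [decide_eq_decide]
      grind

/-- Each arch glued to its copy is one loop, represented by its closing end. -/
theorem loops_formEdge_self (b : HalfDiagram n p) : loops (formEdge b b) {i | b.IsThrough i} = p := by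
  have h1 : Nat.card {j : Fin n // ¬ b.IsOpening j} = p := by
    rw [Nat.card_eq_fintype_card, Fintype.card_subtype]
    conv_rhs => rw [← b.cl_self]
    unfold cl
    congr 1
    ext j
    simp
  conv_rhs => rw [← h1]
  unfold loops
  symm
  refine Nat.card_congr (Equiv.ofBijective (fun j => ⟨Quot.mk _ j.1, fun v hv hJ => ?_⟩) ⟨?_, ?_⟩)
  · have hv' : b.partner v = v := hv
    rcases joined_formEdge_self hJ with h | h
    · exact j.2 (by rw [h]; exact hv'.ge)
    · exact j.2 (by rw [h, hv']; exact hv'.ge)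
  · rintro ⟨i, hi⟩ ⟨j, hj⟩ h
    rcases joined_formEdge_self (Subtype.ext_iff.mp h) with h | h
    · exact Subtype.ext h.symm
    · exact absurd (by simp only at h; rw [h]; exact isOpening_partner hi) hj
  · rintro ⟨C, hC⟩
    obtain ⟨v, rfl⟩ := Quot.exists_rep C
    by_cases hv : b.IsOpening v
    · have hne : b.partner v ≠ v := fun h => hC v h rfl
      have hlt : v < b.partner v := lt_of_le_of_ne hv (Ne.symm hne)
      refine ⟨⟨b.partner v, ?_⟩, Subtype.ext (Quot.sound (Or.inl (b.invol v).symm))⟩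
      unfold IsOpening
      rw [b.invol]
      exact hlt.not_ge
    · exact ⟨⟨v, hv⟩, rfl⟩

theorem E_minimal (q : ℝ) (hp : 2 * p ≤ n) (j : ℕ) (hj : 2 * j + 1 < n) (hjp : j < p) :
    E q (2 * j) hj (Pi.single (minimal n p hp) 1) =
      ((q : ℂ) • Pi.single (minimal n p hp) 1 : U n p) := by
  refine E_single_of_peak q ?_ ?_ <;> rw [(isMinimal_minimal hp).isOpening_iff]
  · simp
  · simp; omega

/-- The image is the line of the minimal vector. Pairing with that vector, an eigenvector of norm `q
^ p`, determines the coefficient after cancelling `q ^ p`. -/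
theorem capProd_arches_eq {q : ℝ} (hq : q ≠ 0) (hp : 2 * p ≤ n) (v : U n p) :
    capProd q p hp v =
      formB q v (secondBasis q (minimal n p hp)) • secondBasis q (minimal n p hp) := by
  have h1 := formB_capProd q hp (E_minimal q hp) v
  rw [capProd_arches, map_smul, normSq_single, loops_formEdge_self, smul_eq_mul, mul_comm] at h1
  have h2 := mul_left_cancel₀ (pow_ne_zero p (by exact_mod_cast hq : (q : ℂ) ≠ 0)) h1
  rw [secondBasis_of_isMinimal q (isMinimal_minimal hp), capProd_arches, h2, formB_comm]

/-- A pairing with more than `p` arches in each half would need more than `p` arches in the result.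
Boxes on either side reduce this to the minimal tensor. -/
theorem actL_single_of_lt {q : ℝ} {r : ℕ} (hr : p < r) {a b : HalfDiagram n r} {P : Pairing n}
    (h : Pairing.IsTensor a b P) : actL q (Pi.single P 1) = (0 : U n p →ₗ[ℂ] U n p) := by
  refine Pairing.IsTensor.induction
    (motive := fun _ _ P => actL q (Pi.single P 1) = (0 : U n p →ₗ[ℂ] U n p)) ?_ ?_ ?_ h
  · exact fun h => LinearMap.ext fun v => by rw [actL_minTensor, capProd_eq_zero q h hr]
  · intro i hi a a' b P P' h h' hb hB ih
    have e : E q i (by omega) (Pi.single P 1) = (Pi.single P' 1 : U (n + n) n) := by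
      rw [E_single, capState_of_isBoxAddition hB, ← single_eq_vec]
    refine LinearMap.ext fun v => ?_
    rw [← e, actL_E_left q i hi, ih]
    simp
  · intro i hi a b b' P P' h h' hb hB ih
    have e : E q (n + n - 2 - i) (by omega) (Pi.single P 1) = (Pi.single P' 1 : U (n + n) n) := by
      rw [E_single, capState_of_isBoxAddition hB, ← single_eq_vec]
    refine LinearMap.ext fun v => ?_
    rw [← e, actL_E_right q i hi, ih]
    simp

theorem actL_eq_sum (q : ℝ) (x : U (n + n) n) (v : U n p) :
    actL q x v = ∑ P, x P • actL q (Pi.single P 1) v := by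
  have hx : x = ∑ P, x P • (Pi.single P 1 : U (n + n) n) := by
    funext P; simp [Pi.single_apply]
  conv_lhs => rw [hx]
  simp only [map_sum, map_smul, LinearMap.sum_apply, LinearMap.smul_apply]

/-- With exactly `r` arches the minimal counts are already the largest possible; transposition gives
the same for the right half. -/
theorem eq_minTensor {r : ℕ} (hr : 2 * r ≤ n) {Q : Pairing n}
    (h : ∀ k, (Pairing.minTensor n r hr).cl k ≤ Q.cl k) (hQ : Q.cl n = r) :
    Q = Pairing.minTensor n r hr := by
  have hT := Pairing.isTensor_minTensor hr
  have hL := Pairing.isTensor_left Q hQ (Q.cl_transpose_self.trans hQ)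
  have key : ∀ a : HalfDiagram n r, (∀ k ≤ n, (minimal n r hr).cl k ≤ a.cl k) → a = minimal n r hr := by
    intro a ha
    refine ext_of_cl fun k hk => le_antisymm ?_ (ha k hk)
    have h1 := a.two_mul_cl_le hk
    have h2 := a.cl_mono hk
    rw [cl_self] at h2
    rw [(isMinimal_minimal hr).cl_eq hk]
    omega
  have e1 := key _ fun k hk => by
    rw [← hL.cl_eq hk, ← hT.cl_eq hk]
    exact h k
  have e2 := key _ fun k hk => by
    rw [← hL.transpose.cl_eq hk, ← hT.transpose.cl_eq hk]
    have h1 := Q.cl_transpose (k := k) (by omega)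
    have h2 := (Pairing.minTensor n r hr).cl_transpose (k := k) (by omega)
    have h3 := h (n + n - k)
    omega
  rw [e1, e2] at hL
  exact hL.unique hT

/-- By triangularity every other term of `e'` has more than `r ≥ p` arches in each half and acts as
zero. -/
theorem actL_secondBasis_minTensor {q : ℝ} {r : ℕ} (hr : 2 * r ≤ n) (h : p ≤ r) (v : U n p) :
    actL q (secondBasis q (Pairing.minTensor n r hr)) v = capProd q r hr v := by
  obtain ⟨h1, h2⟩ := secondBasis_triangular q (Pairing.minTensor n r hr)
  rw [actL_eq_sum, Finset.sum_eq_single (Pairing.minTensor n r hr), h1, one_smul, actL_minTensor]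
  · intro Q _ hQ
    by_cases h0 : secondBasis q (Pairing.minTensor n r hr) Q = 0
    · rw [h0, zero_smul]
    · have h3 := h2 Q h0
      have h4 := h3 n
      rw [(Pairing.isTensor_minTensor hr).cl_eq le_rfl, cl_self] at h4
      have h5 : Q.cl n ≠ r := fun h5 => hQ (eq_minTensor hr h3 h5)
      rw [actL_single_of_lt (r := Q.cl n) (by omega)
        (Pairing.isTensor_left Q rfl Q.cl_transpose_self)]
      simp
  · simp

theorem exists_peak {k : ℕ} (hk : 2 * k ≤ n) (h : k < p) {c : HalfDiagram n p}
    (hc : k ≤ c.cl (2 * k)) :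
    ∃ (i : ℕ) (hi : i + 1 < n), 2 * k ≤ i ∧ c.IsOpening ⟨i, Nat.lt_of_succ_lt hi⟩ ∧
      ¬ c.IsOpening ⟨i + 1, hi⟩ := by
  have hex : ∃ t : ℕ, 2 * k ≤ t ∧ ∃ ht : t < n, ¬ c.IsOpening ⟨t, ht⟩ := by
    by_contra! hcon
    have : ∀ t, 2 * k ≤ t → t ≤ n → c.cl t = c.cl (2 * k) := by
      intro t ht
      induction t, ht using Nat.le_induction with
      | base => exact fun _ => rfl
      | succ t ht ih =>
        intro htn
        rw [← ih (by omega)]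
        exact c.cl_succ_of_isOpening (hcon t ht htn)
    have h1 := this n hk le_rfl
    rw [cl_self] at h1
    have := c.two_mul_cl_le hk
    omega
  classical
  obtain ⟨h1, h2, h3⟩ := Nat.find_spec hex
  have h4 := fun t => @Nat.find_min _ _ hex t
  generalize Nat.find hex = t at *
  have h5 : t ≠ 2 * k := by
    rintro rfl
    have e1 := c.cl_succ_of_not_isOpening h3
    have e2 := c.two_mul_cl_le (show 2 * k + 1 ≤ n by omega)
    simp only at e1
    omega
  obtain ⟨i, rfl⟩ : ∃ i, t = i + 1 := ⟨t - 1, by omega⟩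
  refine ⟨i, h2, by omega, ?_, h3⟩
  by_contra h6
  exact h4 i (by omega) ⟨by omega, by omega, h6⟩


/-- A vector `w` in the image has eigenvalue `q` under the first `r` alternate generators and is
killed by those further right. The eigenvalues reduce its pairings to diagrams starting with `r`
arches; since `r < p`, these have another peak further right, where self-adjointness gives zero. -/
theorem actL_secondBasis_minTensor_of_lt {q : ℝ} (hq : 0 < q) (hΔ : ∀ k : ℕ, k < n → Δ k q ≠ 0)
    {r : ℕ} (hr : 2 * r ≤ n) (h : r < p) (v : U n p) :
    actL q (secondBasis q (Pairing.minTensor n r hr)) v = 0 := by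
  have hT := Pairing.isTensor_minTensor hr
  have hm := isMinimal_minimal hr
  -- For `U(2n; n)` the slope lemma again needs only the indices below `n`.
  have hΔ' : ∀ k : ℕ, k + n < n + n → Δ k q ≠ 0 := fun k hk => hΔ k (by omega)
  set w := actL q (secondBasis q (Pairing.minTensor n r hr)) v with hw
  have hq' : (q : ℂ) ≠ 0 := by exact_mod_cast hq.ne'
  have h1 : ∀ (j : ℕ) (hj : 2 * j + 1 < n), j < r → E q (2 * j) hj w = (q : ℂ) • w := by
    intro j hj hjr
    rw [hw, ← actL_E_left q (2 * j) hj, E_secondBasis_of_peak_zero q, map_smul, LinearMap.smul_apply]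
    · refine (hT.isOpening_left ⟨2 * j, by omega⟩).mpr ((hm.isOpening_iff _).mpr ?_)
      simp
    · refine (hT.isOpening_left ⟨2 * j + 1, by omega⟩).not.mpr ((hm.isOpening_iff _).not.mpr ?_)
      simp
      omega
    · rw [hT.height_eq (by omega), HalfDiagram.height_eq _ (by omega), hm.cl_eq (by omega)]
      push_cast
      omega
  have h2 : ∀ (i : ℕ) (hi : i + 1 < n), 2 * r ≤ i → E q i hi w = 0 := by
    intro i hi hri
    rw [hw, ← actL_E_left q i hi, E_secondBasis_of_isSlope hq.ne' hΔ', map_zero, LinearMap.zero_apply]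
    refine iff_of_true ((hT.isOpening_left ⟨i, by omega⟩).mpr ((hm.isOpening_iff _).mpr ?_))
      ((hT.isOpening_left ⟨i + 1, by omega⟩).mpr ((hm.isOpening_iff _).mpr ?_))
    · simp only; omega
    · simp only; omega
  refine eq_zero_of_formB hq hΔ fun c => ?_
  have h3 := formB_capProd q hr h1 (Pi.single c 1)
  suffices h4 : formB q w (capProd q r hr (Pi.single c 1)) = 0 by
    rw [h4] at h3
    exact (mul_eq_zero.mp h3.symm).resolve_left (pow_ne_zero _ hq')
  generalize hz : capProd q r hr (Pi.single c 1) = z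
  have hz' : z = ∑ b, z b • (Pi.single b 1 : U n p) := by
    funext P; simp [Pi.single_apply]
  rw [hz', map_sum]
  refine Finset.sum_eq_zero fun b _ => ?_
  rw [map_smul]
  by_cases h0 : z b = 0
  · rw [h0, zero_smul]
  · rw [← hz] at h0
    obtain ⟨i, hi, hri, h5, h6⟩ := exists_peak hr h (le_cl_of_forall hr (capProd_apply_ne_zero h0))
    have h7 := formB_E q i hi w (Pi.single b 1)
    rw [h2 i hi hri, E_single_of_peak q h5 h6, map_smul, map_zero, LinearMap.zero_apply] at h7
    rw [(smul_eq_zero.mp h7.symm).resolve_left hq', smul_zero]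

theorem actL_boxOp_left (q : ℝ) (i : ℕ) (hi : i + 1 < n) (h : ℤ) (x : U (n + n) n) (v : U n p) :
    actL q (boxOp q i (by omega) h x) v = boxOp q i hi h (actL q x v) := by
  rw [boxOp, boxOp, map_sub, map_smul, LinearMap.sub_apply, LinearMap.smul_apply, actL_E_left q i hi]

theorem actL_boxOp_right (q : ℝ) (i : ℕ) (hi : i + 1 < n) (h : ℤ) (x : U (n + n) n) (v : U n p) :
    actL q (boxOp q (n + n - 2 - i) (by omega) h x) v = actL q x (boxOp q i hi h v) := by
  rw [boxOp, boxOp, map_sub, map_smul, map_sub, map_smul, LinearMap.sub_apply, LinearMap.smul_apply,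
    actL_E_right q i hi]

theorem formB_boxOp (q : ℝ) (i : ℕ) (hi : i + 1 < n) (h : ℤ) (x y : U n p) :
    formB q (boxOp q i hi h x) y = formB q x (boxOp q i hi h y) := by
  rw [boxOp, boxOp, map_sub, map_smul, map_sub, map_smul, LinearMap.sub_apply, LinearMap.smul_apply,
    formB_E]

theorem actL_secondBasis_of_ne {q : ℝ} (hq : 0 < q) (hΔ : ∀ k : ℕ, k < n → Δ k q ≠ 0) {r : ℕ}
    (hr : r ≠ p) {a b : HalfDiagram n r} {P : Pairing n} (h : Pairing.IsTensor a b P) (v : U n p) :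
    actL q (secondBasis q P) v = 0 := by
  revert v
  refine Pairing.IsTensor.induction
    (motive := fun _ _ P => ∀ v : U n p, actL q (secondBasis q P) v = 0) ?_ ?_ ?_ h
  · intro h v
    rcases lt_or_gt_of_ne hr with h' | h'
    · exact actL_secondBasis_minTensor_of_lt hq hΔ h h' v
    · rw [actL_secondBasis_minTensor h h'.le, capProd_eq_zero q h h', LinearMap.zero_apply]
  · intro i hi a a' b P P' h h' hb hB ih v
    rw [secondBasis_of_isBoxAddition q hB, actL_boxOp_left q i hi, ih, boxOp]
    simp
  · intro i hi a b b' P P' h h' hb hB ih v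
    rw [secondBasis_of_isBoxAddition q hB, actL_boxOp_right q i hi, ih]

/-- The rank-one formula holds for the minimal tensor. A left box acts on `ξ'_a` and a right box on
the argument, where adjointness passes it to `ξ'_b`; the heights agree on both halves. -/
theorem actL_secondBasis {q : ℝ} (hq : q ≠ 0) {a b : HalfDiagram n p} {P : Pairing n}
    (h : Pairing.IsTensor a b P) (v : U n p) :
    actL q (secondBasis q P) v = formB q v (secondBasis q b) • secondBasis q a := by
  revert v
  refine Pairing.IsTensor.induction (motive := fun a b P => ∀ v : U n p,
    actL q (secondBasis q P) v = formB q v (secondBasis q b) • secondBasis q a) ?_ ?_ ?_ h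
  · intro h v
    rw [actL_secondBasis_minTensor h le_rfl, capProd_arches_eq hq]
  · intro i hi a a' b P P' h h' hb hB ih v
    rw [secondBasis_of_isBoxAddition q hB, actL_boxOp_left q i hi, ih,
      secondBasis_of_isBoxAddition q hb, h.height_eq (by omega)]
    rw [boxOp, boxOp, map_smul, smul_sub, smul_comm]
  · intro i hi a b b' P P' h h' hb hB ih v
    rw [secondBasis_of_isBoxAddition q hB, actL_boxOp_right q i hi, ih, formB_boxOp,
      secondBasis_of_isBoxAddition q hb, show n + n - 2 - i + 1 = n + n - (i + 1) by omega,
      h.height_eq_right (by omega)]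

end TemperleyLieb

end

noncomputable section

namespace TemperleyLieb

open HalfDiagram

variable {n p : ℕ}

/-! ### The involution -/

namespace Pairing

theorem capPartner_transpose (P : Pairing n) {u v : Fin (n + n)} (huv : u ≠ v) (j : Fin (n + n)) :
    P.transpose.capPartner u v j = (P.capPartner v.rev u.rev j.rev).rev := by
  have h1 := P.partner_ne u.rev
  have h2 := P.partner_ne v.rev
  have h3 := P.invol j.rev
  have h4 : u.rev ≠ v.rev := fun h => huv (Fin.rev_injective h)
  simp only [capPartner, transpose, Fin.rev_eq_iff, h1, h2, if_false, Fin.rev_rev]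
  split_ifs <;> simp_all

theorem capState_transpose (P : Pairing n) (i : ℕ) (hi : i + 1 < n + n) :
    capState ⟨i, Nat.lt_of_succ_lt hi⟩ ⟨i + 1, hi⟩ rfl P.transpose =
      (capState ⟨n + n - 2 - i, by omega⟩ ⟨n + n - 2 - i + 1, by omega⟩ rfl P).map
        fun r => (r.1.transpose, r.2) := by
  have e1 : (⟨i, Nat.lt_of_succ_lt hi⟩ : Fin (n + n)).rev = ⟨n + n - 2 - i + 1, by omega⟩ := by
    rw [Fin.ext_iff, Fin.val_rev]; simp only; omega
  have e2 : (⟨i + 1, hi⟩ : Fin (n + n)).rev = ⟨n + n - 2 - i, by omega⟩ := by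
    rw [Fin.ext_iff, Fin.val_rev]; simp only; omega
  rw [capState, capState, dif_neg fun h => partner_ne _ _ h.1, dif_neg fun h => partner_ne _ _ h.1,
    Option.map_some, Option.some_inj, Prod.mk.injEq]
  constructor
  · refine HalfDiagram.ext (funext fun j => ?_)
    change capPartner _ _ _ _ = (capPartner _ _ _ _).rev
    rw [capPartner_transpose P (by simp [Fin.ext_iff]), e1, e2]
  · simp only
    congr 1
    rw [eq_iff_iff]
    change (P.partner _).rev = _ ↔ _
    rw [Fin.rev_eq_iff, e1, e2]
    constructor <;>
    · intro h
      rw [← h, P.invol]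

theorem isBoxAddition_transpose {P P' : Pairing n} {i : ℕ} {hi : i + 1 < n + n}
    (h : IsBoxAddition i hi P P') :
    IsBoxAddition (n + n - 2 - i) (by omega) P.transpose P'.transpose := by
  have e1 : (⟨n + n - 2 - i, by omega⟩ : Fin (n + n)).rev = ⟨i + 1, hi⟩ := by
    rw [Fin.ext_iff, Fin.val_rev]; simp only; omega
  have e2 : (⟨n + n - 2 - i + 1, by omega⟩ : Fin (n + n)).rev = ⟨i, Nat.lt_of_succ_lt hi⟩ := by
    rw [Fin.ext_iff, Fin.val_rev]; simp only; omega
  refine ⟨?_, ?_, ?_, ?_, fun j h1 h2 => ?_⟩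
  · rw [isOpening_transpose, e1, not_not]; exact h.2.1
  · rw [isOpening_transpose, e2]; exact h.1
  · rw [isOpening_transpose, e1]; exact h.2.2.2.1
  · rw [isOpening_transpose, e2, not_not]; exact h.2.2.1
  · rw [isOpening_transpose, isOpening_transpose, not_iff_not]
    have := j.isLt
    exact h.2.2.2.2 _ (by rw [Fin.val_rev]; omega) (by rw [Fin.val_rev]; omega)

theorem isMinimal_transpose {P : Pairing n} (h : P.IsMinimal) : P.transpose.IsMinimal := by
  intro i
  have := i.isLt
  change ((P.partner i.rev).rev : ℕ) = _
  rw [Fin.val_rev, h, Fin.val_rev]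
  split_ifs <;> omega

end Pairing

/-- The linear extension of the transposition of pairings. -/
def transposeL : U (n + n) n →ₗ[ℂ] U (n + n) n :=
  LinearMap.funLeft ℂ ℂ HalfDiagram.transpose

theorem transposeL_single (P : Pairing n) :
    transposeL (Pi.single P 1) = (Pi.single P.transpose 1 : U (n + n) n) := by
  funext R
  rw [transposeL, LinearMap.funLeft_apply, Pi.single_apply, Pi.single_apply]
  congr 1
  rw [eq_iff_iff]
  constructor
  · rintro rfl; rw [Pairing.transpose_transpose]
  · rintro rfl; rw [Pairing.transpose_transpose]

theorem transposeL_E (q : ℝ) (i : ℕ) (hi : i + 1 < n + n) (x : U (n + n) n) :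
    transposeL (E q i hi x) = E q (n + n - 2 - i) (by omega) (transposeL x) := by
  suffices h : transposeL ∘ₗ E q i hi = E q (n + n - 2 - i) (by omega) ∘ₗ
      (transposeL : U (n + n) n →ₗ[ℂ] U (n + n) n) from LinearMap.congr_fun h x
  refine U_hom_ext fun P => ?_
  rw [LinearMap.comp_apply, LinearMap.comp_apply, transposeL_single, E_single, E_single,
    Pairing.capState_transpose]
  have e : n + n - 2 - (n + n - 2 - i) = i := by omega
  simp only [e]
  cases capState ⟨i, Nat.lt_of_succ_lt hi⟩ ⟨i + 1, hi⟩ rfl P with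
  | none => simp [State.vec]
  | some r => rw [Option.map_some, State.vec, State.vec, map_smul, transposeL_single]

/-- Reflection fixes the minimal pairing, sends a box at `i` to one at `2n - 2 - i` and preserves
the height of its minimum, so it intertwines the two recursions. -/
theorem secondBasis_transpose (q : ℝ) (P : Pairing n) :
    secondBasis q P.transpose = transposeL (secondBasis q P) := by
  induction P using box_induction with
  | hmin P hP =>
    rw [secondBasis_of_isMinimal q hP, transposeL_single,
      secondBasis_of_isMinimal q (Pairing.isMinimal_transpose hP)]
  | hbox i hi P P' h ih =>
    rw [secondBasis_of_isBoxAddition q h, secondBasis_of_isBoxAddition q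
      (Pairing.isBoxAddition_transpose h), ih, boxOp, boxOp, map_sub, map_smul, transposeL_E]
    have e := Pairing.height_transpose P (k := n + n - 2 - i + 1) (by omega)
    rw [show n + n - (n + n - 2 - i + 1) = i + 1 by omega] at e
    rw [e]

theorem star_ofU_secondBasis (q : ℝ) (P : Pairing n) :
    star (TL.ofU n q (secondBasis q P)) = TL.ofU n q (secondBasis q P.transpose) := by
  rw [secondBasis_transpose]
  conv_rhs => rw [← star_secondBasis]
  rfl

theorem star_TL_add {q : ℝ} (x y : TL n q) : star (x + y) = star x + star y :=
  funext fun P => map_add (starRingEnd ℂ) (x.coeff P.transpose) (y.coeff P.transpose)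

theorem star_TL_smul {q : ℝ} (c : ℂ) (x : TL n q) : star (c • x) = (starRingEnd ℂ) c • star x :=
  funext fun P => map_mul (starRingEnd ℂ) c (x.coeff P.transpose)

theorem star_TL_zero {q : ℝ} : star (0 : TL n q) = 0 :=
  funext fun _ => map_zero (starRingEnd ℂ)

/-! ### The isomorphism with the sum of matrix algebras -/

theorem card_pairing (n : ℕ) :
    Fintype.card (Pairing n) =
      ∑ p : Fin (n / 2 + 1), Fintype.card (HalfDiagram n p) * Fintype.card (HalfDiagram n p) := by
  have h : Fintype.card (Pairing n) =
      Fintype.card ((p : Fin (n / 2 + 1)) × (HalfDiagram n p × HalfDiagram n p)) := by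
    choose f hf hf' using fun P : Pairing n => Pairing.existsUnique_sigma P
    refine Fintype.card_of_bijective (f := f) ⟨fun P Q hPQ => ?_, fun t => ?_⟩
    · have h1 := hf P
      rw [hPQ] at h1
      exact h1.unique (hf Q)
    · obtain ⟨P, hP⟩ := Pairing.exists_isTensor_pair t.2.1 t.2.2
      exact ⟨P, (hf' P t hP).symm⟩
  rw [h, Fintype.card_sigma]
  simp only [Fintype.card_prod]

theorem finrank_MatSum (n : ℕ) : Module.finrank ℂ (MatSum n) = Fintype.card (Pairing n) := by
  rw [Module.finrank_pi_fintype, card_pairing]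
  simp only [Module.finrank_matrix, Module.finrank_self, mul_one]

theorem MatSum.eq_sum (M : MatSum n) : M = ∑ p, ∑ a, ∑ b, elem p a b (M p a b) := by
  have h : ∀ p, ∑ a, ∑ b, elem p a b (M p a b) = Pi.single p (M p) := by
    intro p
    conv_rhs => rw [Matrix.matrix_eq_sum_single (M p)]
    simp only [elem]
    funext r
    by_cases hr : r = p
    · subst hr
      simp only [Finset.sum_apply, Pi.single_eq_same]
    · simp only [Finset.sum_apply, Pi.single_eq_of_ne hr, Finset.sum_const_zero]
  simp only [h]
  exact (Finset.univ_sum_single M).symm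

section Isomorphism

variable {q : ℝ} (hq : 0 < q) (hΔ : ∀ k : ℕ, k < n → Δ k q ≠ 0)
  (s : ∀ p : Fin (n / 2 + 1), HalfDiagram n p → ℂ) (hs : ∀ p a, s p a ≠ 0)

/-- The basis of `U(n; p)` that consists of multiples of the elements of the second basis. -/
def scaledBasis (p : Fin (n / 2 + 1)) : Module.Basis (HalfDiagram n p) ℂ (U n p) :=
  (Module.Basis.mk (linearIndependent_secondBasis hq hΔ) (span_secondBasis hq hΔ).ge).isUnitSMul
    (w := fun a => (s p a)⁻¹) fun a => (inv_ne_zero (hs p a)).isUnit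

theorem scaledBasis_apply (p : Fin (n / 2 + 1)) (a : HalfDiagram n p) :
    scaledBasis hq hΔ s hs p a = (s p a)⁻¹ • secondBasis q a := by
  rw [scaledBasis, Module.Basis.isUnitSMul_apply, Module.Basis.mk_apply]

/-- The matrices of the action. -/
def matrixHom : U (n + n) n →ₗ[ℂ] MatSum n :=
  LinearMap.pi fun p => (LinearMap.toMatrix (scaledBasis hq hΔ s hs p)
    (scaledBasis hq hΔ s hs p)).toLinearMap ∘ₗ actL q

theorem matrixHom_apply (x : U (n + n) n) (p : Fin (n / 2 + 1)) : matrixHom hq hΔ s hs x p =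
    LinearMap.toMatrix (scaledBasis hq hΔ s hs p) (scaledBasis hq hΔ s hs p) (actL q x) := rfl

/-- The scalar serves both normalisations: it is `N_b` for `s = 1`, and `s_a s_b` if `s_b ^ 2 =
N_b`. -/
theorem matrixHom_secondBasis {p : Fin (n / 2 + 1)} {a b : HalfDiagram n p} {P : Pairing n}
    (h : Pairing.IsTensor a b P) :
    matrixHom hq hΔ s hs (secondBasis q P) = elem p a b (normSq q b * s p a * (s p b)⁻¹) := by
  funext r
  rw [matrixHom_apply, elem]
  by_cases hr : r = p
  · subst hr
    rw [Pi.single_eq_same]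
    ext c d
    have e : secondBasis q a = s r a • scaledBasis hq hΔ s hs r a := by
      rw [scaledBasis_apply, smul_smul, mul_inv_cancel₀ (hs r a), one_smul]
    rw [LinearMap.toMatrix_apply, actL_secondBasis hq.ne' h, scaledBasis_apply, map_smul, e,
      map_smul, map_smul, Module.Basis.repr_self, LinearMap.smul_apply]
    by_cases hd : b = d
    · subst hd
      by_cases hc : a = c
      · subst hc
        simp [normSq]
        ring
      · simp [hc]
    · rw [formB_secondBasis_of_ne hq.ne' (fun k hk => hΔ k (by omega)) hd]
      simp [hd]
  · rw [Pi.single_eq_of_ne hr]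
    have h0 : actL q (secondBasis q P) = (0 : U n r →ₗ[ℂ] U n r) :=
      LinearMap.ext fun v => actL_secondBasis_of_ne hq hΔ (fun h => hr (Fin.ext h.symm)) h v
    rw [h0, map_zero]

/-- Keeping the preimage in the span of the second basis lets injectivity later show that this span
is everything. -/
theorem matrixHom_surjective_span (M : MatSum n) :
    ∃ x ∈ Submodule.span ℂ (Set.range (secondBasis q : Pairing n → U (n + n) n)),
      matrixHom hq hΔ s hs x = M := by
  change M ∈ (Submodule.span ℂ (Set.range (secondBasis q : Pairing n → U (n + n) n))).map
    (matrixHom hq hΔ s hs)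
  rw [MatSum.eq_sum M]
  refine Submodule.sum_mem _ fun p _ => Submodule.sum_mem _ fun a _ => Submodule.sum_mem _ fun b _ => ?_
  obtain ⟨P, hP⟩ := Pairing.exists_isTensor_pair a b
  have hc : normSq q b * s p a * (s p b)⁻¹ ≠ 0 :=
    mul_ne_zero (mul_ne_zero (normSq_ne_zero hq hΔ b) (hs p a)) (inv_ne_zero (hs p b))
  refine ⟨(M p a b / (normSq q b * s p a * (s p b)⁻¹)) • secondBasis q P,
    Submodule.smul_mem _ _ (Submodule.subset_span ⟨P, rfl⟩), ?_⟩
  rw [map_smul, matrixHom_secondBasis hq hΔ s hs hP, elem, elem, ← Pi.single_smul, Matrix.smul_single,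
    smul_eq_mul, div_mul_cancel₀ _ hc]

theorem matrixHom_bijective : Function.Bijective (matrixHom hq hΔ s hs) := by
  have h : Function.Surjective (matrixHom hq hΔ s hs) := fun M =>
    let ⟨x, _, hx⟩ := matrixHom_surjective_span hq hΔ s hs M
    ⟨x, hx⟩
  refine ⟨(LinearMap.injective_iff_surjective_of_finrank_eq_finrank ?_).mpr h, h⟩
  rw [finrank_MatSum, Module.finrank_fintype_fun_eq_card]

/-- The isomorphism given by the matrices of the action. -/
def matrixIso : TL n q ≃ₗ[ℂ] MatSum n :=
  (TL.ofU n q).symm ≪≫ₗ LinearEquiv.ofBijective _ (matrixHom_bijective hq hΔ s hs)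

theorem matrixIso_ofU (x : U (n + n) n) :
    matrixIso hq hΔ s hs (TL.ofU n q x) = matrixHom hq hΔ s hs x := rfl

theorem isAlgIso_matrixIso : IsAlgIso (matrixIso hq hΔ s hs) := by
  constructor
  · change matrixHom hq hΔ s hs (Pi.single (Pairing.one n) 1) = 1
    funext p
    have h : actL q (Pi.single (Pairing.one n) 1) = (LinearMap.id : U n p →ₗ[ℂ] U n p) :=
      LinearMap.ext fun v => actL_one q v
    rw [matrixHom_apply, h, LinearMap.toMatrix_id]
    rfl
  · intro x y
    change matrixHom hq hΔ s hs (mulL q x y) = matrixHom hq hΔ s hs x * matrixHom hq hΔ s hs y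
    funext p
    have h : actL q (mulL q x y) = (actL q x ∘ₗ actL q y : U n p →ₗ[ℂ] U n p) :=
      LinearMap.ext fun v => actL_mulL hq.ne' x y v
    rw [matrixHom_apply, h, LinearMap.toMatrix_comp _ (scaledBasis hq hΔ s hs p)]
    rfl

theorem actL_scaledBasis (x : U (n + n) n) (p : Fin (n / 2 + 1)) (c : HalfDiagram n p) :
    actL q x (scaledBasis hq hΔ s hs p c) =
      ∑ a, matrixHom hq hΔ s hs x p a c • scaledBasis hq hΔ s hs p a := by
  rw [matrixHom_apply]
  simp only [LinearMap.toMatrix_apply]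
  exact ((scaledBasis hq hΔ s hs p).sum_repr _).symm

theorem isMatrixOfAction_matrixIso :
    IsMatrixOfAction (fun p a => (s p a)⁻¹ • secondBasis q a) (matrixIso hq hΔ s hs) := by
  intro x p c
  have h := actL_scaledBasis hq hΔ s hs ((TL.ofU n q).symm x) p c
  simp only [scaledBasis_apply] at h
  exact h

end Isomorphism

/-- Orthogonality in `U(2n; n)` would not suffice, since nonvanishing of the norms is known only for
`Δ_k` with `k < n`; the isomorphism replaces it. -/
theorem span_secondBasis_pairing {q : ℝ} (hq : 0 < q) (hΔ : ∀ k : ℕ, k < n → Δ k q ≠ 0) :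
    Submodule.span ℂ (Set.range (secondBasis q : Pairing n → U (n + n) n)) = ⊤ := by
  have hs : ∀ (p : Fin (n / 2 + 1)) (a : HalfDiagram n p), (1 : ℂ) ≠ 0 := fun _ _ => one_ne_zero
  rw [eq_top_iff]
  intro x _
  obtain ⟨y, hy, h⟩ := matrixHom_surjective_span hq hΔ (fun _ _ => 1) hs
    (matrixHom hq hΔ (fun _ _ => 1) hs x)
  rwa [← (matrixHom_bijective hq hΔ (fun _ _ => 1) hs).1 h]

theorem linearIndependent_secondBasis_pairing {q : ℝ} (hq : 0 < q)
    (hΔ : ∀ k : ℕ, k < n → Δ k q ≠ 0) :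
    LinearIndependent ℂ (secondBasis q : Pairing n → U (n + n) n) :=
  linearIndependent_of_top_le_span_of_card_eq_finrank (span_secondBasis_pairing hq hΔ).ge
    (Module.finrank_fintype_fun_eq_card ℂ).symm

/-! ### Signs -/

/-- A square root of a real number is real or purely imaginary according to its sign: `conj z * z =
|r|` while `z ^ 2 = r`. -/
theorem conj_mul_sgn {r : ℝ} {z : ℂ} (h : z ^ 2 = r) : (starRingEnd ℂ) z * sgn r = z := by
  rcases eq_or_ne z 0 with rfl | hz
  · simp
  have h1 : (starRingEnd ℂ) z * z = ((|r| : ℝ) : ℂ) := by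
    rw [mul_comm, Complex.mul_conj, Complex.normSq_eq_norm_sq, ← norm_pow, h, Complex.norm_real,
      Real.norm_eq_abs]
  refine mul_right_cancel₀ hz ?_
  rw [mul_right_comm, h1, ← sq, h, sgn, Complex.ofReal_re]
  split_ifs with h2
  · rw [abs_of_pos h2, mul_one]
  · rw [abs_of_nonpos (not_lt.mp h2)]
    push_cast
    ring

theorem form_secondBasis (q : ℝ) (a b : HalfDiagram n p) :
    form q (secondBasis q a) (secondBasis q b) = formB q (secondBasis q a) (secondBasis q b) := by
  rw [form_eq, star_secondBasis]

theorem form_smul_smul (q : ℝ) (c d : ℂ) (x y : U n p) :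
    form q (c • x) (d • y) = c * (starRingEnd ℂ) d * form q x y := by
  rw [form_eq, form_eq, star_smul, map_smul, map_smul, LinearMap.smul_apply]
  simp only [smul_eq_mul, mul_assoc, starRingEnd_apply]
  ring

end TemperleyLieb

end

/-! ### Assembly of the theorem -/

open TemperleyLieb in
theorem mainTheorem3 (n : ℕ) (q : ℝ) (hq : 0 < q) (hΔ : ∀ k : ℕ, k < n → Δ k q ≠ 0) :
    -- the sizes of the matrix algebras
    (∀ p : Fin (n / 2 + 1), (Fintype.card (HalfDiagram n p) : ℤ) = genCatalan n p) ∧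
    -- `a ⊗ b` is defined, and every pairing is of this form in exactly one way
    (∀ (p : Fin (n / 2 + 1)) (a b : HalfDiagram n p), ∃! P : Pairing n, Pairing.IsTensor a b P) ∧
    (∀ P : Pairing n, ∃! t : (p : Fin (n / 2 + 1)) × (HalfDiagram n p × HalfDiagram n p),
      Pairing.IsTensor t.2.1 t.2.2 P) ∧
    -- the second bases are well defined
    (∀ p : Fin (n / 2 + 1), ∃! F : HalfDiagram n p → U n p, IsSecondBasis q F) ∧
    (∃! F : HalfDiagram (n + n) n → U (n + n) n, IsSecondBasis q F) ∧
    ∀ (ξ' : ∀ p : Fin (n / 2 + 1), HalfDiagram n p → U n p) (η' : Pairing n → U (n + n) n)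
      (e' : Pairing n → TL n q) (N : ∀ p : Fin (n / 2 + 1), HalfDiagram n p → ℂ),
      (∀ p, IsSecondBasis q (ξ' p)) → IsSecondBasis q η' →
      (∀ P, e' P = TL.ofU n q (η' P)) →
      (∀ p a, N p a = form q (ξ' p a) (ξ' p a)) →
      -- they are bases, and the norms are nonzero real numbers
      (∀ p, LinearIndependent ℂ (ξ' p) ∧ Submodule.span ℂ (Set.range (ξ' p)) = ⊤) ∧
      (LinearIndependent ℂ e' ∧ Submodule.span ℂ (Set.range e') = ⊤) ∧
      (∀ p a, N p a ≠ 0 ∧ (N p a).im = 0) ∧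
      -- the action of `e'_{a ⊗ b}` on the basis elements `ξ'_c`
      (∀ (p : Fin (n / 2 + 1)) (a b : HalfDiagram n p) P, Pairing.IsTensor a b P →
        act (e' P) (ξ' p b) = N p b • ξ' p a ∧
        ∀ (p' : Fin (n / 2 + 1)) (c : HalfDiagram n p'), (⟨p', c⟩ : (r : Fin (n / 2 + 1)) × HalfDiagram n r) ≠ ⟨p, b⟩ →
          act (e' P) (ξ' p' c) = 0) ∧
      -- the involution
      (∀ (p : Fin (n / 2 + 1)) (a b : HalfDiagram n p) P Q, Pairing.IsTensor a b P → Pairing.IsTensor b a Q →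
        star (e' P) = e' Q) ∧
      -- the isomorphism given by the matrices with respect to the bases `ξ'`
      (∃ Φ : TL n q ≃ₗ[ℂ] MatSum n, IsAlgIso Φ ∧ IsMatrixOfAction ξ' Φ ∧
        ∀ (p : Fin (n / 2 + 1)) (a b : HalfDiagram n p) P, Pairing.IsTensor a b P → Φ (e' P) = elem p a b (N p b)) ∧
      -- the isomorphism given by the bases normalised by square roots `s` of the norms
      (∀ s : ∀ p : Fin (n / 2 + 1), HalfDiagram n p → ℂ, (∀ p a, s p a ^ 2 = N p a) →
        (∀ p a b, form q ((s p a)⁻¹ • ξ' p a) ((s p b)⁻¹ • ξ' p b) =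
          if a = b then sgn (N p a) else 0) ∧
        ∃ Φ : TL n q ≃ₗ[ℂ] MatSum n, IsAlgIso Φ ∧
          IsMatrixOfAction (fun p a => (s p a)⁻¹ • ξ' p a) Φ ∧
          (∀ (p : Fin (n / 2 + 1)) (a b : HalfDiagram n p) P, Pairing.IsTensor a b P →
            Φ (e' P) = elem p a b (s p a * s p b) ∧
            Φ (star (e' P)) = elem p b a (s p a * s p b)) ∧
          -- `Φ (star x)` is the adjoint of `Φ x` for the form of the normalised bases
          (∀ x p, Φ (star x) p = Matrix.diagonal (fun a => sgn (N p a)) * (Φ x p).conjTranspose *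
            Matrix.diagonal (fun a => sgn (N p a))) ∧
          -- the positive case
          ((∀ k : ℕ, k < n → 0 < Δ k q) →
            ∀ x p, Φ (star x) p = (Φ x p).conjTranspose)) := by
  have hcard : ∀ p : Fin (n / 2 + 1), (Fintype.card (HalfDiagram n p) : ℤ) = genCatalan n p :=
    HalfDiagram.card_eq_genCatalan
  refine ⟨hcard, fun p a b => ?_, Pairing.existsUnique_sigma, fun p => existsUnique_isSecondBasis q,
    existsUnique_isSecondBasis q, ?_⟩
  · obtain ⟨P, hP⟩ := Pairing.exists_isTensor_pair a b
    exact ⟨P, hP, fun Q hQ => hQ.unique hP⟩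
  intro ξ' η' e' N hξ hη he hN
  obtain rfl : ξ' = fun p => secondBasis q := funext fun p => (hξ p).eq
  obtain rfl := hη.eq
  obtain rfl : e' = fun P => TL.ofU n q (secondBasis q P) := funext he
  obtain rfl : N = fun p a => normSq q a := funext fun p => funext fun a => by
    rw [hN, form_secondBasis, normSq]
  have hreal : ∀ (p : Fin (n / 2 + 1)) (a : HalfDiagram n p), ∃ r : ℝ, normSq q a = r ∧ r ≠ 0 ∧
      ((∀ k : ℕ, k < n → 0 < Δ k q) → 0 < r) := fun p a => exists_normSq_eq hq hΔ a
  have hne : ∀ (p : Fin (n / 2 + 1)) (a : HalfDiagram n p), normSq q a ≠ 0 :=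
    fun p a => normSq_ne_zero hq hΔ a
  have hspan : Submodule.span ℂ (Set.range fun P => TL.ofU n q (secondBasis q P)) = ⊤ :=
    span_secondBasis_pairing hq hΔ
  have hstar : ∀ (p : Fin (n / 2 + 1)) (a b : HalfDiagram n p) P Q, Pairing.IsTensor a b P →
      Pairing.IsTensor b a Q → star (TL.ofU n q (secondBasis q P)) = TL.ofU n q (secondBasis q Q) := by
    intro p a b P Q hP hQ
    rw [star_ofU_secondBasis, hP.transpose.unique hQ]
  refine ⟨fun p => ⟨linearIndependent_secondBasis hq hΔ, span_secondBasis hq hΔ⟩,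
    ⟨linearIndependent_secondBasis_pairing hq hΔ, hspan⟩, fun p a => ⟨hne p a, ?_⟩, ?_, hstar, ?_, ?_⟩
  · obtain ⟨r, e, -⟩ := hreal p a
    simp only [e, Complex.ofReal_im]
  · intro p a b P hP
    refine ⟨actL_secondBasis hq.ne' hP _, fun p' c hc => ?_⟩
    rw [act_ofU]
    by_cases hp : p = p'
    · subst hp
      have hcb : b ≠ c := by rintro rfl; exact hc rfl
      rw [actL_secondBasis hq.ne' hP, formB_secondBasis_of_ne hq.ne' (fun k hk => hΔ k (by omega)) hcb,
        zero_smul]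
    · exact actL_secondBasis_of_ne hq hΔ (fun h => hp (Fin.ext h)) hP _
  · have hs : ∀ (p : Fin (n / 2 + 1)) (a : HalfDiagram n p), (1 : ℂ) ≠ 0 := fun _ _ => one_ne_zero
    refine ⟨matrixIso hq hΔ (fun _ _ => 1) hs, isAlgIso_matrixIso hq hΔ _ hs, ?_, fun p a b P hP => ?_⟩
    · have h := isMatrixOfAction_matrixIso hq hΔ (fun _ _ => 1) hs
      simpa only [inv_one, one_smul] using h
    · rw [matrixIso_ofU, matrixHom_secondBasis hq hΔ _ hs hP, mul_one, inv_one, mul_one]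
  intro s hsN
  have hs : ∀ p a, s p a ≠ 0 := by
    intro p a h0
    have h := hsN p a
    rw [h0, zero_pow two_ne_zero] at h
    exact hne p a h.symm
  have hsgn : ∀ p a, (starRingEnd ℂ) (s p a) * sgn (normSq q a) = s p a := by
    intro p a
    obtain ⟨r, e, -⟩ := hreal p a
    have h := hsN p a
    simp only [e] at h ⊢
    exact conj_mul_sgn h
  have hΦ : ∀ (p : Fin (n / 2 + 1)) (a b : HalfDiagram n p) P, Pairing.IsTensor a b P →
      matrixIso hq hΔ s hs (TL.ofU n q (secondBasis q P)) = elem p a b (s p a * s p b) := by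
    intro p a b P hP
    rw [matrixIso_ofU, matrixHom_secondBasis hq hΔ s hs hP, show normSq q b = s p b ^ 2 from (hsN p b).symm]
    congr 1
    have := hs p b
    field_simp
  -- Both sides are conjugate-linear in `x`, so it suffices to compare them on the spanning elements
  -- `e'_P`, where the signs absorb the conjugates of `s_a` and `s_b`.
  have hadj : ∀ x p, matrixIso hq hΔ s hs (star x) p = Matrix.diagonal (fun a => sgn (normSq q a)) *
      (matrixIso hq hΔ s hs x p).conjTranspose * Matrix.diagonal (fun a => sgn (normSq q a)) := by
    intro x p
    induction (hspan ▸ Submodule.mem_top : x ∈ Submodule.span ℂ _) using Submodule.span_induction with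
    | mem x hx =>
      obtain ⟨P, rfl⟩ := hx
      obtain ⟨⟨r, a, b⟩, hP⟩ := Pairing.exists_isTensor P
      rw [hstar r a b P _ hP hP.transpose, hΦ r b a _ hP.transpose, hΦ r a b _ hP, elem, elem]
      by_cases hr : p = r
      · subst hr
        rw [Pi.single_eq_same, Pi.single_eq_same, Matrix.conjTranspose_single]
        ext c d
        rw [Matrix.mul_diagonal, Matrix.diagonal_mul, Matrix.single_apply, Matrix.single_apply]
        by_cases h : b = c ∧ a = d
        · obtain ⟨rfl, rfl⟩ := h
          simp only [and_self, if_true, star_mul']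
          have e1 := hsgn p a
          have e2 := hsgn p b
          rw [starRingEnd_apply] at e1 e2
          rw [mul_comm (sgn _), mul_assoc, mul_assoc]
          conv_lhs => rw [← e1, ← e2]
          ring
        · rw [if_neg h, if_neg h, mul_zero, zero_mul]
      · rw [Pi.single_eq_of_ne hr, Pi.single_eq_of_ne hr, Matrix.conjTranspose_zero, Matrix.mul_zero,
          Matrix.zero_mul]
    | zero => simp [star_TL_zero]
    | add x y _ _ hx hy =>
      rw [star_TL_add, map_add, map_add, Pi.add_apply, Pi.add_apply, hx, hy, Matrix.conjTranspose_add,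
        Matrix.mul_add, Matrix.add_mul]
    | smul c x _ hx =>
      rw [star_TL_smul, map_smul, map_smul, Pi.smul_apply, Pi.smul_apply, hx,
        Matrix.conjTranspose_smul, Matrix.mul_smul, Matrix.smul_mul, starRingEnd_apply]
  refine ⟨fun p a b => ?_, matrixIso hq hΔ s hs, isAlgIso_matrixIso hq hΔ s hs,
    isMatrixOfAction_matrixIso hq hΔ s hs, fun p a b P hP => ⟨hΦ p a b P hP, ?_⟩, hadj, fun hpos x p => ?_⟩
  · rw [form_smul_smul, form_secondBasis]
    by_cases hab : a = b
    · subst hab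
      have h0 : (starRingEnd ℂ) (s p a) ≠ 0 := (map_ne_zero _).mpr (hs p a)
      have e : formB q (secondBasis q a) (secondBasis q a) =
          s p a * ((starRingEnd ℂ) (s p a) * sgn (normSq q a)) := by
        rw [hsgn p a, ← sq]
        exact (hsN p a).symm
      rw [if_pos rfl, e, map_inv₀]
      field_simp [hs p a]
    · rw [if_neg hab, formB_secondBasis_of_ne hq.ne' (fun k hk => hΔ k (by omega)) (Ne.symm hab),
        mul_zero]
  · rw [star_ofU_secondBasis, hΦ p b a _ hP.transpose, mul_comm]
  · have h1 : (fun a : HalfDiagram n p => sgn (normSq q a)) = fun _ => 1 := by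
      funext a
      obtain ⟨r, e, -, hr⟩ := hreal p a
      rw [e, sgn, Complex.ofReal_re, if_pos (hr hpos)]
    rw [hadj, h1, Matrix.diagonal_one, Matrix.one_mul, Matrix.mul_one]
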